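/- Let $d\ge 2$, let $O$ be a compact connected orientable surface (possibly with boundary), and let $Y$ be homeomorphic to a sphere or a torus. Let $O_1$ be $O$ minus an open disc, and let $Y^d$ be $Y$ minus $d+1$ open discs, with boundary circles $b_0$ (the top one) and $b_1,\dots,b_d$; fix orientation-reversing homeomorphisms $\mu_i:b_0\to b_i$ and parametrizations of the $b_i$ compatible with them. The Cantor surface $\mathcal C=\mathcal C_d(O,Y)$ is obtained from $O_1$ and copies $B_v$ of $Y^d$ ("blocks"), one for each finite word $v$ in $d$ letters, by gluing the top boundary of $B_\emptyset$ to the new boundary circle of $O_1$, and the top boundary of $B_{vi}$ to the boundary component $b_i$ of $B_v$ by $\mu_i$. Let $\iota_B:B\to Y^d$ be the identification of the block $B$ with $Y^d$. A suited subsurface is a connected union $Z$ of $O_1$ and finitely many blocks; its suited boundary components are its boundary components that are not in $\partial O$. They are the top boundaries of the blocks $B_a$, where $a$ runs through the leaves of the finite rooted subtree $\tau(Z)$ of the infinite rooted $d$-ary tree $\mathcal T_d$ of finite words whose non-leaf vertices are the words of the blocks in $Z$. Let $\mathrm{Map}_\partial(Y^d,b_0)$ be the group of orientation-preserving homeomorphisms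 of $Y^d$ that respect the boundary parametrizations and are the identity on $b_0$, modulo isotopies fixing $\partial Y^d$ pointwise, and let $q:\mathrm{Map}_\partial(Y^d,b_0)\to \mathrm{Sym}(d)$ record the permutation of $b_1,\dots,b_d$. Let $H\le \mathrm{Map}_\partial(Y^d,b_0)$ and $\bar H=q(H)$. A homeomorphism $f$ of $\mathcal C$ that fixes $\partial\mathcal C$ pointwise is $H$-block, with defining surface $Z$ and label $\mathbf h=(h_a)$, if $Z$ and $f(Z)$ are suited, $f$ sends blocks outside $Z$ to blocks outside $f(Z)$, and for every suited boundary component $a$ of $Z$ there is $h_a\in H$ with $[\iota_{f(B)}\circ f\circ\iota_B^{-1}]=h_a$ for every block $B$ in the component of $\mathcal C\setminus Z$ adjacent to $a$. Let $\mathfrak B_d(H)$ be the set of isotopy classes (rel $\partial\mathcal C$) of $H$-block homeomorphisms. For a subgroup $G\le\mathrm{Sym}(d)$ let $V_d(G)$ be the set of homeomorphisms $\psi$ of the Cantor set $\{1,\dots,d\}^{\mathbb N}$ that have a symmetric tree-pair representative $(F_-,(b,\mathbf g),F_+)$: $F_\pm$ are finite complete rooted subtrees of $\mathcal T_d$, $b$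 is a bijection from the leaves of $F_-$ to those of $F_+$, $g_l\in G$ for each leaf $l$ of $F_-$, and $\psi(l\,t_1t_2t_3\dots)=b(l)\,g_l(t_1)\,g_l(t_2)\,g_l(t_3)\dots$ for all leaves $l$ and all infinite words $t$. Then $\mathfrak B_d(H)$ and $V_d(\bar H)$ are groups under composition, and there is a surjective homomorphism $$\pi:\mathfrak B_d(H)\to V_d(\bar H)$$ such that, if $f$ is an $H$-block homeomorphism with defining surface $Z$ and label $\mathbf h$, and $b_f$ is the bijection that $f$ induces between the suited boundary components of $Z$ and of $f(Z)$, then $(\tau(Z),(b_f,q(\mathbf h)),\tau(f(Z)))$ is a symmetric tree-pair representative of $\pi([f])$. Moreover $\pi([f])$ is the action of $f$ on the ends of $\mathcal C$: for every infinite word $c$ and every $n$ there is an $m$ such that $f$ maps the union of the blocks whose words begin with $c_1\dots c_m$ into the union of the blocks whose words begin with the first $n$ letters of $\pi([f])(c)$. -/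

import Mathlib

open Topology

noncomputable section

namespace CantorSurf

/-! ### Surfaces -/

/-- The closed upper half-plane, the local model of a surface with boundary. -/
abbrev HalfPlane : Type := {z : ℂ // 0 ≤ z.im}

/-- `T` preserves orientation at interior points: around every interior point `x` of its domain,
the image of each small circle centred at `x`, run through once counterclockwise, winds exactly
once counterclockwise around `T x` (`a` is a continuous choice of argument along the image). -/
def OrientationPreserving (T : OpenPartialHomeomorph HalfPlane HalfPlane) : Prop :=
  ∀ x ∈ T.source, 0 < (x : ℂ).im → ∀ᶠ r : ℝ in 𝓝[>] 0,
    ∃ a : ℝ → ℝ, Continuous a ∧ (∀ θ, a (θ + 2 * Real.pi) = a θ + 2 * Real.pi) ∧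
      ∀ θ : ℝ, ∃ y ∈ T.source, (y : ℂ) = x + r * Complex.exp (θ * Complex.I) ∧
        ∃ ρ : ℝ, 0 < ρ ∧ (T y : ℂ) = T x + ρ * Complex.exp (a θ * Complex.I)

/-- `X` is locally homeomorphic to the half-plane, and orientable: it has an atlas whose
transition maps preserve orientation. -/
def IsOrientableSurface (X : Type*) [TopologicalSpace X] : Prop :=
  ∃ c : ChartedSpace HalfPlane X, ∀ e ∈ c.atlas, ∀ e' ∈ c.atlas,
    OrientationPreserving (e.symm.trans e')

/-- The boundary of a surface: the points without a neighbourhood homeomorphic to the plane. -/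
def surfaceBoundary (X : Type*) [TopologicalSpace X] : Set X :=
  {x | ¬ ∃ e : ℂ → X, IsOpenEmbedding e ∧ x ∈ Set.range e}

/-- `Y` is homeomorphic to a sphere or to a torus. -/
def IsSphereOrTorus (Y : Type*) [TopologicalSpace Y] : Prop :=
  Nonempty (Y ≃ₜ Metric.sphere (0 : EuclideanSpace ℝ (Fin 3)) 1) ∨
    Nonempty (Y ≃ₜ Circle × Circle)

/-- A coordinate plane in `X`: a homeomorphism of `ℂ` onto an open subset of `X`. -/
structure CoordPlane (X : Type*) [TopologicalSpace X] where
  toFun : ℂ → X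
  isOpenEmbedding : IsOpenEmbedding toFun

/-! ### Isotopy and mapping class groups -/

section Isotopy

variable {S : Type*} [TopologicalSpace S]

/-- The homeomorphisms of `S` that are isotopic to the identity by an isotopy that fixes `A`
pointwise; an isotopy is given by a level-preserving homeomorphism of `S × [0,1]`. -/
def isotopicToId (A : Set S) : Subgroup (S ≃ₜ S) where
  carrier := {h | ∃ Φ : S × unitInterval ≃ₜ S × unitInterval,
    (∀ p, (Φ p).2 = p.2) ∧ (∀ x, Φ (x, 0) = (x, 0)) ∧ (∀ x, Φ (x, 1) = (h x, 1)) ∧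
      ∀ x ∈ A, ∀ t, Φ (x, t) = (x, t)}
  one_mem' := ⟨Homeomorph.refl _, fun _ => rfl, fun _ => rfl, fun _ => rfl, fun _ _ _ => rfl⟩
  mul_mem' := by
    rintro f g ⟨Φ, h1, h2, h3, h4⟩ ⟨Ψ, k1, k2, k3, k4⟩
    refine ⟨Ψ.trans Φ, fun p => ?_, fun x => ?_, fun x => ?_, fun x hx t => ?_⟩
    · simp [h1, k1]
    · simp [h2, k2]
    · simp [h3, k3, Homeomorph.mul_apply]
    · simp [h4 x hx, k4 x hx]
  inv_mem' := by
    rintro f ⟨Φ, h1, h2, h3, h4⟩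
    refine ⟨Φ.symm, fun p => ?_, fun x => ?_, fun x => ?_, fun x hx t => ?_⟩
    · simpa using (h1 (Φ.symm p)).symm
    · exact (Homeomorph.symm_apply_eq _).2 (h2 x).symm
    · rw [Homeomorph.symm_apply_eq, h3]
      exact congrArg (fun y => (y, (1 : unitInterval))) (f.apply_symm_apply x).symm
    · exact (Homeomorph.symm_apply_eq _).2 (h4 x hx t).symm

theorem isotopicToId_fix {A : Set S} {h : S ≃ₜ S} (hh : h ∈ isotopicToId A) {x : S} (hx : x ∈ A) :
    h x = x := by
  obtain ⟨Φ, -, -, h3, h4⟩ := hh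
  exact congrArg Prod.fst ((h3 x).symm.trans (h4 x hx 1))

theorem isotopicToId_conj {A : Set S} {h g : S ≃ₜ S} (hh : h ∈ isotopicToId A)
    (hg : ∀ x ∈ A, g⁻¹ x ∈ A) : g * h * g⁻¹ ∈ isotopicToId A := by
  obtain ⟨Φ, h1, h2, h3, h4⟩ := hh
  have hgg : ∀ x, g (g.symm x) = x := g.apply_symm_apply
  refine ⟨((g.symm.prodCongr (Homeomorph.refl _)).trans Φ).trans
    (g.prodCongr (Homeomorph.refl _)), fun p => ?_, fun x => ?_, fun x => ?_, fun x hx t => ?_⟩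
  · simp [h1]
  · simp [h2]
  · have h5 := h3 (g.symm x)
    simp [h5, Homeomorph.mul_apply]
  · have := h4 (g.symm x) (hg x hx) t
    simp [this]

theorem normal_subgroupOf_isotopicToId (A : Set S) (G : Subgroup (S ≃ₜ S))
    (hG : ∀ g ∈ G, ∀ x ∈ A, g x ∈ A) : ((isotopicToId A).subgroupOf G).Normal := by
  refine ⟨fun h hh g => ?_⟩
  rw [Subgroup.mem_subgroupOf] at hh ⊢
  exact isotopicToId_conj hh fun x hx => hG _ (G.inv_mem g.2) x hx

/-- The homeomorphisms that fix `A` pointwise. -/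
def fixingHomeo (A : Set S) : Subgroup (S ≃ₜ S) where
  carrier := {h | ∀ x ∈ A, h x = x}
  one_mem' := fun _ _ => rfl
  mul_mem' := fun {f g} hf hg x hx => by rw [Homeomorph.mul_apply, hg x hx, hf x hx]
  inv_mem' := fun {f} hf x hx => (Homeomorph.symm_apply_eq f).2 (hf x hx).symm

end Isotopy

/-! ### The block `Y^d` -/

section Block

variable (d : ℕ) {Y : Type*} [TopologicalSpace Y] (w : CoordPlane Y)

/-- The surface `Y^d`, obtained from `Y` by removing the `d + 1` open discs that correspond, in
the coordinate plane `w`, to the discs of radius one around `0, 3, 6, …, 3 d`. As `w` is arbitrary,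
so are the discs and their boundary parametrizations (below). -/
def Block : Type _ := {y : Y // ∀ i : Fin (d + 1), y ∉ w.toFun '' Metric.ball (3 * (i : ℂ)) 1}

instance : TopologicalSpace (Block d w) := instTopologicalSpaceSubtype

variable {d}

theorem three_mul_add_not_mem_ball (i j : Fin (d + 1)) {z : ℂ} (hz : ‖z‖ = 1) :
    3 * (i : ℂ) + z ∉ Metric.ball (3 * (j : ℂ)) 1 := by
  rw [Metric.mem_ball, dist_eq_norm, not_lt]
  by_cases h : i = j
  · subst h; simp [hz]
  · have h1 : (1 : ℝ) ≤ |((i : ℕ) : ℝ) - ((j : ℕ) : ℝ)| := by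
      have h2 : ((i : ℕ) : ℤ) - ((j : ℕ) : ℤ) ≠ 0 := by
        intro h3; apply h; ext; omega
      have := Int.one_le_abs h2
      exact_mod_cast this
    have h3 : ‖3 * ((i : ℕ) : ℂ) - 3 * ((j : ℕ) : ℂ)‖ = 3 * |((i : ℕ) : ℝ) - ((j : ℕ) : ℝ)| := by
      rw [← mul_sub, norm_mul, ← Real.norm_eq_abs, ← Complex.norm_real]
      simp
    have h4 := norm_sub_norm_le (3 * ((i : ℕ) : ℂ) - 3 * ((j : ℕ) : ℂ)) (-z)
    rw [norm_neg, hz, h3] at h4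
    have h5 : 3 * ((i : ℕ) : ℂ) - 3 * ((j : ℕ) : ℂ) - -z
        = 3 * ((i : ℕ) : ℂ) + z - 3 * ((j : ℕ) : ℂ) := by ring
    rw [h5] at h4
    linarith

theorem bdry_aux (i : Fin (d + 1)) {z : ℂ} (hz : ‖z‖ = 1) (j : Fin (d + 1)) :
    w.toFun (3 * (i : ℂ) + z) ∉ w.toFun '' Metric.ball (3 * (j : ℂ)) 1 := by
  rintro ⟨y, hy, hyz⟩
  rw [w.isOpenEmbedding.injective hyz] at hy
  exact three_mul_add_not_mem_ball i j hz hy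

/-- The inverse of the parametrization of the top boundary component `b_0` of `Y^d`. It runs
clockwise in the coordinate plane, the inverses `bdry w i` below run counterclockwise, so that
the gluing map `μ_i = bdry w i ∘ (top w)⁻¹ : b_0 → b_i` reverses orientation. -/
def top (z : Circle) : Block d w :=
  ⟨w.toFun (3 * ((0 : Fin (d + 1)) : ℂ) + (starRingEnd ℂ) (z : ℂ)),
    bdry_aux w 0 (by rw [Complex.norm_conj]; exact z.norm_coe)⟩

/-- The inverses of the parametrizations of the boundary components `b_1, …, b_d` of `Y^d`
(enumerated by `Fin d`). -/
def bdry (i : Fin d) (z : Circle) : Block d w :=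
  ⟨w.toFun (3 * (i.succ : ℂ) + (z : ℂ)), bdry_aux w i.succ z.norm_coe⟩

/-- The boundary of `Y^d`. -/
def blockBoundary : Set (Block d w) := Set.range (top w) ∪ ⋃ i, Set.range (bdry w i)

theorem bdry_injective {i j : Fin d} {z z' : Circle} (h : bdry w i z = bdry w j z') : i = j := by
  have h1 := w.isOpenEmbedding.injective (congrArg Subtype.val h)
  by_contra hij
  have h2 : (3 * (i.succ : ℂ) + (z : ℂ)) - 3 * (j.succ : ℂ) = (z' : ℂ) := by
    rw [h1]; ring
  have h4 : (2 : ℝ) ≤ ‖(3 * (i.succ : ℂ) + (z : ℂ)) - 3 * (j.succ : ℂ)‖ := by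
    have h5 : (1 : ℝ) ≤ |(((i : ℕ) : ℝ)) - ((j : ℕ) : ℝ)| := by
      have h2 : ((i : ℕ) : ℤ) - ((j : ℕ) : ℤ) ≠ 0 := by
        intro h3; apply hij; ext; omega
      have := Int.one_le_abs h2
      exact_mod_cast this
    have h3 : ‖3 * ((i : ℕ) : ℂ) - 3 * ((j : ℕ) : ℂ)‖ = 3 * |((i : ℕ) : ℝ) - ((j : ℕ) : ℝ)| := by
      rw [← mul_sub, norm_mul, ← Real.norm_eq_abs, ← Complex.norm_real]
      simp
    have h4 := norm_sub_norm_le (3 * ((i : ℕ) : ℂ) - 3 * ((j : ℕ) : ℂ)) (-(z : ℂ))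
    rw [norm_neg, z.norm_coe, h3] at h4
    have h6 : 3 * ((i : ℕ) : ℂ) - 3 * ((j : ℕ) : ℂ) - -(z : ℂ)
        = (3 * (i.succ : ℂ) + (z : ℂ)) - 3 * (j.succ : ℂ) := by
      simp only [Fin.val_succ]; push_cast; ring
    rw [h6] at h4
    linarith
  rw [h2, z'.norm_coe] at h4
  norm_num at h4

variable (d)

/-- The self-homeomorphisms of `Y^d` that respect the boundary parametrizations and restrict to
the identity on `b_0`. (They preserve orientation automatically: `Y^d` is connected, and they fix
a boundary circle pointwise.) -/
def blockHomeo : Subgroup (Block d w ≃ₜ Block d w) where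
  carrier := {h | (∀ z, h (top w z) = top w z) ∧
    ∃ σ : Equiv.Perm (Fin d), ∀ i z, h (bdry w i z) = bdry w (σ i) z}
  one_mem' := ⟨fun _ => rfl, 1, fun _ _ => rfl⟩
  mul_mem' := by
    rintro f g ⟨hf, σ, hσ⟩ ⟨hg, τ, hτ⟩
    exact ⟨fun z => by rw [Homeomorph.mul_apply, hg, hf], σ * τ,
      fun i z => by rw [Homeomorph.mul_apply, hτ, hσ]; rfl⟩
  inv_mem' := by
    rintro f ⟨hf, σ, hσ⟩
    refine ⟨fun z => (Homeomorph.symm_apply_eq f).2 (hf z).symm, σ⁻¹,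
      fun i z => (Homeomorph.symm_apply_eq f).2 ?_⟩
    rw [hσ]; simp

theorem blockHomeo_boundary : ∀ h ∈ blockHomeo d w, ∀ x ∈ blockBoundary (d := d) w,
    h x ∈ blockBoundary w := by
  rintro h ⟨h0, σ, hσ⟩ x (⟨z, rfl⟩ | hx)
  · rw [h0]; exact Or.inl ⟨z, rfl⟩
  · obtain ⟨i, z, rfl⟩ := Set.mem_iUnion.1 hx
    rw [hσ]; exact Or.inr (Set.mem_iUnion.2 ⟨σ i, z, rfl⟩)

instance : ((isotopicToId (blockBoundary w)).subgroupOf (blockHomeo d w)).Normal :=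
  normal_subgroupOf_isotopicToId _ _ (blockHomeo_boundary d w)

/-- The group `Map_∂(Y^d, b_0)`. -/
abbrev BlockMCG : Type _ :=
  blockHomeo d w ⧸ (isotopicToId (blockBoundary w)).subgroupOf (blockHomeo d w)

/-- The permutation of the boundary components `b_1, …, b_d` induced by a homeomorphism. -/
def homeoPerm : blockHomeo d w →* Equiv.Perm (Fin d) where
  toFun h := h.2.2.choose
  map_one' := by
    ext i : 1
    have := (1 : blockHomeo d w).2.2.choose_spec i 1
    exact (bdry_injective w this).symm
  map_mul' := by
    intro f g
    ext i : 1
    have h1 := (f * g).2.2.choose_spec i 1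
    have h2 := g.2.2.choose_spec i 1
    have h3 := f.2.2.choose_spec (g.2.2.choose i) 1
    have h4 : ((f * g : blockHomeo d w) : Block d w ≃ₜ Block d w) (bdry w i 1)
      = (f : Block d w ≃ₜ Block d w) ((g : Block d w ≃ₜ Block d w) (bdry w i 1)) := rfl
    rw [h2, h3] at h4
    exact bdry_injective w (h1.symm.trans h4)

/-- The homomorphism `q : Map_∂(Y^d, b_0) → Sym(d)`. -/
def q : BlockMCG d w →* Equiv.Perm (Fin d) :=
  QuotientGroup.lift _ (homeoPerm d w) (by
    intro h hh
    rw [Subgroup.mem_subgroupOf] at hh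
    rw [MonoidHom.mem_ker]
    ext i : 1
    have h1 := h.2.2.choose_spec i 1
    have h2 := isotopicToId_fix hh
      (x := bdry w i 1) (Or.inr (Set.mem_iUnion.2 ⟨i, 1, rfl⟩))
    exact (bdry_injective w (h2.symm.trans h1)).symm)

theorem q_mk (h : blockHomeo d w) (i : Fin d) (z : Circle) :
    (h : Block d w ≃ₜ Block d w) (bdry w i z)
      = bdry w (q d w (QuotientGroup.mk h) i) z :=
  h.2.2.choose_spec i z

end Block

/-! ### The Cantor surface -/

section Cantor

variable (d : ℕ) {O Y : Type*} [TopologicalSpace O] [TopologicalSpace Y]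
  (e : CoordPlane O) (w : CoordPlane Y)

/-- The surface `O_1`: the open disc that corresponds to the unit disc in the coordinate plane `e`
is removed from `O`. -/
def Base : Type _ := {x : O // x ∉ e.toFun '' Metric.ball 0 1}

instance : TopologicalSpace (Base e) := instTopologicalSpaceSubtype

/-- The parametrized boundary circle of `O_1` that is created by the removal. -/
def rim (z : Circle) : Base e :=
  ⟨e.toFun z, by
    rintro ⟨y, hy, hyz⟩
    rw [e.isOpenEmbedding.injective hyz, mem_ball_zero_iff, z.norm_coe] at hy
    exact lt_irrefl _ hy⟩

/-- The gluing pattern. There is one copy of `Y^d` for every finite word in `d` letters. The top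
boundary of the copy of the empty word is glued to `O_1`, and the top boundary of the copy of
`v ++ [i]` is glued by `μ_i` to the boundary component `b_i` of the copy of `v`. -/
inductive Glue : Base e ⊕ (Σ _ : List (Fin d), Block d w) →
    Base e ⊕ (Σ _ : List (Fin d), Block d w) → Prop
  | root (z : Circle) : Glue (Sum.inl (rim e z)) (Sum.inr ⟨[], top w z⟩)
  | child (v : List (Fin d)) (i : Fin d) (z : Circle) :
      Glue (Sum.inr ⟨v, bdry w i z⟩) (Sum.inr ⟨v ++ [i], top w z⟩)

/-- The Cantor surface `C_d(O, Y)`. -/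
def CantorSurface : Type _ := Quot (Glue d e w)

instance : TopologicalSpace (CantorSurface d e w) := instTopologicalSpaceQuot

variable {d}

/-- The inclusion of `O_1`. -/
def ofBase (x : Base e) : CantorSurface d e w := Quot.mk _ (Sum.inl x)

/-- The inclusion of `Y^d` as the block of the word `v`; this is the inverse of the homeomorphism
`ι_B : B → Y^d`. -/
def ofBlock (v : List (Fin d)) (y : Block d w) : CantorSurface d e w := Quot.mk _ (Sum.inr ⟨v, y⟩)

/-- The block of the word `v`. -/
def block (v : List (Fin d)) : Set (CantorSurface d e w) := Set.range (ofBlock e w v)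

/-- The suited curve of the word `v`: the top boundary of the block of `v`. -/
def curve (v : List (Fin d)) : Set (CantorSurface d e w) :=
  Set.range fun z => ofBlock e w v (top w z)

/-- The union of all blocks at or below the block of `v`: the closure of the complementary
component of a suited subsurface that is adjacent to its suited boundary component `curve v`. The
sets `region v`, where `v` runs through the initial segments of an infinite word, form a
neighbourhood basis of one end, and this is a bijection from infinite words to ends. -/
def region (v : List (Fin d)) : Set (CantorSurface d e w) := ⋃ u, block e w (v ++ u)

variable (d)

/-- The boundary of the Cantor surface, which is the boundary of `O`. -/
def cantorBoundary : Set (CantorSurface d e w) :=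
  ofBase e w '' {x | x.1 ∈ surfaceBoundary O}

/-- The self-homeomorphisms of the Cantor surface that fix its boundary pointwise. -/
abbrev cantorHomeo : Subgroup (CantorSurface d e w ≃ₜ CantorSurface d e w) :=
  fixingHomeo (cantorBoundary d e w)

instance :
    ((isotopicToId (cantorBoundary d e w)).subgroupOf (cantorHomeo d e w)).Normal :=
  normal_subgroupOf_isotopicToId _ _ fun h hh x hx => by rw [hh x hx]; exact hx

/-- Isotopy classes of homeomorphisms of the Cantor surface that fix the boundary pointwise. -/
abbrev CantorMCG : Type _ :=
  cantorHomeo d e w ⧸ (isotopicToId (cantorBoundary d e w)).subgroupOf (cantorHomeo d e w)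

end Cantor

/-! ### Trees and the symmetric Higman-Thompson groups -/

/-- A complete finite rooted subtree of the infinite rooted `d`-ary tree; the vertices of the
latter are the finite words in `d` letters. -/
structure FinTree (d : ℕ) where
  verts : Finset (List (Fin d))
  root_mem : [] ∈ verts
  parent_mem : ∀ v i, v ++ [i] ∈ verts → v ∈ verts
  complete : ∀ v i j, v ++ [i] ∈ verts → v ++ [j] ∈ verts

/-- `v` is a leaf of `F`: a vertex of `F` without descendants in `F`. -/
def FinTree.IsLeaf {d : ℕ} (F : FinTree d) (v : List (Fin d)) : Prop :=
  v ∈ F.verts ∧ ∀ i, v ++ [i] ∉ F.verts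

/-- `v` is an interior vertex of `F`: a vertex of `F` that is not a leaf. -/
def FinTree.IsInner {d : ℕ} (F : FinTree d) (v : List (Fin d)) : Prop :=
  v ∈ F.verts ∧ ¬ F.IsLeaf v

/-- The set of leaves of `F`. -/
abbrev FinTree.Leaf {d : ℕ} (F : FinTree d) : Type := {v : List (Fin d) // F.IsLeaf v}

/-- The Cantor set of infinite words `c_1 c_2 c_3 …` in `d` letters, with the product topology. -/
abbrev InfWord (d : ℕ) : Type := ℕ → Fin d

/-- The infinite word `l` followed by `t`. -/
def prepend {d : ℕ} (l : List (Fin d)) (t : InfWord d) : InfWord d :=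
  fun n => if h : n < l.length then l[n] else t (n - l.length)

/-- The initial segment of length `n` of an infinite word. -/
def initSeg {d : ℕ} (c : InfWord d) (n : ℕ) : List (Fin d) := List.ofFn fun k : Fin n => c k

/-- `(F, (b, g), F')` is a symmetric tree-pair representative of `ψ`. -/
def IsSymTreePair {d : ℕ} (F F' : FinTree d) (b : F.Leaf ≃ F'.Leaf)
    (g : F.Leaf → Equiv.Perm (Fin d)) (ψ : InfWord d ≃ₜ InfWord d) : Prop :=
  ∀ (l : F.Leaf) (t : InfWord d),
    ψ (prepend l.1 t) = prepend (b l).1 fun n => g l (t n)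

/-- The underlying set of the symmetric Higman-Thompson group `V_d(G)`: the homeomorphisms of the
Cantor set that have a symmetric tree-pair representative with labels in `G`. -/
def symHigmanThompson {d : ℕ} (G : Subgroup (Equiv.Perm (Fin d))) :
    Set (InfWord d ≃ₜ InfWord d) :=
  {ψ | ∃ (F F' : FinTree d) (b : F.Leaf ≃ F'.Leaf) (g : F.Leaf → Equiv.Perm (Fin d)),
    (∀ l, g l ∈ G) ∧ IsSymTreePair F F' b g ψ}

/-! ### Block mapping class groups -/

section BlockMap

variable {d : ℕ} {O Y : Type*} [TopologicalSpace O] [TopologicalSpace Y]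
  (e : CoordPlane O) (w : CoordPlane Y)

/-- The suited subsurface with tree `F`: the union of `O_1` and the blocks of the interior vertices
of `F`. The sets of interior vertices of such trees are the finite sets of words that contain,
with a word, all its initial segments; hence these are the connected unions of `O_1` and finitely
many blocks. The suited boundary components are the curves `curve a`, with `a` a leaf of `F`. -/
def suited (F : FinTree d) : Set (CantorSurface d e w) :=
  Set.range (ofBase e w) ∪ ⋃ (v) (_ : F.IsInner v), block e w v

variable {e w}

/-- `f` is a block homeomorphism with defining surface `Z = suited e w F`, and the suited
subsurface `f(Z)` has tree `F'`: outside of `Z`, `f` sends blocks to blocks. -/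
def IsDefining (f : CantorSurface d e w ≃ₜ CantorSurface d e w) (F F' : FinTree d) : Prop :=
  f '' suited e w F = suited e w F' ∧
    ∀ v, ¬ F.IsInner v → ∃ v', ¬ F'.IsInner v' ∧ f '' block e w v = block e w v'

/-- For every suited boundary component `curve a` of `Z = suited e w F` and every block `B` in the
component of the complement of `Z` that is adjacent to it, `ι_{f(B)} ∘ f ∘ ι_B⁻¹` is a
representative of the mapping class `h a`. -/
def EventuallyActsLike (f : CantorSurface d e w ≃ₜ CantorSurface d e w) (F : FinTree d)
    (h : F.Leaf → BlockMCG d w) : Prop :=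
  ∀ (a : F.Leaf) (u v' : List (Fin d)), f '' block e w (a.1 ++ u) = block e w v' →
    ∃ k : blockHomeo d w, (QuotientGroup.mk k : BlockMCG d w) = h a ∧
      ∀ y, f (ofBlock e w (a.1 ++ u) y) = ofBlock e w v' ((k : Block d w ≃ₜ Block d w) y)

/-- `f` is an `H`-block homeomorphism. -/
def IsHBlock (H : Subgroup (BlockMCG d w)) (f : CantorSurface d e w ≃ₜ CantorSurface d e w) :
    Prop :=
  ∃ (F F' : FinTree d) (h : F.Leaf → BlockMCG d w),
    IsDefining f F F' ∧ (∀ a, h a ∈ H) ∧ EventuallyActsLike f F h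

variable (e) in
/-- The underlying set of the block mapping class group `𝔅_d(H)` with local group `H`: the isotopy
classes of the `H`-block homeomorphisms. (An `H`-block homeomorphism preserves orientation
automatically: the surface is connected, and outside of a compact set it is given on each block by
an orientation preserving homeomorphism of `Y^d`.) -/
def blockClasses (H : Subgroup (BlockMCG d w)) : Set (CantorMCG d e w) :=
  {x | ∃ f : cantorHomeo d e w, IsHBlock H f.1 ∧ QuotientGroup.mk f = x}

end BlockMap

end CantorSurf

end

/-!
The homomorphism `π` is the action on the ends of the Cantor surface, which are the infinite words.
The argument has three parts.

*Block homeomorphisms.* The basic notion is `ActsOnRegion f v v' x`: on every block below the word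
`v`, the homeomorphism `f` is a representative of the mapping class `x`, and it maps the region of
`v` to that of `v'`. Because neighbouring blocks are glued along parametrized circles, the class
`x` on the blocks below `v` forces `f` to change the letters after `v` by the permutation `q x`
(`ActsOnBlock.child`). An `H`-block homeomorphism with a given defining surface and label is
therefore one that acts on the regions of the leaves of a tree, and it induces a bijection between
these and the leaves of a second tree (`exists_matchesLeaves`, `MatchesLeaves.isDefining`). By
compactness of suited subsurfaces, the second tree need not be mentioned: it suffices that `f` acts,
by elements of `H`, on the regions of all words of some fixed length (`isHBlock_iff_length`). In
this form it is clear that the composition of two `H`-block homeomorphisms is again one.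

*Ends.* A block homeomorphism acts on the ends by the homeomorphism of its symmetric tree pair
(`MatchesLeaves.endAction`), and an action on the ends is unique (`EndAction.unique`). A
homeomorphism that is isotopic to the identity fixes all ends (`endAction_id_of_isotopic`): the
curve that bounds a region sweeps out only a compact set during the inverse isotopy, so a point
close enough to an end never crosses this curve. Hence the action on the ends depends only on the
isotopy class and is multiplicative. That `V_d(H̄)` is closed under multiplication and inverses then
follows from surjectivity.

*Surjectivity.* Every pair of trees with a bijection between the leaves and with labels in `H` has
to be realized by a homeomorphism (`HasBasicSwaps.exists_matchesLeaves`). The labels are realized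
block by block (`portraitHomeo`). The bijection is realized by homeomorphisms that move regions
rigidly, all of which come from two kinds of swaps (`HasBasicSwaps`):

* exchanging two siblings, by half twists in the coordinate plane of a block that exchange two
  neighbouring removed discs (`exchangeDiscs`, `homeoPerm_surjective`);
* exchanging a child of a word with a child of another child, by a half twist of a disc that lies
  in the union of two adjacent blocks. A chart of this disc is obtained by placing one half of it
  in each block by means of the Cayley transform, which turns the gluing map into `z ↦ -z`
  (`mixChart`, `swappable_child_grandchild`).

By conjugation these give the exchange of the regions of any two independent words
(`HasBasicSwaps.swappable`), hence all permutations of the leaves of a tree. Two trees with equally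
many leaves are compared by removing a caret from each and moving the one caret to the other
(`HasBasicSwaps.exists_moves_leaves`).
-/

noncomputable section

namespace CantorSurf

/-! ### The boundary circles of a block -/

section BlockGeometry

variable {d : ℕ} {Y : Type*} [TopologicalSpace Y] {w : CoordPlane Y}

theorem three_mul_natCast_add_inj {i j : ℕ} {z z' : ℂ} (hz : ‖z‖ ≤ 1) (hz' : ‖z'‖ ≤ 1)
    (h : 3 * (i : ℂ) + z = 3 * (j : ℂ) + z') : i = j ∧ z = z' := by
  have hij : i = j := by
    by_contra hij
    have h1 : (1 : ℝ) ≤ |(i : ℝ) - (j : ℝ)| := by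
      have := Int.one_le_abs (z := (i : ℤ) - (j : ℤ)) (by omega)
      exact_mod_cast this
    have h2 : ‖3 * (i : ℂ) - 3 * (j : ℂ)‖ = 3 * |(i : ℝ) - (j : ℝ)| := by
      rw [← mul_sub, norm_mul, ← Real.norm_eq_abs, ← Complex.norm_real]
      simp
    have h3 : 3 * (i : ℂ) - 3 * (j : ℂ) = z' - z := by linear_combination h
    rw [h3] at h2
    linarith [norm_sub_le z' z]
  subst hij
  exact ⟨rfl, add_left_cancel h⟩

theorem top_injective : Function.Injective (top (d := d) w) := by
  intro z z' h
  have h1 := w.isOpenEmbedding.injective (congrArg Subtype.val h)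
  have h2 := add_left_cancel h1
  exact Subtype.ext ((starRingEnd ℂ).injective h2)

theorem bdry_injective_snd {i j : Fin d} {z z' : Circle} (h : bdry w i z = bdry w j z') :
    z = z' := by
  have h1 := w.isOpenEmbedding.injective (congrArg Subtype.val h)
  exact Subtype.ext (three_mul_natCast_add_inj z.norm_coe.le z'.norm_coe.le h1).2

theorem top_ne_bdry (i : Fin d) (z z' : Circle) : top w z ≠ bdry w i z' := by
  intro h
  have h1 := w.isOpenEmbedding.injective (congrArg Subtype.val h)
  have h2 := (three_mul_natCast_add_inj (by rw [Complex.norm_conj]; exact z.norm_coe.le)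
    z'.norm_coe.le h1).1
  simp at h2

variable (d w) in
/-- A point of the block that lies on none of its boundary circles. -/
def interiorPoint : Block d w := ⟨w.toFun (-3), by
  rintro i ⟨p, hp, hpw⟩
  rw [w.isOpenEmbedding.injective hpw, Metric.mem_ball, dist_eq_norm] at hp
  have h1 : ‖(-3 - 3 * ((i : ℕ) : ℂ) : ℂ)‖ = 3 + 3 * (i : ℕ) := by
    have h2 : (-3 - 3 * ((i : ℕ) : ℂ) : ℂ) = ((-(3 + 3 * ((i : ℕ) : ℝ)) : ℝ) : ℂ) := by
      push_cast; ring
    rw [h2, Complex.norm_real, Real.norm_eq_abs, abs_neg, abs_of_nonneg (by positivity)]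
  rw [h1] at hp
  have : (0 : ℝ) ≤ ((i : ℕ) : ℝ) := by positivity
  linarith⟩

theorem neg_three_ne_three_mul_add (i : ℕ) {z : ℂ} (hz : ‖z‖ = 1) : (-3 : ℂ) ≠ 3 * (i : ℂ) + z := by
  intro h
  have h1 := congrArg Complex.re h
  have h2 := Complex.abs_re_le_norm z
  rw [hz, abs_le] at h2
  have : (0 : ℝ) ≤ (i : ℝ) := by positivity
  simp at h1
  linarith

theorem top_ne_interiorPoint (z : Circle) : top w z ≠ interiorPoint d w := by
  intro h
  have h1 := w.isOpenEmbedding.injective (congrArg Subtype.val h)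
  exact neg_three_ne_three_mul_add ((0 : Fin (d + 1)) : ℕ)
    (by rw [Complex.norm_conj]; exact z.norm_coe) h1.symm

theorem bdry_ne_interiorPoint (i : Fin d) (z : Circle) : bdry w i z ≠ interiorPoint d w := by
  intro h
  have h1 := w.isOpenEmbedding.injective (congrArg Subtype.val h)
  exact neg_three_ne_three_mul_add _ z.norm_coe h1.symm

theorem continuous_top : Continuous (top (d := d) w) := by
  refine Continuous.subtype_mk (w.isOpenEmbedding.continuous.comp ?_) _
  exact continuous_const.add (Complex.continuous_conj.comp continuous_subtype_val)

theorem continuous_bdry (i : Fin d) : Continuous (bdry w i) := by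
  refine Continuous.subtype_mk (w.isOpenEmbedding.continuous.comp ?_) _
  exact continuous_const.add continuous_subtype_val

instance [T2Space Y] : T2Space (Block d w) := inferInstanceAs (T2Space (Subtype _))

theorem isClosed_range_top [T2Space Y] : IsClosed (Set.range (top (d := d) w)) :=
  (isCompact_range continuous_top).isClosed

theorem isClosed_range_bdry [T2Space Y] (i : Fin d) : IsClosed (Set.range (bdry w i)) :=
  (isCompact_range (continuous_bdry i)).isClosed

instance [CompactSpace Y] : CompactSpace (Block d w) := by
  refine isCompact_iff_compactSpace.1 (IsClosed.isCompact ?_)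
  have : {y : Y | ∀ i : Fin (d + 1), y ∉ w.toFun '' Metric.ball (3 * (i : ℂ)) 1}
      = ⋂ i : Fin (d + 1), (w.toFun '' Metric.ball (3 * (i : ℂ)) 1)ᶜ := by
    ext; simp
  change IsClosed {y : Y | ∀ i : Fin (d + 1), y ∉ w.toFun '' Metric.ball (3 * (i : ℂ)) 1}
  rw [this]
  exact isClosed_iInter fun i =>
    (w.isOpenEmbedding.isOpenMap _ Metric.isOpen_ball).isClosed_compl

theorem IsSphereOrTorus.t2Space (hY : IsSphereOrTorus Y) : T2Space Y := by
  rcases hY with ⟨⟨g⟩⟩ | ⟨⟨g⟩⟩ <;> exact g.symm.t2Space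

theorem IsSphereOrTorus.compactSpace (hY : IsSphereOrTorus Y) : CompactSpace Y := by
  rcases hY with ⟨⟨g⟩⟩ | ⟨⟨g⟩⟩ <;> exact g.symm.compactSpace

theorem q_mk_top (k : blockHomeo d w) (z : Circle) :
    (k : Block d w ≃ₜ Block d w) (top w z) = top w z := k.2.1 z

end BlockGeometry

/-! ### Points of the Cantor surface -/

section Points

variable {d : ℕ} {O Y : Type*} [TopologicalSpace O] [TopologicalSpace Y]
  {e : CoordPlane O} {w : CoordPlane Y}

theorem rim_injective : Function.Injective (rim e) := by
  intro z z' h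
  exact Subtype.ext (e.isOpenEmbedding.injective (congrArg Subtype.val h))

theorem continuous_rim : Continuous (rim e) :=
  Continuous.subtype_mk (e.isOpenEmbedding.continuous.comp continuous_subtype_val) _

theorem isClosed_range_rim [T2Space O] : IsClosed (Set.range (rim e)) :=
  haveI : T2Space (Base e) := inferInstanceAs (T2Space (Subtype _))
  (isCompact_range continuous_rim).isClosed

instance [CompactSpace O] : CompactSpace (Base e) := by
  refine isCompact_iff_compactSpace.1 (IsClosed.isCompact ?_)
  exact (e.isOpenEmbedding.isOpenMap _ Metric.isOpen_ball).isClosed_compl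

theorem ofBase_rim (z : Circle) : ofBase e w (d := d) (rim e z) = ofBlock e w [] (top w z) :=
  Quot.sound (Glue.root z)

theorem ofBlock_bdry (v : List (Fin d)) (i : Fin d) (z : Circle) :
    ofBlock e w v (bdry w i z) = ofBlock e w (v ++ [i]) (top w z) :=
  Quot.sound (Glue.child v i z)

open Classical in
/-- The normal form of a point of `O_1` or of a block: a point on a gluing circle is represented
in the lower one of the two pieces. -/
def normalForm : Base e ⊕ (Σ _ : List (Fin d), Block d w) →
    Base e ⊕ (Σ _ : List (Fin d), Block d w)
  | Sum.inl x => if h : ∃ z, x = rim e z then Sum.inr ⟨[], top w h.choose⟩ else Sum.inl x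
  | Sum.inr ⟨v, y⟩ =>
    if h : ∃ p : Fin d × Circle, y = bdry w p.1 p.2 then
      Sum.inr ⟨v ++ [h.choose.1], top w h.choose.2⟩ else Sum.inr ⟨v, y⟩

theorem normalForm_rim (z : Circle) :
    normalForm (d := d) (w := w) (Sum.inl (rim e z)) = Sum.inr ⟨[], top w z⟩ := by
  have h : ∃ z', rim e z = rim e z' := ⟨z, rfl⟩
  have h1 := rim_injective h.choose_spec
  simp only [normalForm, dif_pos h]
  rw [← h1]

theorem normalForm_base {x : Base e} (hx : ∀ z, x ≠ rim e z) :
    normalForm (d := d) (w := w) (Sum.inl x) = Sum.inl x := by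
  simp only [normalForm]
  rw [dif_neg]
  rintro ⟨z, hz⟩
  exact hx z hz

theorem normalForm_bdry (v : List (Fin d)) (i : Fin d) (z : Circle) :
    normalForm (e := e) (Sum.inr ⟨v, bdry w i z⟩) = Sum.inr ⟨v ++ [i], top w z⟩ := by
  have h : ∃ p : Fin d × Circle, bdry w i z = bdry w p.1 p.2 := ⟨(i, z), rfl⟩
  have h1 := bdry_injective w h.choose_spec
  have h2 := bdry_injective_snd h.choose_spec
  simp only [normalForm, dif_pos h]
  rw [← h1, ← h2]

theorem normalForm_block (v : List (Fin d)) {y : Block d w} (hy : ∀ i z, y ≠ bdry w i z) :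
    normalForm (e := e) (Sum.inr ⟨v, y⟩) = Sum.inr ⟨v, y⟩ := by
  simp only [normalForm]
  rw [dif_neg]
  rintro ⟨p, hp⟩
  exact hy _ _ hp

/-- Glued points have the same normal form, so that equality of points of the Cantor surface can be
decided on normal forms. -/
theorem normalForm_eq_of_mk_eq {a b : Base e ⊕ (Σ _ : List (Fin d), Block d w)}
    (h : Quot.mk (Glue d e w) a = Quot.mk (Glue d e w) b) : normalForm a = normalForm b := by
  have key : ∀ a b, Glue d e w a b → normalForm a = normalForm b := by
    rintro _ _ (z | ⟨v, i, z⟩)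
    · rw [normalForm_rim, normalForm_block _ fun i z' => top_ne_bdry i z z']
    · rw [normalForm_bdry, normalForm_block _ fun i z' => top_ne_bdry i z z']
  exact congrArg (Quot.lift normalForm key) h

theorem ofBlock_eq_iff {v v' : List (Fin d)} {y y' : Block d w} :
    ofBlock e w v y = ofBlock e w v' y' ↔ (v = v' ∧ y = y') ∨
      (∃ i z, v' = v ++ [i] ∧ y = bdry w i z ∧ y' = top w z) ∨
      (∃ i z, v = v' ++ [i] ∧ y' = bdry w i z ∧ y = top w z) := by
  constructor
  · intro h
    have h1 := normalForm_eq_of_mk_eq h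
    by_cases hy : ∃ i z, y = bdry w i z
    · obtain ⟨i, z, rfl⟩ := hy
      rw [normalForm_bdry] at h1
      by_cases hy' : ∃ i z, y' = bdry w i z
      · obtain ⟨j, z', rfl⟩ := hy'
        rw [normalForm_bdry] at h1
        have h2 := Sigma.mk.inj (Sum.inr.inj h1)
        have h3 := List.append_inj' h2.1 rfl
        have h4 := top_injective (eq_of_heq h2.2)
        have h5 : i = j := by simpa using h3.2
        exact Or.inl ⟨h3.1, by rw [h4, h5]⟩
      · push Not at hy'
        rw [normalForm_block _ hy'] at h1
        have h2 := Sigma.mk.inj (Sum.inr.inj h1)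
        exact Or.inr (Or.inl ⟨i, z, h2.1.symm, rfl, (eq_of_heq h2.2).symm⟩)
    · push Not at hy
      rw [normalForm_block _ hy] at h1
      by_cases hy' : ∃ i z, y' = bdry w i z
      · obtain ⟨j, z', rfl⟩ := hy'
        rw [normalForm_bdry] at h1
        have h2 := Sigma.mk.inj (Sum.inr.inj h1)
        exact Or.inr (Or.inr ⟨j, z', h2.1, rfl, eq_of_heq h2.2⟩)
      · push Not at hy'
        rw [normalForm_block _ hy'] at h1
        have h2 := Sigma.mk.inj (Sum.inr.inj h1)
        exact Or.inl ⟨h2.1, eq_of_heq h2.2⟩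
  · rintro (⟨rfl, rfl⟩ | ⟨i, z, rfl, rfl, rfl⟩ | ⟨i, z, rfl, rfl, rfl⟩)
    · rfl
    · exact ofBlock_bdry v i z
    · exact (ofBlock_bdry v' i z).symm

theorem ofBase_eq_ofBlock_iff {x : Base e} {v : List (Fin d)} {y : Block d w} :
    ofBase e w x = ofBlock e w v y ↔ v = [] ∧ ∃ z, x = rim e z ∧ y = top w z := by
  constructor
  · intro h
    have h1 := normalForm_eq_of_mk_eq h
    by_cases hx : ∃ z, x = rim e z
    · obtain ⟨z, rfl⟩ := hx
      rw [normalForm_rim] at h1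
      by_cases hy' : ∃ i z, y = bdry w i z
      · obtain ⟨j, z', rfl⟩ := hy'
        rw [normalForm_bdry] at h1
        have h2 := Sigma.mk.inj (Sum.inr.inj h1)
        simp at h2
      · push Not at hy'
        rw [normalForm_block _ hy'] at h1
        have h2 := Sigma.mk.inj (Sum.inr.inj h1)
        exact ⟨h2.1.symm, z, rfl, (eq_of_heq h2.2).symm⟩
    · push Not at hx
      rw [normalForm_base hx] at h1
      by_cases hy' : ∃ i z, y = bdry w i z
      · obtain ⟨j, z', rfl⟩ := hy'
        rw [normalForm_bdry] at h1
        cases h1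
      · push Not at hy'
        rw [normalForm_block _ hy'] at h1
        cases h1
  · rintro ⟨rfl, z, rfl, rfl⟩
    exact ofBase_rim z

theorem ofBlock_injective (v : List (Fin d)) : Function.Injective (ofBlock e w v) := by
  intro y y' h
  rcases ofBlock_eq_iff.1 h with ⟨-, h⟩ | ⟨i, z, h, -⟩ | ⟨i, z, h, -⟩
  · exact h
  · simp at h
  · simp at h

theorem eq_of_ofBlock_eq_interiorPoint {v v' : List (Fin d)} {y : Block d w}
    (h : ofBlock e w v y = ofBlock e w v' (interiorPoint d w)) : v = v' := by
  rcases ofBlock_eq_iff.1 h with ⟨h, -⟩ | ⟨i, z, -, -, h⟩ | ⟨i, z, -, h, -⟩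
  · exact h
  · exact absurd h.symm (top_ne_interiorPoint z)
  · exact absurd h.symm (bdry_ne_interiorPoint i z)

theorem eq_of_ofBlock_top_eq {v v' : List (Fin d)} {z z' : Circle}
    (h : ofBlock e w v (top w z) = ofBlock e w v' (top w z')) : v = v' := by
  rcases ofBlock_eq_iff.1 h with ⟨h, -⟩ | ⟨i, z, -, h, -⟩ | ⟨i, z, -, h, -⟩
  · exact h
  · exact absurd h (top_ne_bdry _ _ _)
  · exact absurd h (top_ne_bdry _ _ _)

theorem block_subset_block {v v' : List (Fin d)} (h : block e w v ⊆ block e w v') : v = v' := by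
  obtain ⟨y, hy⟩ := h ⟨interiorPoint d w, rfl⟩
  exact (eq_of_ofBlock_eq_interiorPoint hy).symm

theorem block_injective : Function.Injective (block (d := d) e w) :=
  fun _ _ h => block_subset_block h.subset

theorem exists_ofBase_or_ofBlock (x : CantorSurface d e w) :
    (∃ b, x = ofBase e w b) ∨ ∃ v y, x = ofBlock e w v y := by
  induction x using Quot.ind with
  | mk a =>
    rcases a with b | ⟨v, y⟩
    · exact Or.inl ⟨b, rfl⟩
    · exact Or.inr ⟨v, y, rfl⟩

theorem mem_region {v : List (Fin d)} {x : CantorSurface d e w} :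
    x ∈ region e w v ↔ ∃ u y, x = ofBlock e w (v ++ u) y := by
  simp only [region, block, Set.mem_iUnion, Set.mem_range, eq_comm]

theorem ofBlock_mem_region {u v : List (Fin d)} {y : Block d w} :
    ofBlock e w u y ∈ region e w v ↔ v <+: u ∨ ∃ i z, v = u ++ [i] ∧ y = bdry w i z := by
  rw [mem_region]
  constructor
  · rintro ⟨t, y', h⟩
    rcases ofBlock_eq_iff.1 h with ⟨rfl, -⟩ | ⟨i, z, h1, rfl, rfl⟩ | ⟨i, z, rfl, rfl, rfl⟩
    · exact Or.inl (List.prefix_append _ _)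
    · rcases List.eq_nil_or_concat t with rfl | ⟨t', j, rfl⟩
      · exact Or.inr ⟨i, z, by simpa using h1, rfl⟩
      · rw [List.concat_eq_append, ← List.append_assoc] at h1
        have h2 := List.append_inj' h1 rfl
        exact Or.inl ⟨t', h2.1⟩
    · exact Or.inl ⟨t ++ [i], by simp⟩
  · rintro (⟨t, rfl⟩ | ⟨i, z, rfl, rfl⟩)
    · exact ⟨t, y, rfl⟩
    · exact ⟨[], top w z, by rw [List.append_nil]; exact ofBlock_bdry u i z⟩

theorem ofBase_mem_region {v : List (Fin d)} {x : Base e} :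
    ofBase e w x ∈ region e w v ↔ v = [] ∧ ∃ z, x = rim e z := by
  rw [mem_region]
  constructor
  · rintro ⟨t, y', h⟩
    obtain ⟨h1, z, h2, -⟩ := ofBase_eq_ofBlock_iff.1 h
    exact ⟨(List.append_eq_nil_iff.1 h1).1, z, h2⟩
  · rintro ⟨rfl, z, rfl⟩
    exact ⟨[], top w z, ofBase_rim z⟩

theorem ofBlock_mem_curve {u v : List (Fin d)} {y : Block d w} :
    ofBlock e w u y ∈ curve e w v ↔
      (u = v ∧ ∃ z, y = top w z) ∨ ∃ i z, v = u ++ [i] ∧ y = bdry w i z := by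
  constructor
  · rintro ⟨z, hz⟩
    rcases ofBlock_eq_iff.1 hz with ⟨h, h'⟩ | ⟨i, z, -, h, -⟩ | ⟨i, z, h, h', -⟩
    · exact Or.inl ⟨h.symm, z, h'.symm⟩
    · exact absurd h (top_ne_bdry _ _ _)
    · exact Or.inr ⟨i, z, h, h'⟩
  · rintro (⟨rfl, z, rfl⟩ | ⟨i, z, rfl, rfl⟩)
    · exact ⟨z, rfl⟩
    · exact ⟨z, (ofBlock_bdry u i z).symm⟩

theorem ofBase_mem_curve {v : List (Fin d)} {x : Base e} :
    ofBase e w x ∈ curve e w v ↔ v = [] ∧ ∃ z, x = rim e z := by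
  constructor
  · rintro ⟨z, hz⟩
    obtain ⟨h1, z', h2, -⟩ := ofBase_eq_ofBlock_iff.1 hz.symm
    exact ⟨h1, z', h2⟩
  · rintro ⟨rfl, z, rfl⟩
    exact ⟨z, (ofBase_rim z).symm⟩

theorem region_append_subset (v u : List (Fin d)) : region e w (v ++ u) ⊆ region e w v := by
  intro x hx
  obtain ⟨t, y, rfl⟩ := mem_region.1 hx
  exact mem_region.2 ⟨u ++ t, y, by rw [List.append_assoc]⟩

theorem region_subset_of_prefix {v v' : List (Fin d)} (h : v <+: v') :
    region e w v' ⊆ region e w v := by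
  obtain ⟨u, rfl⟩ := h
  exact region_append_subset v u

/-! ### The topology of the Cantor surface -/

theorem continuous_ofBase : Continuous (ofBase (d := d) e w) :=
  continuous_quot_mk.comp continuous_inl

theorem continuous_ofBlock (v : List (Fin d)) : Continuous (ofBlock e w v) :=
  continuous_quot_mk.comp (continuous_inr.comp continuous_sigmaMk)

theorem isOpen_iff_preimage {s : Set (CantorSurface d e w)} :
    IsOpen s ↔ IsOpen (ofBase e w ⁻¹' s) ∧ ∀ v, IsOpen (ofBlock e w v ⁻¹' s) := by
  constructor
  · exact fun h => ⟨h.preimage continuous_ofBase, fun v => h.preimage (continuous_ofBlock v)⟩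
  · rintro ⟨h1, h2⟩
    refine isQuotientMap_quot_mk.isOpen_preimage.1 ?_
    exact isOpen_sum_iff.2 ⟨h1, isOpen_sigma_iff.2 h2⟩

theorem isClosed_iff_preimage {s : Set (CantorSurface d e w)} :
    IsClosed s ↔ IsClosed (ofBase e w ⁻¹' s) ∧ ∀ v, IsClosed (ofBlock e w v ⁻¹' s) := by
  simp only [← isOpen_compl_iff, ← Set.preimage_compl]
  exact isOpen_iff_preimage

theorem continuous_iff_comp {Z : Type*} [TopologicalSpace Z] {g : CantorSurface d e w → Z} :
    Continuous g ↔ Continuous (g ∘ ofBase e w) ∧ ∀ v, Continuous (g ∘ ofBlock e w v) := by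
  constructor
  · exact fun h => ⟨h.comp continuous_ofBase, fun v => h.comp (continuous_ofBlock v)⟩
  · rintro ⟨h1, h2⟩
    refine continuous_def.2 fun s hs => isOpen_iff_preimage.2 ⟨hs.preimage h1, fun v =>
      hs.preimage (h2 v)⟩

theorem isClosed_region [T2Space O] [T2Space Y] (v : List (Fin d)) :
    IsClosed (region e w v) := by
  refine isClosed_iff_preimage.2 ⟨?_, fun u => ?_⟩
  · by_cases hv : v = []
    · have : ofBase e w ⁻¹' region e w v = Set.range (rim e) := by
        ext x
        simp [Set.mem_preimage, ofBase_mem_region, hv, eq_comm]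
      rw [this]
      exact isClosed_range_rim
    · have : ofBase e w ⁻¹' region e w v = ∅ := by
        ext x
        simp [Set.mem_preimage, ofBase_mem_region, hv]
      rw [this]
      exact isClosed_empty
  · by_cases hv : v <+: u
    · have : ofBlock e w u ⁻¹' region e w v = Set.univ := by
        ext x
        simp [Set.mem_preimage, ofBlock_mem_region, hv]
      rw [this]
      exact isClosed_univ
    · by_cases hi : ∃ i, v = u ++ [i]
      · obtain ⟨i, rfl⟩ := hi
        have : ofBlock e w u ⁻¹' region e w (u ++ [i]) = Set.range (bdry w i) := by
          ext x
          simp only [Set.mem_preimage, ofBlock_mem_region, hv, false_or]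
          constructor
          · rintro ⟨j, z, h, rfl⟩
            have h1 : i = j := by simpa using h
            exact ⟨z, by rw [h1]⟩
          · rintro ⟨z, rfl⟩
            exact ⟨i, z, rfl, rfl⟩
        rw [this]
        exact isClosed_range_bdry i
      · have : ofBlock e w u ⁻¹' region e w v = ∅ := by
          ext x
          simp only [Set.mem_preimage, ofBlock_mem_region, hv, false_or, Set.mem_empty_iff_false,
            iff_false]
          rintro ⟨i, z, h, -⟩
          exact hi ⟨i, h⟩
        rw [this]
        exact isClosed_empty

theorem isOpen_region_diff_curve [T2Space Y] (v : List (Fin d)) :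
    IsOpen (region e w v \ curve e w v) := by
  refine isOpen_iff_preimage.2 ⟨?_, fun u => ?_⟩
  · have : ofBase e w ⁻¹' (region e w v \ curve e w v) = ∅ := by
      ext x
      simp [Set.mem_preimage, ofBase_mem_region, ofBase_mem_curve]
    rw [this]
    exact isOpen_empty
  · by_cases hv : v <+: u
    · by_cases hu : u = v
      · subst hu
        have : ofBlock e w u ⁻¹' (region e w u \ curve e w u) = (Set.range (top w))ᶜ := by
          ext x
          simp [Set.mem_preimage, ofBlock_mem_region, ofBlock_mem_curve, eq_comm]
        rw [this]
        exact isClosed_range_top.isOpen_compl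
      · have : ofBlock e w u ⁻¹' (region e w v \ curve e w v) = Set.univ := by
          ext x
          simp only [Set.mem_preimage, Set.mem_sdiff, ofBlock_mem_region, hv, true_or, true_and,
            Set.mem_univ, iff_true, ofBlock_mem_curve, hu, false_and, false_or]
          rintro ⟨i, z, rfl, -⟩
          have := hv.length_le
          simp at this
        rw [this]
        exact isOpen_univ
    · have : ofBlock e w u ⁻¹' (region e w v \ curve e w v) = ∅ := by
        ext x
        simp only [Set.mem_preimage, Set.mem_sdiff, ofBlock_mem_region, hv, false_or,
          ofBlock_mem_curve, Set.mem_empty_iff_false, iff_false]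
        rintro ⟨h, h'⟩
        exact h' (Or.inr h)
      rw [this]
      exact isOpen_empty

theorem isCompact_curve (v : List (Fin d)) : IsCompact (curve e w v) :=
  isCompact_range ((continuous_ofBlock v).comp continuous_top)

theorem isCompact_block [CompactSpace Y] (v : List (Fin d)) : IsCompact (block e w v) :=
  isCompact_range (continuous_ofBlock v)

end Points

/-! ### Finite and infinite words -/

section Words

variable {d : ℕ}

@[simp] theorem length_initSeg (c : InfWord d) (n : ℕ) : (initSeg c n).length = n := by
  simp [initSeg]

theorem getElem_initSeg (c : InfWord d) (n k : ℕ) (h : k < (initSeg c n).length) :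
    (initSeg c n)[k] = c k := by
  simp [initSeg]

theorem initSeg_prefix_initSeg (c : InfWord d) {m n : ℕ} (h : m ≤ n) :
    initSeg c m <+: initSeg c n := by
  rw [List.prefix_iff_eq_take]
  refine List.ext_getElem (by simp [h]) fun k h1 h2 => ?_
  simp [initSeg]

theorem initSeg_succ (c : InfWord d) (n : ℕ) : initSeg c (n + 1) = initSeg c n ++ [c n] := by
  rw [initSeg, List.ofFn_succ_last]
  simp [initSeg]

theorem eq_initSeg_of_prefix {c : InfWord d} {n : ℕ} {v : List (Fin d)}
    (h : v <+: initSeg c n) : v = initSeg c v.length := by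
  have h1 := h.length_le
  rw [length_initSeg] at h1
  exact (List.prefix_of_prefix_length_le h (initSeg_prefix_initSeg c h1) (by simp)).eq_of_length
    (by simp)

theorem prepend_apply_lt {l : List (Fin d)} {t : InfWord d} {n : ℕ} (h : n < l.length) :
    prepend l t n = l[n] := by
  simp [prepend, h]

theorem prepend_apply_add (l : List (Fin d)) (t : InfWord d) (n : ℕ) :
    prepend l t (l.length + n) = t n := by
  simp [prepend]

theorem initSeg_prepend_length (l : List (Fin d)) (t : InfWord d) :
    initSeg (prepend l t) l.length = l := by
  refine List.ext_getElem (by simp) fun k h1 h2 => ?_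
  rw [getElem_initSeg, prepend_apply_lt h2]

theorem initSeg_prepend_add (l : List (Fin d)) (t : InfWord d) (n : ℕ) :
    initSeg (prepend l t) (l.length + n) = l ++ initSeg t n := by
  induction n with
  | zero => rw [add_zero, initSeg_prepend_length]; simp [initSeg]
  | succ n ih => rw [← add_assoc, initSeg_succ, ih, prepend_apply_add, initSeg_succ,
      List.append_assoc]

theorem prepend_initSeg (c : InfWord d) (n : ℕ) :
    prepend (initSeg c n) (fun k => c (n + k)) = c := by
  funext k
  by_cases hk : k < n
  · rw [prepend_apply_lt (by simpa using hk), getElem_initSeg]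
  · obtain ⟨j, rfl⟩ := Nat.exists_eq_add_of_le (not_lt.1 hk)
    have := prepend_apply_add (initSeg c n) (fun k => c (n + k)) j
    rwa [length_initSeg] at this

theorem prepend_injective (l : List (Fin d)) : Function.Injective (prepend l) := by
  intro t t' h
  funext n
  rw [← prepend_apply_add l t, h, prepend_apply_add]

theorem infWord_ext {c c' : InfWord d} (h : ∀ n, initSeg c n = initSeg c' n) : c = c' := by
  funext n
  have := h (n + 1)
  rw [initSeg_succ, initSeg_succ] at this
  simpa using (List.append_inj' this rfl).2

theorem map_initSeg (g : Equiv.Perm (Fin d)) (t : InfWord d) (n : ℕ) :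
    (initSeg t n).map g = initSeg (fun k => g (t k)) n := by
  simp [initSeg, List.map_ofFn, Function.comp_def]

/-- Two finite words are independent if neither is an initial segment of the other. -/
def Indep (a b : List (Fin d)) : Prop := ¬ a <+: b ∧ ¬ b <+: a

theorem Indep.symm {a b : List (Fin d)} (h : Indep a b) : Indep b a := ⟨h.2, h.1⟩

theorem Indep.append_left {a b : List (Fin d)} (h : Indep a b) (u : List (Fin d)) :
    Indep (a ++ u) b := by
  refine ⟨fun h1 => h.1 ((List.prefix_append _ _).trans h1), fun h1 => ?_⟩
  rcases List.prefix_or_prefix_of_prefix h1 (List.prefix_append a u) with h2 | h2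
  · exact h.2 h2
  · exact h.1 h2

theorem Indep.append_right {a b : List (Fin d)} (h : Indep a b) (u : List (Fin d)) :
    Indep a (b ++ u) := (h.symm.append_left u).symm

theorem indep_append_iff {v a b : List (Fin d)} : Indep (v ++ a) (v ++ b) ↔ Indep a b := by
  simp [Indep, List.prefix_append_right_inj]

theorem indep_cons_of_ne {i j : Fin d} (h : i ≠ j) (a b : List (Fin d)) :
    Indep (i :: a) (j :: b) := by
  simp [Indep, List.cons_prefix_cons, h, h.symm]

theorem indep_cons_iff {i : Fin d} {a b : List (Fin d)} :
    Indep (i :: a) (i :: b) ↔ Indep a b := by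
  simp [Indep, List.cons_prefix_cons]

end Words

/-! ### Trees -/

namespace FinTree

variable {d : ℕ} (F : FinTree d)

theorem mem_of_prefix {v v' : List (Fin d)} (h : v <+: v') (hv : v' ∈ F.verts) :
    v ∈ F.verts := by
  obtain ⟨u, rfl⟩ := h
  induction u using List.reverseRecOn with
  | nil => simpa using hv
  | append_singleton u i ih => exact ih (F.parent_mem _ i (by rwa [← List.append_assoc] at hv))

variable {F}

theorem isInner_iff {v : List (Fin d)} : F.IsInner v ↔ ∃ i, v ++ [i] ∈ F.verts := by
  constructor
  · rintro ⟨h1, h2⟩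
    by_contra h3
    push Not at h3
    exact h2 ⟨h1, h3⟩
  · rintro ⟨i, hi⟩
    exact ⟨F.parent_mem _ _ hi, fun h => h.2 i hi⟩

theorem IsInner.child_mem {v : List (Fin d)} (h : F.IsInner v) (i : Fin d) :
    v ++ [i] ∈ F.verts := by
  obtain ⟨j, hj⟩ := isInner_iff.1 h
  exact F.complete _ _ _ hj

theorem isInner_of_prefix_of_ne {v v' : List (Fin d)} (h : v <+: v') (hne : v ≠ v')
    (hv : v' ∈ F.verts) : F.IsInner v := by
  obtain ⟨u, rfl⟩ := h
  cases u with
  | nil => simp at hne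
  | cons i u =>
    exact isInner_iff.2 ⟨i, F.mem_of_prefix ⟨u, by simp⟩ hv⟩

theorem IsLeaf.not_isInner {v : List (Fin d)} (h : F.IsLeaf v) : ¬ F.IsInner v :=
  fun h' => h'.2 h

theorem IsLeaf.eq_of_prefix {l l' : List (Fin d)} (h : F.IsLeaf l) (h' : F.IsLeaf l')
    (hp : l <+: l') : l = l' := by
  by_contra hne
  exact h.not_isInner (isInner_of_prefix_of_ne hp hne h'.1)

theorem IsLeaf.indep {l l' : List (Fin d)} (h : F.IsLeaf l) (h' : F.IsLeaf l') (hne : l ≠ l') :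
    Indep l l' :=
  ⟨fun hp => hne (h.eq_of_prefix h' hp), fun hp => hne (h'.eq_of_prefix h hp).symm⟩

theorem IsInner.not_prefix {v l : List (Fin d)} (h : F.IsInner v) (hl : F.IsLeaf l) :
    ¬ l <+: v := by
  intro hp
  by_cases hne : l = v
  · exact hl.not_isInner (hne ▸ h)
  · exact hl.not_isInner (isInner_of_prefix_of_ne hp hne h.1)

theorem exists_leaf_prefix {v : List (Fin d)} (hv : ¬ F.IsInner v) :
    ∃ l, F.IsLeaf l ∧ l <+: v := by
  induction v using List.reverseRecOn with
  | nil =>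
    refine ⟨[], ?_, List.prefix_rfl⟩
    by_contra h
    exact hv ⟨F.root_mem, h⟩
  | append_singleton v i ih =>
    by_cases h : F.IsInner v
    · refine ⟨v ++ [i], ?_, List.prefix_rfl⟩
      by_contra h'
      exact hv ⟨h.child_mem i, h'⟩
    · obtain ⟨l, hl, hlv⟩ := ih h
      exact ⟨l, hl, hlv.trans (List.prefix_append _ _)⟩

theorem IsLeaf.append_not_isInner {l : List (Fin d)} (h : F.IsLeaf l) (u : List (Fin d)) :
    ¬ F.IsInner (l ++ u) := fun h' => h'.not_prefix h (List.prefix_append _ _)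

theorem isLeaf_of_child {v : List (Fin d)} {i : Fin d} (h : F.IsInner v)
    (h' : ¬ F.IsInner (v ++ [i])) : F.IsLeaf (v ++ [i]) := by
  by_contra h1
  exact h' ⟨h.child_mem i, h1⟩

/-- A bound for the lengths of the vertices of a tree. -/
def depth (F : FinTree d) : ℕ := F.verts.sup List.length

theorem length_le_depth {v : List (Fin d)} (h : v ∈ F.verts) : v.length ≤ F.depth :=
  Finset.le_sup (f := List.length) h

theorem not_isInner_of_depth_le {v : List (Fin d)} (h : F.depth ≤ v.length) : ¬ F.IsInner v := by
  intro h1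
  obtain ⟨i, hi⟩ := isInner_iff.1 h1
  have := length_le_depth hi
  simp at this
  omega

theorem exists_leaf_initSeg (F : FinTree d) (c : InfWord d) :
    ∃ l, F.IsLeaf l ∧ l = initSeg c l.length := by
  obtain ⟨l, hl, hlv⟩ := exists_leaf_prefix (F := F) (v := initSeg c F.depth)
    (not_isInner_of_depth_le (by simp))
  exact ⟨l, hl, eq_initSeg_of_prefix hlv⟩

instance : Finite F.Leaf :=
  Set.Finite.to_subtype (F.verts.finite_toSet.subset fun _ hv => hv.1)

/-- The complete tree of depth `N`. -/
def full (d N : ℕ) : FinTree d where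
  verts := (List.finite_length_le (Fin d) N).toFinset
  root_mem := by simp
  parent_mem := by
    intro v i h
    simp at h ⊢
    omega
  complete := by
    intro v i j h
    simp at h ⊢
    omega

theorem full_isLeaf_iff (hd : 0 < d) {N : ℕ} {v : List (Fin d)} :
    (full d N).IsLeaf v ↔ v.length = N := by
  simp only [IsLeaf, full, Set.Finite.mem_toFinset, Set.mem_ofPred_eq, List.length_append,
    List.length_singleton]
  constructor
  · rintro ⟨h1, h2⟩
    have := h2 ⟨0, hd⟩
    omega
  · rintro rfl
    exact ⟨le_rfl, fun _ => by omega⟩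

/-- A nonempty finite set of pairwise independent words is the set of leaves of a tree if every
infinite word starts with an element of it. -/
theorem exists_of_leaves (L : Set (List (Fin d))) (hfin : L.Finite) (hd : 0 < d)
    (hindep : ∀ l ∈ L, ∀ l' ∈ L, l <+: l' → l = l')
    (hcover : ∀ c : InfWord d, ∃ n, initSeg c n ∈ L) :
    ∃ F : FinTree d, ∀ v, F.IsLeaf v ↔ v ∈ L := by
  have hcover' : ∀ v : List (Fin d), ∃ l ∈ L, l <+: v ∨ v <+: l := by
    intro v
    obtain ⟨n, hn⟩ := hcover (prepend v fun _ => ⟨0, hd⟩)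
    refine ⟨_, hn, ?_⟩
    have h1 := initSeg_prepend_length v fun _ => ⟨0, hd⟩
    rcases le_total n v.length with h | h
    · left
      conv_rhs => rw [← h1]
      exact initSeg_prefix_initSeg _ h
    · right
      conv_lhs => rw [← h1]
      exact initSeg_prefix_initSeg _ h
  have hfin' : {v | ∃ l ∈ L, v <+: l}.Finite := by
    have : {v | ∃ l ∈ L, v <+: l} = ⋃ l ∈ L, {v | v <+: l} := by ext; simp
    rw [this]
    refine hfin.biUnion fun l _ => ?_
    refine (l.inits.finite_toSet).subset fun v hv => ?_
    simpa using hv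
  refine ⟨⟨hfin'.toFinset, ?_, ?_, ?_⟩, fun v => ?_⟩
  · obtain ⟨n, hn⟩ := hcover fun _ => ⟨0, hd⟩
    simpa using ⟨_, hn⟩
  · intro v i h
    simp only [Set.Finite.mem_toFinset, Set.mem_ofPred_eq] at h ⊢
    obtain ⟨l, hl, h⟩ := h
    exact ⟨l, hl, (List.prefix_append _ _).trans h⟩
  · intro v i j h
    simp only [Set.Finite.mem_toFinset, Set.mem_ofPred_eq] at h ⊢
    obtain ⟨l, hl, h⟩ := h
    obtain ⟨l', hl', h' | h'⟩ := hcover' (v ++ [j])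
    · rcases List.prefix_concat_iff.1 h' with h1 | h1
      · exact ⟨l', hl', by rw [h1]⟩
      · have h2 : l' <+: l := (h1.trans (List.prefix_append _ _)).trans h
        have h3 := hindep _ hl' _ hl h2
        subst h3
        have := (h.trans h1).length_le
        simp at this
    · exact ⟨l', hl', h'⟩
  · simp only [IsLeaf, Set.Finite.mem_toFinset, Set.mem_ofPred_eq, not_exists, not_and]
    constructor
    · rintro ⟨⟨l, hl, u, rfl⟩, h⟩
      cases u with
      | nil => simpa using hl
      | cons i u => exact absurd ⟨u, by simp⟩ (h i _ hl)
    · intro hv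
      refine ⟨⟨v, hv, List.prefix_rfl⟩, fun i l hl h => ?_⟩
      have := hindep _ hv _ hl ((List.prefix_append _ _).trans h)
      subst this
      have := h.length_le
      simp at this

end FinTree

/-! ### Ends of the Cantor surface -/

section Ends

variable {d : ℕ} {O Y : Type*} [TopologicalSpace O] [TopologicalSpace Y]
  {e : CoordPlane O} {w : CoordPlane Y}

theorem exists_not_mem_region (x : CantorSurface d e w) (c : InfWord d) :
    ∃ m, x ∉ region e w (initSeg c m) := by
  rcases exists_ofBase_or_ofBlock x with ⟨b, rfl⟩ | ⟨v, y, rfl⟩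
  · refine ⟨1, fun h => ?_⟩
    have := congrArg List.length (ofBase_mem_region.1 h).1
    simp at this
  · refine ⟨v.length + 2, fun h => ?_⟩
    rcases ofBlock_mem_region.1 h with h1 | ⟨i, z, h1, -⟩
    · have := h1.length_le
      simp at this
    · have := congrArg List.length h1
      simp at this

/-- A compact set avoids a neighbourhood of every end. -/
theorem exists_disjoint_region [T2Space O] [T2Space Y] {K : Set (CantorSurface d e w)}
    (hK : IsCompact K) (c : InfWord d) : ∃ m, Disjoint K (region e w (initSeg c m)) := by
  obtain ⟨m, hm⟩ := hK.elim_directed_cover (fun m => (region e w (initSeg c m))ᶜ)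
    (fun m => (isClosed_region _).isOpen_compl)
    (fun x _ => Set.mem_iUnion.2 (exists_not_mem_region x c))
    (directed_of_isDirected_le fun m n h => Set.compl_subset_compl.2
      (region_subset_of_prefix (initSeg_prefix_initSeg c h)))
  exact ⟨m, Set.disjoint_left.2 fun x hx => hm hx⟩

/-- `f` acts on the ends of the Cantor surface, which correspond to the infinite words, by `ψ`. -/
def EndAction (f : CantorSurface d e w ≃ₜ CantorSurface d e w) (ψ : InfWord d → InfWord d) :
    Prop :=
  ∀ c n, ∃ m, f '' region e w (initSeg c m) ⊆ region e w (initSeg (ψ c) n)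

theorem EndAction.mul {f g : CantorSurface d e w ≃ₜ CantorSurface d e w}
    {ψ χ : InfWord d → InfWord d} (hf : EndAction f ψ) (hg : EndAction g χ) :
    EndAction (f * g) (ψ ∘ χ) := by
  intro c n
  obtain ⟨m, hm⟩ := hf (χ c) n
  obtain ⟨k, hk⟩ := hg c m
  refine ⟨k, ?_⟩
  rintro _ ⟨x, hx, rfl⟩
  exact hm ⟨g x, hk ⟨x, hx, rfl⟩, rfl⟩

theorem prefix_or_prefix_of_mem_region {v v' : List (Fin d)} {x : CantorSurface d e w}
    (h : x ∈ region e w v) (h' : x ∈ region e w v') : v <+: v' ∨ v' <+: v := by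
  rcases exists_ofBase_or_ofBlock x with ⟨b, rfl⟩ | ⟨u, y, rfl⟩
  · rw [(ofBase_mem_region.1 h).1]
    exact Or.inl List.nil_prefix
  · rcases ofBlock_mem_region.1 h with h1 | ⟨i, z, rfl, rfl⟩ <;>
      rcases ofBlock_mem_region.1 h' with h2 | ⟨j, z', rfl, h2⟩
    · exact List.prefix_or_prefix_of_prefix h1 h2
    · exact Or.inl (h1.trans (List.prefix_append _ _))
    · exact Or.inr (h2.trans (List.prefix_append _ _))
    · rw [bdry_injective w h2]
      exact Or.inl List.prefix_rfl

theorem region_nonempty (v : List (Fin d)) : (region e w v).Nonempty :=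
  ⟨ofBlock e w v (interiorPoint d w), ofBlock_mem_region.2 (Or.inl List.prefix_rfl)⟩

theorem EndAction.unique {f : CantorSurface d e w ≃ₜ CantorSurface d e w}
    {ψ χ : InfWord d → InfWord d} (h : EndAction f ψ) (h' : EndAction f χ) : ψ = χ := by
  funext c
  refine infWord_ext fun n => ?_
  obtain ⟨m, hm⟩ := h c n
  obtain ⟨m', hm'⟩ := h' c n
  obtain ⟨x, hx⟩ := region_nonempty (e := e) (w := w) (initSeg c (max m m'))
  have h1 := hm ⟨x, region_subset_of_prefix (initSeg_prefix_initSeg c (le_max_left m m')) hx, rfl⟩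
  have h2 := hm' ⟨x, region_subset_of_prefix (initSeg_prefix_initSeg c (le_max_right m m')) hx,
    rfl⟩
  rcases prefix_or_prefix_of_mem_region h1 h2 with h3 | h3
  · exact h3.eq_of_length (by simp)
  · exact (h3.eq_of_length (by simp)).symm

/-- A homeomorphism that is isotopic to the identity fixes all ends: the trace of an isotopy that
moves a point out of a region `R` crosses the curve that bounds `R`, and the points whose trace
crosses this curve form a compact set. -/
theorem endAction_id_of_isotopic [T2Space O] [T2Space Y] {A : Set (CantorSurface d e w)}
    {f : CantorSurface d e w ≃ₜ CantorSurface d e w} (hf : f ∈ isotopicToId A) :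
    EndAction f id := by
  obtain ⟨Φ, h1, h2, h3, -⟩ := hf
  intro c n
  let v := initSeg c n
  let K : Set (CantorSurface d e w) :=
    (fun p => (Φ.symm p).1) '' (curve e w v ×ˢ (Set.univ : Set unitInterval))
  have hK : IsCompact K := ((isCompact_curve v).prod isCompact_univ).image
    (continuous_fst.comp Φ.symm.continuous)
  obtain ⟨m, hm⟩ := exists_disjoint_region hK c
  refine ⟨max m n, ?_⟩
  rintro _ ⟨x, hx, rfl⟩
  by_contra hfx
  have hxm := region_subset_of_prefix (initSeg_prefix_initSeg c (le_max_left m n)) hx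
  have hxv : x ∈ region e w v :=
    region_subset_of_prefix (initSeg_prefix_initSeg c (le_max_right m n)) hx
  have hγ : Continuous fun t : unitInterval => (Φ (x, t)).1 :=
    continuous_fst.comp (Φ.continuous.comp (Continuous.prodMk_right x))
  have hcross : ∀ t, (Φ (x, t)).1 ∉ curve e w v := by
    intro t ht
    refine Set.disjoint_left.1 hm ⟨Φ (x, t), ⟨ht, trivial⟩, ?_⟩ hxm
    simp
  have hclopen : IsClopen ((fun t : unitInterval => (Φ (x, t)).1) ⁻¹' region e w v) := by
    refine ⟨(isClosed_region v).preimage hγ, ?_⟩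
    have : (fun t : unitInterval => (Φ (x, t)).1) ⁻¹' region e w v
        = (fun t : unitInterval => (Φ (x, t)).1) ⁻¹' (region e w v \ curve e w v) := by
      ext t
      simp [hcross t]
    rw [this]
    exact (isOpen_region_diff_curve v).preimage hγ
  have huniv := hclopen.eq_univ ⟨0, by simpa [h2] using hxv⟩
  have h4 : (1 : unitInterval) ∈ (fun t : unitInterval => (Φ (x, t)).1) ⁻¹' region e w v := by
    rw [huniv]; trivial
  apply hfx
  simpa [h3] using h4

end Ends

/-! ### Homeomorphisms that act on regions -/

section ActsOn

variable {d : ℕ} {O Y : Type*} [TopologicalSpace O] [TopologicalSpace Y]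
  {e : CoordPlane O} {w : CoordPlane Y}

/-- `f` maps the block of `v` to the block of `v'` by a representative of the mapping class `x`. -/
def ActsOnBlock (f : CantorSurface d e w ≃ₜ CantorSurface d e w) (v v' : List (Fin d))
    (x : BlockMCG d w) : Prop :=
  ∃ k : blockHomeo d w, (QuotientGroup.mk k : BlockMCG d w) = x ∧
    ∀ y, f (ofBlock e w v y) = ofBlock e w v' ((k : Block d w ≃ₜ Block d w) y)

/-- `f` maps the region of `v` to the region of `v'`, and on every block of the region it is given
by a representative of the mapping class `x`. As a consequence, the words of the blocks are changed
below `v` by the permutation `q x`, letter by letter. -/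
def ActsOnRegion (f : CantorSurface d e w ≃ₜ CantorSurface d e w) (v v' : List (Fin d))
    (x : BlockMCG d w) : Prop :=
  ∀ u, ActsOnBlock f (v ++ u) (v' ++ u.map (q d w x)) x

variable {f g : CantorSurface d e w ≃ₜ CantorSurface d e w} {v v' v'' : List (Fin d)}
  {x x' : BlockMCG d w}

theorem ActsOnBlock.image (h : ActsOnBlock f v v' x) : f '' block e w v = block e w v' := by
  obtain ⟨k, -, hk⟩ := h
  ext p
  constructor
  · rintro ⟨_, ⟨y, rfl⟩, rfl⟩
    exact ⟨_, (hk y).symm⟩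
  · rintro ⟨y, rfl⟩
    exact ⟨_, ⟨(k : Block d w ≃ₜ Block d w).symm y, rfl⟩, by rw [hk]; simp⟩

theorem ActsOnBlock.top (h : ActsOnBlock f v v' x) (z : Circle) :
    f (ofBlock e w v (top w z)) = ofBlock e w v' (CantorSurf.top w z) := by
  obtain ⟨k, -, hk⟩ := h
  rw [hk, q_mk_top]

theorem ActsOnBlock.image_curve (h : ActsOnBlock f v v' x) :
    f '' curve e w v = curve e w v' := by
  rw [curve, curve, ← Set.range_comp]
  exact congrArg Set.range (funext fun z => h.top z)

/-- The image of the block of `v` determines the images of the blocks of its children. -/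
theorem ActsOnBlock.child (h : ActsOnBlock f v v' x) {i : Fin d}
    (h' : ActsOnBlock f (v ++ [i]) v'' x') : v'' = v' ++ [q d w x i] := by
  have h1 := h'.top 1
  obtain ⟨k, rfl, hk⟩ := h
  rw [← ofBlock_bdry, hk, q_mk, ofBlock_bdry] at h1
  exact (eq_of_ofBlock_top_eq h1).symm

theorem ActsOnBlock.mul (hf : ActsOnBlock f v' v'' x') (hg : ActsOnBlock g v v' x) :
    ActsOnBlock (f * g) v v'' (x' * x) := by
  obtain ⟨k, rfl, hk⟩ := hf
  obtain ⟨l, rfl, hl⟩ := hg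
  exact ⟨k * l, rfl, fun y => by rw [Homeomorph.mul_apply, hl, hk]; rfl⟩

theorem ActsOnBlock.inv (h : ActsOnBlock f v v' x) : ActsOnBlock f⁻¹ v' v x⁻¹ := by
  obtain ⟨k, rfl, hk⟩ := h
  refine ⟨k⁻¹, rfl, fun y => (Homeomorph.symm_apply_eq f).2 ?_⟩
  rw [hk]
  congr 1
  exact ((k : Block d w ≃ₜ Block d w).apply_symm_apply y).symm

theorem ActsOnRegion.block (h : ActsOnRegion f v v' x) : ActsOnBlock f v v' x := by
  simpa using h []

theorem ActsOnRegion.append (h : ActsOnRegion f v v' x) (u : List (Fin d)) :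
    ActsOnRegion f (v ++ u) (v' ++ u.map (q d w x)) x := by
  intro t
  simpa using h (u ++ t)

theorem ActsOnRegion.mul (hf : ActsOnRegion f v' v'' x') (hg : ActsOnRegion g v v' x) :
    ActsOnRegion (f * g) v v'' (x' * x) := by
  intro u
  have := (hf (u.map (q d w x))).mul (hg u)
  simpa [Function.comp_def] using this

theorem ActsOnRegion.inv (h : ActsOnRegion f v v' x) : ActsOnRegion f⁻¹ v' v x⁻¹ := by
  intro u
  have := (h (u.map ((q d w x)⁻¹ : Equiv.Perm (Fin d)))).inv
  rw [List.map_map] at this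
  simpa [Function.comp_def] using this

theorem ActsOnRegion.mapsTo (h : ActsOnRegion f v v' x) :
    f '' region e w v ⊆ region e w v' := by
  rintro _ ⟨p, hp, rfl⟩
  obtain ⟨u, y, rfl⟩ := mem_region.1 hp
  obtain ⟨k, -, hk⟩ := h u
  exact mem_region.2 ⟨_, _, hk y⟩

theorem ActsOnRegion.image (h : ActsOnRegion f v v' x) :
    f '' region e w v = region e w v' := by
  refine h.mapsTo.antisymm fun p hp => ⟨f⁻¹ p, h.inv.mapsTo ⟨p, hp, rfl⟩, ?_⟩
  exact f.apply_symm_apply p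

theorem ActsOnRegion.image_curve (h : ActsOnRegion f v v' x) :
    f '' curve e w v = curve e w v' := h.block.image_curve

end ActsOn

/-! ### Block homeomorphisms -/

section BlockHomeomorphisms

variable {d : ℕ} {O Y : Type*} [TopologicalSpace O] [TopologicalSpace Y]
  {e : CoordPlane O} {w : CoordPlane Y}

theorem curve_subset_suited {F : FinTree d} {l : List (Fin d)} (hl : F.IsLeaf l) :
    curve e w l ⊆ suited e w F := by
  rintro _ ⟨z, rfl⟩
  rcases List.eq_nil_or_concat l with rfl | ⟨v, i, rfl⟩
  · exact Or.inl ⟨rim e z, ofBase_rim z⟩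
  · rw [List.concat_eq_append] at hl ⊢
    refine Or.inr (Set.mem_iUnion₂.2 ⟨v, ?_, bdry w i z, ofBlock_bdry v i z⟩)
    exact FinTree.isInner_iff.2 ⟨i, hl.1⟩

/-- A suited subsurface is the complement of the open regions below the leaves of its tree. -/
theorem mem_suited {F : FinTree d} {x : CantorSurface d e w} :
    x ∈ suited e w F ↔ ∀ l, F.IsLeaf l → x ∈ region e w l → x ∈ curve e w l := by
  constructor
  · intro hx l hl hxl
    rcases hx with ⟨b, rfl⟩ | hx
    · exact ofBase_mem_curve.2 (ofBase_mem_region.1 hxl)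
    · obtain ⟨v, hv, y, rfl⟩ := Set.mem_iUnion₂.1 hx
      rcases ofBlock_mem_region.1 hxl with h | h
      · exact absurd h (hv.not_prefix hl)
      · exact ofBlock_mem_curve.2 (Or.inr h)
  · intro h
    rcases exists_ofBase_or_ofBlock x with ⟨b, rfl⟩ | ⟨v, y, rfl⟩
    · exact Or.inl ⟨b, rfl⟩
    · by_cases hv : F.IsInner v
      · exact Or.inr (Set.mem_iUnion₂.2 ⟨v, hv, y, rfl⟩)
      · obtain ⟨l, hl, hlv⟩ := FinTree.exists_leaf_prefix hv
        exact curve_subset_suited hl (h l hl (ofBlock_mem_region.2 (Or.inl hlv)))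

theorem interiorPoint_not_mem_suited {F : FinTree d} {v : List (Fin d)} (hv : ¬ F.IsInner v) :
    ofBlock e w v (interiorPoint d w) ∉ suited e w F := by
  obtain ⟨l, hl, hlv⟩ := FinTree.exists_leaf_prefix hv
  intro h
  rcases ofBlock_mem_curve.1 (mem_suited.1 h l hl (ofBlock_mem_region.2 (Or.inl hlv))) with
    ⟨-, z, h⟩ | ⟨i, z, -, h⟩
  · exact top_ne_interiorPoint z h.symm
  · exact bdry_ne_interiorPoint i z h.symm

variable {f g : CantorSurface d e w ≃ₜ CantorSurface d e w} {F F' : FinTree d}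

/-- `f` is a block homeomorphism with defining surface `suited e w F` and label `h` that induces
the bijection `b` between the suited boundary components. -/
def MatchesLeaves (f : CantorSurface d e w ≃ₜ CantorSurface d e w) (F F' : FinTree d)
    (b : F.Leaf ≃ F'.Leaf) (h : F.Leaf → BlockMCG d w) : Prop :=
  ∀ a, ActsOnRegion f a.1 (b a).1 (h a)

theorem exists_actsOnBlock {h : F.Leaf → BlockMCG d w} (hF : IsDefining f F F')
    (hh : EventuallyActsLike f F h) (a : F.Leaf) (u : List (Fin d)) :
    ∃ v', ¬ F'.IsInner v' ∧ ActsOnBlock f (a.1 ++ u) v' (h a) := by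
  obtain ⟨v', hv', hf⟩ := hF.2 _ (a.2.append_not_isInner u)
  exact ⟨v', hv', hh a u v' hf⟩

/-- The image of the block of a leaf is the block of a leaf because its top curve lies in the image
of the defining surface. -/
theorem exists_actsOnRegion {h : F.Leaf → BlockMCG d w} (hF : IsDefining f F F')
    (hh : EventuallyActsLike f F h) (a : F.Leaf) :
    ∃ a', F'.IsLeaf a' ∧ ActsOnRegion f a.1 a' (h a) := by
  obtain ⟨a', ha', hf⟩ := exists_actsOnBlock hF hh a []
  rw [List.append_nil] at hf
  refine ⟨a', ?_, fun u => ?_⟩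
  · obtain ⟨l, hl, hla⟩ := FinTree.exists_leaf_prefix ha'
    have h1 : ofBlock e w a' (top w 1) ∈ suited e w F' := by
      rw [← hF.1, ← hf.top]
      exact ⟨_, curve_subset_suited a.2 ⟨1, rfl⟩, rfl⟩
    rcases ofBlock_mem_curve.1 (mem_suited.1 h1 l hl (ofBlock_mem_region.2 (Or.inl hla))) with
      ⟨h2, -⟩ | ⟨i, z, -, h2⟩
    · rwa [h2]
    · exact absurd h2 (top_ne_bdry _ _ _)
  · induction u using List.reverseRecOn with
    | nil => simpa using hf
    | append_singleton u i ih =>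
      obtain ⟨v', -, hv'⟩ := exists_actsOnBlock hF hh a (u ++ [i])
      rw [← List.append_assoc] at hv'
      have h1 := ih.child hv'
      subst h1
      simpa using hv'

theorem exists_matchesLeaves {h : F.Leaf → BlockMCG d w} (hF : IsDefining f F F')
    (hh : EventuallyActsLike f F h) : ∃ b, MatchesLeaves f F F' b h := by
  choose b hb hfb using exists_actsOnRegion hF hh
  have hinj : Function.Injective fun a => (⟨b a, hb a⟩ : F'.Leaf) := by
    intro a a' haa
    have h1 : b a = b a' := congrArg Subtype.val haa
    have h2 := (hfb a).block.image
    rw [h1, ← (hfb a').block.image] at h2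
    exact Subtype.ext (block_injective (f.injective.image_injective h2))
  have hsurj : Function.Surjective fun a => (⟨b a, hb a⟩ : F'.Leaf) := by
    intro l
    have h1 := interiorPoint_not_mem_suited (e := e) (w := w) l.2.not_isInner
    rw [← hF.1] at h1
    obtain ⟨p, hp⟩ := f.surjective (ofBlock e w l.1 (interiorPoint d w))
    have h2 : p ∉ suited e w F := fun h => h1 ⟨p, h, hp⟩
    rw [mem_suited] at h2
    push Not at h2
    obtain ⟨a, ha, hpa, -⟩ := h2
    refine ⟨⟨a, ha⟩, Subtype.ext ?_⟩
    have h3 := (hfb ⟨a, ha⟩).mapsTo ⟨p, hpa, rfl⟩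
    rw [hp] at h3
    rcases ofBlock_mem_region.1 h3 with h4 | ⟨i, z, -, h4⟩
    · exact (hb _).eq_of_prefix l.2 h4
    · exact absurd h4.symm (bdry_ne_interiorPoint i z)
  exact ⟨Equiv.ofBijective _ ⟨hinj, hsurj⟩, hfb⟩

theorem MatchesLeaves.isDefining {b : F.Leaf ≃ F'.Leaf} {h : F.Leaf → BlockMCG d w}
    (hf : MatchesLeaves f F F' b h) : IsDefining f F F' := by
  refine ⟨?_, fun v hv => ?_⟩
  · ext p
    constructor
    · rintro ⟨p, hp, rfl⟩
      rw [mem_suited] at hp ⊢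
      intro l hl hpl
      obtain ⟨a, ha⟩ := b.surjective ⟨l, hl⟩
      obtain rfl : (b a).1 = l := congrArg Subtype.val ha
      rw [← (hf a).image] at hpl
      obtain ⟨p', hp', hpp⟩ := hpl
      rw [f.injective hpp] at hp'
      rw [← (hf a).image_curve]
      exact ⟨p, hp _ a.2 hp', rfl⟩
    · intro hp
      obtain ⟨p, rfl⟩ := f.surjective p
      refine ⟨p, ?_, rfl⟩
      rw [mem_suited] at hp ⊢
      intro l hl hpl
      have h1 := hp _ (b ⟨l, hl⟩).2 ((hf ⟨l, hl⟩).mapsTo ⟨p, hpl, rfl⟩)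
      rw [← (hf ⟨l, hl⟩).image_curve] at h1
      obtain ⟨p', hp', hpp⟩ := h1
      rwa [← f.injective hpp]
  · obtain ⟨l, hl, u, rfl⟩ := FinTree.exists_leaf_prefix hv
    exact ⟨_, (b ⟨l, hl⟩).2.append_not_isInner _, (hf ⟨l, hl⟩ u).image⟩

theorem MatchesLeaves.eventuallyActsLike {b : F.Leaf ≃ F'.Leaf} {h : F.Leaf → BlockMCG d w}
    (hf : MatchesLeaves f F F' b h) : EventuallyActsLike f F h := by
  intro a u v' hv'
  have h1 := hf a u
  rw [h1.image] at hv'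
  rwa [← block_injective hv']

theorem isHBlock_iff_matchesLeaves {H : Subgroup (BlockMCG d w)} :
    IsHBlock H f ↔ ∃ F F' b h, (∀ a, h a ∈ H) ∧ MatchesLeaves f F F' b h := by
  constructor
  · rintro ⟨F, F', h, hF, hH, hh⟩
    obtain ⟨b, hb⟩ := exists_matchesLeaves hF hh
    exact ⟨F, F', b, h, hH, hb⟩
  · rintro ⟨F, F', b, h, hH, hb⟩
    exact ⟨F, F', h, hb.isDefining, hH, hb.eventuallyActsLike⟩

theorem isCompact_suited [CompactSpace O] [CompactSpace Y] (F : FinTree d) :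
    IsCompact (suited e w F) := by
  refine (isCompact_range continuous_ofBase).union ?_
  have : {v | F.IsInner v}.Finite := F.verts.finite_toSet.subset fun v hv => hv.1
  exact this.isCompact_biUnion fun v _ => isCompact_block v

/-- `f` is an `H`-block homeomorphism if and only if it acts on the region of every word of a
fixed length by an element of `H`. The tree of the image of the defining surface is recovered from
the regions into which `f` maps: these cover a neighbourhood of every end because the image of the
defining surface is compact. -/
theorem isHBlock_iff_length [CompactSpace O] [T2Space O] [CompactSpace Y] [T2Space Y]
    (hd : 0 < d) {H : Subgroup (BlockMCG d w)} :
    IsHBlock H f ↔ ∃ N : ℕ, ∀ v : List (Fin d), v.length = N →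
      ∃ v', ∃ x ∈ H, ActsOnRegion f v v' x := by
  rw [isHBlock_iff_matchesLeaves]
  constructor
  · rintro ⟨F, F', b, h, hH, hb⟩
    refine ⟨F.depth, fun v hv => ?_⟩
    obtain ⟨l, hl, u, rfl⟩ := FinTree.exists_leaf_prefix
      (FinTree.not_isInner_of_depth_le (F := F) hv.ge)
    exact ⟨_, h ⟨l, hl⟩, hH _, (hb ⟨l, hl⟩).append u⟩
  · rintro ⟨N, hN⟩
    let F := FinTree.full d N
    choose φ x hxH hφ using hN
    have hF : ∀ {v}, F.IsLeaf v ↔ v.length = N := FinTree.full_isLeaf_iff hd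
    let φ' : F.Leaf → List (Fin d) := fun a => φ a.1 (hF.1 a.2)
    have hφ' : ∀ a : F.Leaf, ActsOnRegion f a.1 (φ' a) (x a.1 (hF.1 a.2)) := fun a => hφ _ _
    have hindep : ∀ a a', φ' a <+: φ' a' → a = a' := by
      rintro a a' ⟨u, hu⟩
      have h1 := (hφ' a).append (u.map ((q d w (x a.1 (hF.1 a.2)))⁻¹ : Equiv.Perm (Fin d)))
      have h2 : (u.map ((q d w (x a.1 (hF.1 a.2)))⁻¹ : Equiv.Perm (Fin d))).map
          (q d w (x a.1 (hF.1 a.2))) = u := by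
        simp [Function.comp_def]
      rw [h2, hu] at h1
      have h3 := h1.block.image.trans (hφ' a').block.image.symm
      have h4 := block_injective (f.injective.image_injective h3)
      have h5 := congrArg List.length h4
      rw [List.length_append, List.length_map] at h5
      have h6 := hF.1 a.2
      have h7 := hF.1 a'.2
      have h8 : u = [] := List.length_eq_zero_iff.1 (by omega)
      rw [h8, List.map_nil, List.append_nil] at h4
      exact Subtype.ext h4
    obtain ⟨F', hF'⟩ := FinTree.exists_of_leaves (Set.range φ') (Set.finite_range φ') hd (by
        rintro _ ⟨a, rfl⟩ _ ⟨a', rfl⟩ h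
        rw [hindep a a' h]) (by
        intro c
        obtain ⟨m, hm⟩ := exists_disjoint_region
          ((isCompact_suited (e := e) (w := w) F).image f.continuous) c
        have key : ∃ m a, φ' a <+: initSeg c m := by
          let p := ofBlock e w (initSeg c m) (interiorPoint d w)
          have h1 : p ∈ region e w (initSeg c m) := ofBlock_mem_region.2 (Or.inl List.prefix_rfl)
          have h2 : f⁻¹ p ∉ suited e w F := fun h =>
            Set.disjoint_left.1 hm ⟨_, h, f.apply_symm_apply p⟩ h1
          rw [mem_suited] at h2
          push Not at h2
          obtain ⟨a, ha, hpa, -⟩ := h2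
          have h3 := (hφ' ⟨a, ha⟩).mapsTo ⟨_, hpa, f.apply_symm_apply p⟩
          rcases ofBlock_mem_region.1 h3 with h4 | ⟨i, z, -, h4⟩
          · exact ⟨m, _, h4⟩
          · exact absurd h4.symm (bdry_ne_interiorPoint i z)
        obtain ⟨m, a, ha⟩ := key
        exact ⟨_, a, eq_initSeg_of_prefix ha⟩)
    let b : F.Leaf ≃ F'.Leaf := Equiv.ofBijective
      (fun a => ⟨φ' a, (hF' _).2 ⟨a, rfl⟩⟩) ⟨fun a a' h =>
        hindep a a' ⟨[], (List.append_nil _).trans (congrArg Subtype.val h)⟩, fun l => by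
        obtain ⟨a, ha⟩ := (hF' l.1).1 l.2
        exact ⟨a, Subtype.ext ha⟩⟩
    exact ⟨F, F', b, fun a => x a.1 (hF.1 a.2), fun a => hxH _ _, hφ'⟩

theorem IsHBlock.mul [CompactSpace O] [T2Space O] [CompactSpace Y] [T2Space Y] (hd : 0 < d)
    {H : Subgroup (BlockMCG d w)} (hf : IsHBlock H f) (hg : IsHBlock H g) :
    IsHBlock H (f * g) := by
  rw [isHBlock_iff_length hd] at hf hg ⊢
  obtain ⟨N, hN⟩ := hf
  obtain ⟨M, hM⟩ := hg
  refine ⟨M + N, fun v hv => ?_⟩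
  obtain ⟨v₁, x, hx, hv₁⟩ := hM (v.take M) (by simp [hv])
  have h1 := hv₁.append (v.drop M)
  rw [List.take_append_drop] at h1
  obtain ⟨v₂, y, hy, hv₂⟩ := hN ((v₁ ++ (v.drop M).map (q d w x)).take N) (by simp [hv])
  have h2 := hv₂.append ((v₁ ++ (v.drop M).map (q d w x)).drop N)
  rw [List.take_append_drop] at h2
  exact ⟨_, y * x, H.mul_mem hy hx, h2.mul h1⟩

theorem IsHBlock.inv {H : Subgroup (BlockMCG d w)} (hf : IsHBlock H f) : IsHBlock H f⁻¹ := by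
  rw [isHBlock_iff_matchesLeaves] at hf ⊢
  obtain ⟨F, F', b, h, hH, hb⟩ := hf
  refine ⟨F', F, b.symm, fun a => (h (b.symm a))⁻¹, fun a => H.inv_mem (hH _), fun a => ?_⟩
  simpa using (hb (b.symm a)).inv

theorem isHBlock_one (H : Subgroup (BlockMCG d w)) :
    IsHBlock H (1 : CantorSurface d e w ≃ₜ CantorSurface d e w) :=
  isHBlock_iff_matchesLeaves.2 ⟨FinTree.full d 0, FinTree.full d 0, Equiv.refl _, fun _ => 1,
    fun _ => H.one_mem, fun a u => ⟨1, rfl, fun y => by simp⟩⟩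

end BlockHomeomorphisms

/-! ### The homeomorphism of a symmetric tree pair -/

section TreePair

variable {d : ℕ}

theorem exists_leaf_eq_prepend (F : FinTree d) (c : InfWord d) :
    ∃ (l : F.Leaf) (t : InfWord d), c = prepend l.1 t := by
  obtain ⟨l, hl, h⟩ := F.exists_leaf_initSeg c
  refine ⟨⟨l, hl⟩, fun k => c (l.length + k), ?_⟩
  conv_lhs => rw [← prepend_initSeg c l.length, ← h]

theorem leaf_eq_of_prepend_eq {F : FinTree d} {l l' : F.Leaf} {t t' : InfWord d}
    (h : prepend l.1 t = prepend l'.1 t') : l = l' ∧ t = t' := by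
  have h1 : l.1 <+: l'.1 ∨ l'.1 <+: l.1 := by
    rw [← initSeg_prepend_length l.1 t, ← initSeg_prepend_length l'.1 t', h]
    rcases le_total l.1.length l'.1.length with h2 | h2
    · exact Or.inl (initSeg_prefix_initSeg _ h2)
    · exact Or.inr (initSeg_prefix_initSeg _ h2)
  have h2 : l = l' := by
    rcases h1 with h1 | h1
    · exact Subtype.ext (l.2.eq_of_prefix l'.2 h1)
    · exact Subtype.ext (l'.2.eq_of_prefix l.2 h1).symm
  subst h2
  exact ⟨rfl, prepend_injective _ h⟩

/-- The leaf of `F` at which an infinite word starts. -/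
def leafOf (F : FinTree d) (c : InfWord d) : F.Leaf := (exists_leaf_eq_prepend F c).choose

/-- The rest of an infinite word after the leaf of `F` at which it starts. -/
def tailOf (F : FinTree d) (c : InfWord d) : InfWord d :=
  (exists_leaf_eq_prepend F c).choose_spec.choose

theorem prepend_leafOf_tailOf (F : FinTree d) (c : InfWord d) :
    prepend (leafOf F c).1 (tailOf F c) = c :=
  (exists_leaf_eq_prepend F c).choose_spec.choose_spec.symm

theorem leafOf_prepend {F : FinTree d} (l : F.Leaf) (t : InfWord d) :
    leafOf F (prepend l.1 t) = l :=
  (leaf_eq_of_prepend_eq (prepend_leafOf_tailOf F (prepend l.1 t))).1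

theorem tailOf_prepend {F : FinTree d} (l : F.Leaf) (t : InfWord d) :
    tailOf F (prepend l.1 t) = t :=
  (leaf_eq_of_prepend_eq (prepend_leafOf_tailOf F (prepend l.1 t))).2

theorem isOpen_setOf_initSeg_eq (c : InfWord d) (n : ℕ) :
    IsOpen {c' : InfWord d | initSeg c' n = initSeg c n} := by
  have : {c' : InfWord d | initSeg c' n = initSeg c n}
      = ⋂ k : Fin n, (fun c' : InfWord d => c' k) ⁻¹' {c k} := by
    ext c'
    simp only [Set.mem_ofPred_eq, Set.mem_iInter, Set.mem_preimage, Set.mem_singleton_iff,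
      initSeg, List.ofFn_inj]
    exact funext_iff
  rw [this]
  exact isOpen_iInter_of_finite fun k => (isOpen_discrete _).preimage (continuous_apply _)

theorem continuous_prepend (l : List (Fin d)) : Continuous (prepend l) := by
  refine continuous_pi fun n => ?_
  by_cases h : n < l.length
  · simp only [prepend, h, dif_pos]
    exact continuous_const
  · simp only [prepend, h, dif_neg, not_false_eq_true]
    exact continuous_apply _

/-- The map of infinite words that is described by a tree pair. -/
def treePairFun (F F' : FinTree d) (b : F.Leaf → F'.Leaf) (g : F.Leaf → Equiv.Perm (Fin d))
    (c : InfWord d) : InfWord d :=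
  prepend (b (leafOf F c)).1 fun n => g (leafOf F c) (tailOf F c n)

theorem treePairFun_prepend (F F' : FinTree d) (b : F.Leaf → F'.Leaf)
    (g : F.Leaf → Equiv.Perm (Fin d)) (l : F.Leaf) (t : InfWord d) :
    treePairFun F F' b g (prepend l.1 t) = prepend (b l).1 fun n => g l (t n) := by
  rw [treePairFun, leafOf_prepend, tailOf_prepend]

theorem continuous_treePairFun (F F' : FinTree d) (b : F.Leaf → F'.Leaf)
    (g : F.Leaf → Equiv.Perm (Fin d)) : Continuous (treePairFun F F' b g) := by
  refine continuous_iff_continuousAt.2 fun c => ?_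
  obtain ⟨l, t, rfl⟩ := exists_leaf_eq_prepend F c
  have h1 : (fun c' : InfWord d => prepend (b l).1 fun n => g l (c' (l.1.length + n)))
      =ᶠ[𝓝 (prepend l.1 t)] treePairFun F F' b g := by
    filter_upwards [(isOpen_setOf_initSeg_eq (prepend l.1 t) l.1.length).mem_nhds rfl] with c' hc
    rw [initSeg_prepend_length] at hc
    conv_rhs => rw [← prepend_initSeg c' l.1.length, hc, treePairFun_prepend]
  refine ContinuousAt.congr (Continuous.continuousAt ?_) h1
  refine (continuous_prepend _).comp (continuous_pi fun n => ?_)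
  exact continuous_of_discreteTopology.comp (continuous_apply _)

/-- The homeomorphism of the Cantor set that is described by a symmetric tree pair. -/
def treePairHomeo (F F' : FinTree d) (b : F.Leaf ≃ F'.Leaf) (g : F.Leaf → Equiv.Perm (Fin d)) :
    InfWord d ≃ₜ InfWord d where
  toFun := treePairFun F F' b g
  invFun := treePairFun F' F b.symm fun l => (g (b.symm l))⁻¹
  left_inv c := by
    obtain ⟨l, t, rfl⟩ := exists_leaf_eq_prepend F c
    rw [treePairFun_prepend, treePairFun_prepend]
    simp
  right_inv c := by
    obtain ⟨l, t, rfl⟩ := exists_leaf_eq_prepend F' c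
    rw [treePairFun_prepend, treePairFun_prepend]
    simp
  continuous_toFun := continuous_treePairFun _ _ _ _
  continuous_invFun := continuous_treePairFun _ _ _ _

theorem isSymTreePair_treePairHomeo (F F' : FinTree d) (b : F.Leaf ≃ F'.Leaf)
    (g : F.Leaf → Equiv.Perm (Fin d)) : IsSymTreePair F F' b g (treePairHomeo F F' b g) :=
  treePairFun_prepend F F' b g

theorem IsSymTreePair.eq_treePairHomeo {F F' : FinTree d} {b : F.Leaf ≃ F'.Leaf}
    {g : F.Leaf → Equiv.Perm (Fin d)} {ψ : InfWord d ≃ₜ InfWord d}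
    (h : IsSymTreePair F F' b g ψ) : ψ = treePairHomeo F F' b g := by
  ext c : 1
  obtain ⟨l, t, rfl⟩ := exists_leaf_eq_prepend F c
  rw [h, isSymTreePair_treePairHomeo]

variable {O Y : Type*} [TopologicalSpace O] [TopologicalSpace Y]
  {e : CoordPlane O} {w : CoordPlane Y}

theorem MatchesLeaves.endAction {f : CantorSurface d e w ≃ₜ CantorSurface d e w}
    {F F' : FinTree d} {b : F.Leaf ≃ F'.Leaf} {h : F.Leaf → BlockMCG d w}
    (hf : MatchesLeaves f F F' b h) :
    EndAction f (treePairHomeo F F' b fun a => q d w (h a)) := by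
  intro c n
  obtain ⟨l, t, rfl⟩ := exists_leaf_eq_prepend F c
  refine ⟨l.1.length + n, ?_⟩
  rw [isSymTreePair_treePairHomeo, initSeg_prepend_add, ((hf l).append _).image, map_initSeg,
    ← initSeg_prepend_add]
  exact region_subset_of_prefix (initSeg_prefix_initSeg _ (Nat.le_add_left _ _))

end TreePair

/-! ### Homeomorphisms that permute the children of every block -/

section Portrait

variable {d : ℕ}

/-- The automorphism of the rooted `d`-ary tree that applies the permutation `σ v` to the letter
that follows the initial segment `v`. -/
def treeMap : (List (Fin d) → Equiv.Perm (Fin d)) → List (Fin d) → List (Fin d)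
  | _, [] => []
  | σ, i :: v => σ [] i :: treeMap (fun u => σ (i :: u)) v

/-- The inverse of `treeMap σ`. -/
def treeMapInv : (List (Fin d) → Equiv.Perm (Fin d)) → List (Fin d) → List (Fin d)
  | _, [] => []
  | σ, j :: v => (σ [])⁻¹ j :: treeMapInv (fun u => σ ((σ [])⁻¹ j :: u)) v

theorem treeMap_nil (σ : List (Fin d) → Equiv.Perm (Fin d)) : treeMap σ [] = [] := rfl

theorem treeMapInv_nil (σ : List (Fin d) → Equiv.Perm (Fin d)) : treeMapInv σ [] = [] := rfl

theorem treeMapInv_treeMap (σ : List (Fin d) → Equiv.Perm (Fin d)) (v : List (Fin d)) :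
    treeMapInv σ (treeMap σ v) = v := by
  induction v generalizing σ with
  | nil => rfl
  | cons i v ih => simp [treeMap, treeMapInv, ih]

theorem treeMap_treeMapInv (σ : List (Fin d) → Equiv.Perm (Fin d)) (v : List (Fin d)) :
    treeMap σ (treeMapInv σ v) = v := by
  induction v generalizing σ with
  | nil => rfl
  | cons i v ih =>
    simp only [treeMap, treeMapInv]
    rw [ih]
    simp

theorem treeMap_append_singleton (σ : List (Fin d) → Equiv.Perm (Fin d)) (v : List (Fin d))
    (i : Fin d) : treeMap σ (v ++ [i]) = treeMap σ v ++ [σ v i] := by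
  induction v generalizing σ with
  | nil => rfl
  | cons j v ih => simp [treeMap, ih]

theorem treeMapInv_append_singleton (σ : List (Fin d) → Equiv.Perm (Fin d)) (v : List (Fin d))
    (i : Fin d) : treeMapInv σ (v ++ [i]) = treeMapInv σ v ++ [(σ (treeMapInv σ v))⁻¹ i] := by
  rw [← treeMapInv_treeMap σ (treeMapInv σ v ++ _), treeMap_append_singleton, treeMap_treeMapInv]
  simp

/-- A word is fixed if the permutations at its proper initial segments are trivial. -/
theorem treeMap_eq_self {σ : List (Fin d) → Equiv.Perm (Fin d)} {v : List (Fin d)}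
    (h : ∀ u i, u ++ [i] <+: v → σ u = 1) : treeMap σ v = v := by
  induction v using List.reverseRecOn with
  | nil => rfl
  | append_singleton v i ih =>
    rw [treeMap_append_singleton, h v i List.prefix_rfl,
      ih fun u j hu => h u j (hu.trans (List.prefix_append _ _))]
    simp

theorem treeMap_append {σ : List (Fin d) → Equiv.Perm (Fin d)} {v : List (Fin d)}
    {s : Equiv.Perm (Fin d)} (h : ∀ u, σ (v ++ u) = s) (u : List (Fin d)) :
    treeMap σ (v ++ u) = treeMap σ v ++ u.map s := by
  induction u using List.reverseRecOn with
  | nil => simp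
  | append_singleton u i ih =>
    rw [← List.append_assoc, treeMap_append_singleton, ih, h]
    simp

variable {O Y : Type*} [TopologicalSpace O] [TopologicalSpace Y]
  (e : CoordPlane O) {w : CoordPlane Y}

/-- The map of the Cantor surface that is the identity on `O_1` and maps the block of `v` to the
block of `φ v` by `k v`. -/
def blockwiseMap (k : List (Fin d) → blockHomeo d w) (φ : List (Fin d) → List (Fin d))
    (h0 : φ [] = []) (hφ : ∀ v i, φ (v ++ [i]) = φ v ++ [q d w (QuotientGroup.mk (k v)) i]) :
    CantorSurface d e w → CantorSurface d e w :=
  Quot.lift (Sum.elim (ofBase e w)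
    fun p => ofBlock e w (φ p.1) ((k p.1 : Block d w ≃ₜ Block d w) p.2)) (by
      rintro _ _ (z | ⟨v, i, z⟩)
      · simp only [Sum.elim_inl, Sum.elim_inr]
        rw [h0, q_mk_top, ofBase_rim]
      · simp only [Sum.elim_inr]
        rw [q_mk, q_mk_top, hφ, ofBlock_bdry])

theorem blockwiseMap_ofBlock (k : List (Fin d) → blockHomeo d w)
    (φ : List (Fin d) → List (Fin d)) (h0 : φ [] = [])
    (hφ : ∀ v i, φ (v ++ [i]) = φ v ++ [q d w (QuotientGroup.mk (k v)) i]) (v : List (Fin d))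
    (y : Block d w) : blockwiseMap e k φ h0 hφ (ofBlock e w v y) =
      ofBlock e w (φ v) ((k v : Block d w ≃ₜ Block d w) y) := rfl

theorem continuous_blockwiseMap (k : List (Fin d) → blockHomeo d w)
    (φ : List (Fin d) → List (Fin d)) (h0 : φ [] = [])
    (hφ : ∀ v i, φ (v ++ [i]) = φ v ++ [q d w (QuotientGroup.mk (k v)) i]) :
    Continuous (blockwiseMap e k φ h0 hφ) :=
  continuous_iff_comp.2 ⟨continuous_ofBase, fun v =>
    (continuous_ofBlock (φ v)).comp (k v : Block d w ≃ₜ Block d w).continuous⟩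

/-- The homeomorphism of the Cantor surface that is the identity on `O_1` and is given on the block
of `v` by `k v`; the permutation of the blocks is the tree automorphism that results from the
permutations of boundary components. -/
def portraitHomeo (k : List (Fin d) → blockHomeo d w) :
    CantorSurface d e w ≃ₜ CantorSurface d e w where
  toFun := blockwiseMap e k (treeMap fun v => q d w (QuotientGroup.mk (k v))) (treeMap_nil _)
    (treeMap_append_singleton _)
  invFun := blockwiseMap e
    (fun v => (k (treeMapInv (fun v => q d w (QuotientGroup.mk (k v))) v))⁻¹)
    (treeMapInv fun v => q d w (QuotientGroup.mk (k v))) (treeMapInv_nil _)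
    (fun v i => by rw [treeMapInv_append_singleton, QuotientGroup.mk_inv, map_inv])
  left_inv p := by
    rcases exists_ofBase_or_ofBlock p with ⟨b, rfl⟩ | ⟨v, y, rfl⟩
    · rfl
    · rw [blockwiseMap_ofBlock, blockwiseMap_ofBlock, treeMapInv_treeMap]
      congr 1
      exact (k v : Block d w ≃ₜ Block d w).symm_apply_apply y
  right_inv p := by
    rcases exists_ofBase_or_ofBlock p with ⟨b, rfl⟩ | ⟨v, y, rfl⟩
    · rfl
    · rw [blockwiseMap_ofBlock, blockwiseMap_ofBlock, treeMap_treeMapInv]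
      congr 1
      exact (k _ : Block d w ≃ₜ Block d w).apply_symm_apply y
  continuous_toFun := continuous_blockwiseMap e _ _ _ _
  continuous_invFun := continuous_blockwiseMap e _ _ _ _

variable {e}

theorem portraitHomeo_ofBlock (k : List (Fin d) → blockHomeo d w) (v : List (Fin d))
    (y : Block d w) : portraitHomeo e k (ofBlock e w v y) =
      ofBlock e w (treeMap (fun v => q d w (QuotientGroup.mk (k v))) v)
        ((k v : Block d w ≃ₜ Block d w) y) := rfl

theorem actsOnRegion_portraitHomeo {k : List (Fin d) → blockHomeo d w} {v : List (Fin d)}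
    {s : blockHomeo d w} (h : ∀ u, k (v ++ u) = s) :
    ActsOnRegion (portraitHomeo e k) v
      (treeMap (fun v => q d w (QuotientGroup.mk (k v))) v) (QuotientGroup.mk s) := by
  intro u
  refine ⟨s, rfl, fun y => ?_⟩
  rw [portraitHomeo_ofBlock, treeMap_append (s := q d w (QuotientGroup.mk s)), h]
  intro u
  rw [h]

end Portrait

/-! ### Permuting the regions of the leaves of a tree -/

section Realization

variable {d : ℕ} {O Y : Type*} [TopologicalSpace O] [TopologicalSpace Y]
  {e : CoordPlane O} {w : CoordPlane Y}

variable (d e w) in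
/-- The homeomorphisms that fix `O_1` pointwise. -/
abbrev baseFixing : Subgroup (CantorSurface d e w ≃ₜ CantorSurface d e w) :=
  fixingHomeo (Set.range (ofBase e w))

theorem baseFixing_le_cantorHomeo : baseFixing d e w ≤ cantorHomeo d e w := by
  rintro f hf _ ⟨b, -, rfl⟩
  exact hf _ ⟨b, rfl⟩

theorem portraitHomeo_mem (k : List (Fin d) → blockHomeo d w) :
    portraitHomeo e k ∈ baseFixing d e w := by
  rintro _ ⟨b, rfl⟩
  rfl

theorem actsOnRegion_refl (v : List (Fin d)) :
    ActsOnRegion (1 : CantorSurface d e w ≃ₜ CantorSurface d e w) v v 1 :=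
  fun u => ⟨1, rfl, fun y => by simp⟩

/-- `f` moves the region of `v` to the region of `v'` without changing the words below it. -/
abbrev Moves (f : CantorSurface d e w ≃ₜ CantorSurface d e w) (v v' : List (Fin d)) : Prop :=
  ActsOnRegion f v v' 1

theorem Moves.mul {f g : CantorSurface d e w ≃ₜ CantorSurface d e w} {v v' v'' : List (Fin d)}
    (hf : Moves f v' v'') (hg : Moves g v v') : Moves (f * g) v v'' := by
  simpa using ActsOnRegion.mul hf hg

theorem Moves.inv {f : CantorSurface d e w ≃ₜ CantorSurface d e w} {v v' : List (Fin d)}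
    (hf : Moves f v v') : Moves f⁻¹ v' v := by
  simpa using ActsOnRegion.inv hf

theorem Moves.append {f : CantorSurface d e w ≃ₜ CantorSurface d e w} {v v' : List (Fin d)}
    (hf : Moves f v v') (u : List (Fin d)) : Moves f (v ++ u) (v' ++ u) := by
  simpa using ActsOnRegion.append hf u

/-- `f` exchanges the regions of `a` and `b` and fixes every region that is disjoint from them. -/
structure Swaps (f : CantorSurface d e w ≃ₜ CantorSurface d e w) (a b : List (Fin d)) :
    Prop where
  mem : f ∈ baseFixing d e w
  left : Moves f a b
  right : Moves f b a
  fix : ∀ c, Indep c a → Indep c b → Moves f c c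

theorem Swaps.symm {f : CantorSurface d e w ≃ₜ CantorSurface d e w} {a b : List (Fin d)}
    (h : Swaps f a b) : Swaps f b a :=
  ⟨h.mem, h.right, h.left, fun c hb ha => h.fix c ha hb⟩

theorem Swaps.conj {f g : CantorSurface d e w ≃ₜ CantorSurface d e w} {a b a' b' : List (Fin d)}
    (h : Swaps f a b) (hg : g ∈ baseFixing d e w) (ha : Moves g a a') (hb : Moves g b b')
    (hc : ∀ c, Indep c a' → Indep c b' → ∃ c', Indep c' a ∧ Indep c' b ∧ Moves g c' c) :
    Swaps (g * f * g⁻¹) a' b' := by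
  refine ⟨(baseFixing d e w).mul_mem ((baseFixing d e w).mul_mem hg h.mem)
    ((baseFixing d e w).inv_mem hg), (hb.mul h.left).mul ha.inv, (ha.mul h.right).mul hb.inv,
    fun c h1 h2 => ?_⟩
  obtain ⟨c', h3, h4, h5⟩ := hc c h1 h2
  exact (h5.mul (h.fix c' h3 h4)).mul h5.inv

variable (e w) in
/-- Some homeomorphism exchanges the regions of `a` and `b`. -/
def Swappable (a b : List (Fin d)) : Prop :=
  ∃ f : CantorSurface d e w ≃ₜ CantorSurface d e w, Swaps f a b

theorem Swappable.symm {a b : List (Fin d)} (h : Swappable e w a b) : Swappable e w b a :=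
  let ⟨f, hf⟩ := h
  ⟨f, hf.symm⟩

/-- Conjugation by a swap of `x` and `y`. The condition on `y` says that a word that is independent
of `x` and `b` cannot be a proper initial segment of `y`. -/
theorem Swappable.trans {x y b : List (Fin d)} (hyb : Swappable e w y b)
    (hxy : Swappable e w x y) (h1 : Indep x b) (h2 : Indep y b) (h3 : Indep x y)
    (h : ∀ c, Indep c x → Indep c b → Indep c y ∨ y <+: c) : Swappable e w x b := by
  obtain ⟨f, hf⟩ := hyb
  obtain ⟨g, hg⟩ := hxy
  refine ⟨_, hf.conj hg.mem hg.right (hg.fix b h1.symm h2.symm) fun c hcx hcb => ?_⟩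
  rcases h c hcx hcb with hcy | ⟨z, rfl⟩
  · exact ⟨c, hcy, hcb, hg.fix c hcx hcy⟩
  · exact ⟨x ++ z, h3.append_left z, h1.append_left z, hg.left.append z⟩

/-- A proper initial segment of `p ++ [m]` is not independent of a word that extends `p`. -/
theorem indep_or_prefix_of_parent_prefix {p x c : List (Fin d)} (m : Fin d) (hp : p <+: x)
    (hc : Indep c x) : Indep c (p ++ [m]) ∨ p ++ [m] <+: c := by
  by_cases h : p ++ [m] <+: c
  · exact Or.inr h
  · refine Or.inl ⟨fun h1 => ?_, h⟩
    rcases List.prefix_concat_iff.1 h1 with h2 | h2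
    · exact h (h2 ▸ List.prefix_rfl)
    · exact hc.1 (h2.trans hp)

/-- The two kinds of swaps from which all others are obtained: those of siblings, and for every
word `v` one swap of a child of `v` with a grandchild of `v`. -/
structure HasBasicSwaps (e : CoordPlane O) (w : CoordPlane Y) (i₀ i₁ : Fin d) : Prop where
  ne : i₀ ≠ i₁
  perm : ∀ (v : List (Fin d)) (σ : Equiv.Perm (Fin d)),
    ∃ g ∈ baseFixing d e w, (∀ i, Moves g (v ++ [i]) (v ++ [σ i])) ∧ ∀ c, Indep c v → Moves g c c
  mix : ∀ v : List (Fin d), Swappable e w (v ++ [i₁]) (v ++ [i₀, i₀])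

variable {i₀ i₁ : Fin d}

theorem indep_or_child_prefix {v c : List (Fin d)} {i : Fin d} (h : Indep c (v ++ [i])) :
    Indep c v ∨ ∃ j u, c = v ++ j :: u := by
  by_cases h1 : v <+: c
  · obtain ⟨t, rfl⟩ := h1
    cases t with
    | nil => exact absurd (by simp) h.1
    | cons j u => exact Or.inr ⟨j, u, rfl⟩
  · exact Or.inl ⟨fun h2 => h.1 (h2.trans (List.prefix_append _ _)), h1⟩

theorem HasBasicSwaps.sibling (hS : HasBasicSwaps e w i₀ i₁) (v : List (Fin d)) {i j : Fin d}
    (hij : i ≠ j) : Swappable e w (v ++ [i]) (v ++ [j]) := by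
  obtain ⟨g, hg, h1, h2⟩ := hS.perm v (Equiv.swap i j)
  refine ⟨g, hg, by simpa using h1 i, by simpa using h1 j, fun c hi hj => ?_⟩
  rcases indep_or_child_prefix hi with h | ⟨m, u, rfl⟩
  · exact h2 c h
  · have hmi : m ≠ i := by
      rintro rfl
      exact hi.2 ⟨u, by simp⟩
    have hmj : m ≠ j := by
      rintro rfl
      exact hj.2 ⟨u, by simp⟩
    have h3 := (h1 m).append u
    rw [Equiv.swap_apply_of_ne_of_ne hmi hmj] at h3
    simpa using h3

theorem indep_child_grandchild {v : List (Fin d)} {i j k : Fin d} (h : i ≠ j) :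
    Indep (v ++ [i]) (v ++ [j, k]) := indep_append_iff.2 (indep_cons_of_ne h _ _)

theorem HasBasicSwaps.child_grandchild (hS : HasBasicSwaps e w i₀ i₁) (v : List (Fin d))
    {i j : Fin d} (k : Fin d) (hij : i ≠ j) : Swappable e w (v ++ [i]) (v ++ [j, k]) := by
  have step : Swappable e w (v ++ [i₁]) (v ++ [i₀, k]) := by
    by_cases hk : k = i₀
    · subst hk
      exact hS.mix v
    · have h1 := hS.sibling (v ++ [i₀]) hk
      refine (Swappable.trans (hS.mix v).symm (b := v ++ [i₁]) (x := v ++ [i₀, k])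
        (by simpa using h1) (indep_child_grandchild hS.ne.symm).symm
        (indep_child_grandchild hS.ne.symm).symm
        (indep_append_iff.2 (indep_cons_iff.2 (indep_cons_of_ne hk _ _))) fun c hc _ => ?_).symm
      have := indep_or_prefix_of_parent_prefix (p := v ++ [i₀]) i₀ (x := v ++ [i₀, k])
        (by simp [List.prefix_append_right_inj]) hc
      simpa using this
  obtain ⟨σ, h0, h1⟩ : ∃ σ : Equiv.Perm (Fin d), σ i₀ = j ∧ σ i₁ = i := by
    refine ⟨Equiv.swap (Equiv.swap i₀ j i₁) i * Equiv.swap i₀ j, ?_, ?_⟩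
    · rw [Equiv.Perm.mul_apply, Equiv.swap_apply_left, Equiv.swap_apply_of_ne_of_ne]
      · intro h
        exact hS.ne.symm
          ((Equiv.swap i₀ j).injective (h.symm.trans (Equiv.swap_apply_left _ _).symm))
      · exact hij.symm
    · rw [Equiv.Perm.mul_apply, Equiv.swap_apply_left]
  obtain ⟨f, hf⟩ := step
  obtain ⟨g, hg, hg1, hg2⟩ := hS.perm v σ
  have h2 : Moves g (v ++ [i₁]) (v ++ [i]) := by rw [← h1]; exact hg1 i₁
  have h3 : Moves g (v ++ [i₀, k]) (v ++ [j, k]) := by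
    have := (hg1 i₀).append [k]
    rw [h0] at this
    simpa using this
  refine ⟨_, hf.conj hg h2 h3 fun c hc1 hc2 => ?_⟩
  rcases indep_or_child_prefix hc1 with h | ⟨m, u, rfl⟩
  · exact ⟨c, h.append_right _, h.append_right _, hg2 c h⟩
  · have h4 : Moves g (v ++ σ.symm m :: u) (v ++ m :: u) := by
      have := (hg1 (σ.symm m)).append u
      simpa using this
    refine ⟨_, ?_, ?_, h4⟩
    · rw [indep_append_iff] at hc1 ⊢
      refine indep_cons_of_ne (fun h => ?_) _ _
      rw [Equiv.symm_apply_eq, h1] at h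
      subst h
      simp [Indep] at hc1
    · rw [indep_append_iff] at hc2 ⊢
      by_cases h : m = j
      · subst h
        rw [← h0, Equiv.symm_apply_apply, indep_cons_iff]
        exact indep_cons_iff.1 hc2
      · refine indep_cons_of_ne (fun h' => h ?_) _ _
        rw [Equiv.symm_apply_eq, h0] at h'
        exact h'

theorem HasBasicSwaps.exists_ne (hS : HasBasicSwaps e w i₀ i₁) (m : Fin d) : ∃ m', m' ≠ m := by
  by_cases h : m = i₀
  · exact ⟨i₁, fun h' => hS.ne (h.symm.trans h'.symm)⟩
  · exact ⟨i₀, fun h' => h h'.symm⟩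

/-- The last letter of a word with at least two letters after its branching point from `b` can be
dropped: conjugate by the swap of `p ++ [m, k]` with a sibling of its parent. -/
theorem HasBasicSwaps.shorten (hS : HasBasicSwaps e w i₀ i₁) {p b : List (Fin d)} (m k : Fin d)
    (hp : Indep p b) (h : ∀ m', Swappable e w (p ++ [m']) b) : Swappable e w (p ++ [m, k]) b := by
  obtain ⟨m', hm⟩ := hS.exists_ne m
  exact Swappable.trans (h m') (hS.child_grandchild p k hm).symm (hp.append_left _)
    (hp.append_left _) (indep_child_grandchild hm).symm fun c hc _ =>
      indep_or_prefix_of_parent_prefix m' (List.prefix_append _ _) hc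

/-- The regions of two independent words can be exchanged. -/
theorem HasBasicSwaps.swappable (hS : HasBasicSwaps e w i₀ i₁) {a b : List (Fin d)}
    (hab : Indep a b) : Swappable e w a b := by
  have grand : ∀ (v : List (Fin d)) (i j k m : Fin d), i ≠ j →
      Swappable e w (v ++ [i, k]) (v ++ [j, m]) := by
    intro v i j k m hij
    obtain ⟨k', hk⟩ := hS.exists_ne k
    -- conjugate the swap of `v j` and `v i k m` by the swap of `v j` and `v i k`
    have h1 : Swappable e w (v ++ [i, k, m]) (v ++ [j]) := by
      have h := hS.shorten (p := v ++ [i]) (b := v ++ [j]) k m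
        (indep_append_iff.2 (indep_cons_of_ne hij _ _)) fun m' => by
          simpa using (hS.child_grandchild v m' hij.symm).symm
      simpa using h
    obtain ⟨f, hf⟩ := h1.symm
    obtain ⟨g, hg⟩ := hS.child_grandchild v k hij.symm
    have hm : Moves g (v ++ [i, k, m]) (v ++ [j, m]) := by
      simpa using hg.right.append [m]
    refine ⟨_, hf.conj hg.mem hg.left hm fun c hc1 hc2 => ?_⟩
    by_cases hj : v ++ [j] <+: c
    · obtain ⟨z, rfl⟩ := hj
      have hz : Indep z [m] := by
        have : Indep (v ++ [j] ++ z) (v ++ [j] ++ [m]) := by simpa using hc2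
        exact indep_append_iff.1 this
      refine ⟨v ++ [i, k] ++ z, ?_, ?_, hg.right.append z⟩
      · exact (indep_child_grandchild hij.symm).symm.append_left z
      · have : Indep (v ++ [i, k] ++ z) (v ++ [i, k] ++ [m]) := indep_append_iff.2 hz
        simpa using this
    · have hcj : Indep c (v ++ [j]) :=
        (indep_or_prefix_of_parent_prefix j (List.prefix_append _ _) hc1).resolve_right hj
      refine ⟨c, hcj, ?_, hg.fix c hcj hc1⟩
      simpa using hc1.append_right [m]
  -- induction on the numbers of letters after the branching point
  have main : ∀ (n : ℕ) (v : List (Fin d)) (i j : Fin d) (x y : List (Fin d)), i ≠ j →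
      x.length + y.length = n → Swappable e w (v ++ i :: x) (v ++ j :: y) := by
    intro n
    induction n using Nat.strong_induction_on with
    | _ n ih =>
      have long : ∀ (v : List (Fin d)) (i j : Fin d) (x y : List (Fin d)), i ≠ j →
          x.length + y.length = n → 2 ≤ x.length →
          Swappable e w (v ++ i :: x) (v ++ j :: y) := by
        intro v i j x y hij hn hx
        rcases List.eq_nil_or_concat x with rfl | ⟨x, k, rfl⟩
        · simp at hx
        rw [List.concat_eq_append] at hn hx ⊢
        rcases List.eq_nil_or_concat x with rfl | ⟨x, m, rfl⟩
        · simp at hx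
        rw [List.concat_eq_append] at hn hx ⊢
        have h := hS.shorten (p := v ++ i :: x) (b := v ++ j :: y) m k
          (indep_append_iff.2 (indep_cons_of_ne hij _ _)) fun m' => by
            have := ih (n - 1) (by simp at hn; omega) v i j (x ++ [m']) y hij
              (by simp at hn ⊢; omega)
            simpa using this
        simpa using h
      intro v i j x y hij hn
      by_cases hx : 2 ≤ x.length
      · exact long v i j x y hij hn hx
      by_cases hy : 2 ≤ y.length
      · exact (long v j i y x hij.symm (by omega) hy).symm
      rcases x with _ | ⟨k, _ | ⟨k', x⟩⟩
      · rcases y with _ | ⟨m, _ | ⟨m', y⟩⟩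
        · exact hS.sibling v hij
        · exact hS.child_grandchild v m hij
        · simp at hy
      · rcases y with _ | ⟨m, _ | ⟨m', y⟩⟩
        · exact (hS.child_grandchild v k hij.symm).symm
        · exact grand v i j k m hij
        · simp at hy
      · simp at hx
  obtain ⟨v, i, j, x, y, hij, rfl, rfl⟩ : ∃ v i j x y, i ≠ j ∧ a = v ++ i :: x ∧
      b = v ++ j :: y := by
    clear main grand
    induction a generalizing b with
    | nil => exact absurd List.nil_prefix hab.1
    | cons i a ih =>
      cases b with
      | nil => exact absurd List.nil_prefix hab.2
      | cons j b =>
        by_cases hij : i = j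
        · subst hij
          obtain ⟨v, i', j', x, y, h, h1, h2⟩ := ih (indep_cons_iff.1 hab)
          exact ⟨i :: v, i', j', x, y, h, by simp [h1], by simp [h2]⟩
        · exact ⟨[], i, j, a, b, hij, rfl, rfl⟩
  exact main _ v i j x y hij rfl

/-- Every permutation of the leaves of a tree is induced by a homeomorphism. -/
theorem HasBasicSwaps.exists_perm_leaves (hS : HasBasicSwaps e w i₀ i₁) (F : FinTree d)
    (τ : Equiv.Perm F.Leaf) : ∃ f ∈ baseFixing d e w, ∀ a : F.Leaf, Moves f a.1 (τ a).1 := by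
  classical
  have := Fintype.ofFinite F.Leaf
  induction τ using Equiv.Perm.swap_induction_on with
  | one => exact ⟨1, (baseFixing d e w).one_mem, fun a => actsOnRegion_refl _⟩
  | swap_mul τ x y hxy ih =>
    obtain ⟨f, hf, hτ⟩ := ih
    obtain ⟨g, hg⟩ := hS.swappable (x.2.indep y.2 fun h => hxy (Subtype.ext h))
    refine ⟨g * f, (baseFixing d e w).mul_mem hg.mem hf, fun a => Moves.mul ?_ (hτ a)⟩
    rw [Equiv.Perm.mul_apply]
    by_cases h1 : τ a = x
    · rw [h1, Equiv.swap_apply_left]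
      exact hg.left
    by_cases h2 : τ a = y
    · rw [h2, Equiv.swap_apply_right]
      exact hg.right
    rw [Equiv.swap_apply_of_ne_of_ne h1 h2]
    exact hg.fix _ ((τ a).2.indep x.2 fun h => h1 (Subtype.ext h))
      ((τ a).2.indep y.2 fun h => h2 (Subtype.ext h))

end Realization

/-! ### Changing the shape of the tree -/

namespace FinTree

variable {d : ℕ}

/-- All children of an inner vertex of maximal length are leaves. -/
theorem exists_caret {F : FinTree d} (h : F.IsInner []) :
    ∃ p, ∀ i, F.IsLeaf (p ++ [i]) := by
  have hfin : {v | F.IsInner v}.Finite := F.verts.finite_toSet.subset fun v hv => hv.1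
  obtain ⟨p, hp, hmax⟩ := hfin.exists_maximalFor List.length _ ⟨[], h⟩
  refine ⟨p, fun i => isLeaf_of_child hp fun hi => ?_⟩
  have := hmax hi (by simp)
  simp at this

/-- The tree without the children of `p`, which have to be leaves. -/
def prune (F : FinTree d) (p : List (Fin d)) (hp : ∀ i, F.IsLeaf (p ++ [i])) : FinTree d where
  verts := F.verts.filter fun v => ∀ i, v ≠ p ++ [i]
  root_mem := by simp [F.root_mem]
  parent_mem := by
    intro v i h
    rw [Finset.mem_filter] at h ⊢
    refine ⟨F.parent_mem v i h.1, ?_⟩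
    rintro j rfl
    exact (hp j).2 i h.1
  complete := by
    intro v i j h
    rw [Finset.mem_filter] at h ⊢
    refine ⟨F.complete v i j h.1, fun k hk => ?_⟩
    have h1 := (List.append_inj' hk rfl).1
    subst h1
    exact h.2 i rfl

variable {F : FinTree d} {p : List (Fin d)} {hp : ∀ i, F.IsLeaf (p ++ [i])}

theorem mem_prune {v : List (Fin d)} :
    v ∈ (F.prune p hp).verts ↔ v ∈ F.verts ∧ ∀ i, v ≠ p ++ [i] := by
  simp [prune]

theorem prune_isLeaf_iff (hd : 0 < d) {v : List (Fin d)} :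
    (F.prune p hp).IsLeaf v ↔ v = p ∨ (F.IsLeaf v ∧ ∀ i, v ≠ p ++ [i]) := by
  simp only [IsLeaf, mem_prune]
  constructor
  · rintro ⟨⟨h1, h2⟩, h3⟩
    by_cases hv : v = p
    · exact Or.inl hv
    · refine Or.inr ⟨⟨h1, fun i hi => h3 i ⟨hi, fun j hj => hv (List.append_inj' hj rfl).1⟩⟩, h2⟩
  · rintro (rfl | ⟨⟨h1, h2⟩, h3⟩)
    · refine ⟨⟨F.parent_mem _ ⟨0, hd⟩ (hp _).1, fun i h => ?_⟩, fun i h => h.2 i rfl⟩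
      simpa using congrArg List.length h
    · exact ⟨⟨h1, h3⟩, fun i hi => h2 i hi.1⟩

theorem ncard_leaves_prune (hd : 0 < d) :
    {v | F.IsLeaf v}.ncard + 1 = {v | (F.prune p hp).IsLeaf v}.ncard + d := by
  have hfin : ∀ G : FinTree d, {v | G.IsLeaf v}.Finite := fun G =>
    G.verts.finite_toSet.subset fun v hv => hv.1
  let C : Set (List (Fin d)) := Set.range fun i => p ++ [i]
  have hC : C.ncard = d := by
    have h1 := Set.ncard_image_of_injective (Set.univ : Set (Fin d))
      (f := fun i => p ++ [i]) (fun i j h => by simpa using h)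
    rw [Set.image_univ] at h1
    rw [h1, Set.ncard_univ, Nat.card_eq_fintype_card, Fintype.card_fin]
  have hpF : p ∉ {v | F.IsLeaf v} := fun h => h.2 ⟨0, hd⟩ (hp _).1
  have hdisj : Disjoint {v | (F.prune p hp).IsLeaf v} C := by
    rw [Set.disjoint_left]
    rintro _ h ⟨i, rfl⟩
    rcases (prune_isLeaf_iff hd).1 h with h | h
    · simpa using congrArg List.length h
    · exact h.2 i rfl
  have key : insert p {v | F.IsLeaf v} = {v | (F.prune p hp).IsLeaf v} ∪ C := by
    ext v
    simp only [Set.mem_insert_iff, Set.mem_ofPred_eq, Set.mem_union, prune_isLeaf_iff hd, C,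
      Set.mem_range]
    constructor
    · rintro (h | h)
      · exact Or.inl (Or.inl h)
      · by_cases hv : ∃ i, p ++ [i] = v
        · exact Or.inr hv
        · push Not at hv
          exact Or.inl (Or.inr ⟨h, fun i hi => hv i hi.symm⟩)
    · rintro ((h | h) | ⟨i, rfl⟩)
      · exact Or.inl h
      · exact Or.inr h.1
      · exact Or.inr (hp i)
  have h1 := congrArg Set.ncard key
  rwa [Set.ncard_insert_of_notMem hpF (hfin F),
    Set.ncard_union_eq hdisj (hfin _) (Set.finite_range _), hC] at h1

end FinTree

/-! ### Realizing tree pairs -/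

section Realization

variable {d : ℕ} {O Y : Type*} [TopologicalSpace O] [TopologicalSpace Y]
  {e : CoordPlane O} {w : CoordPlane Y} {i₀ i₁ : Fin d}

theorem ActsOnRegion.eq_of_eq {f : CantorSurface d e w ≃ₜ CantorSurface d e w}
    {a a' c : List (Fin d)} {x x' : BlockMCG d w} (h : ActsOnRegion f a c x)
    (h' : ActsOnRegion f a' c x') : a = a' :=
  block_injective (f.injective.image_injective (h.block.image.trans h'.block.image.symm))

/-- Trees with equally many leaves are related by a homeomorphism. -/
theorem HasBasicSwaps.exists_moves_leaves (hS : HasBasicSwaps e w i₀ i₁) (F F' : FinTree d)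
    (hcard : {v | F.IsLeaf v}.ncard = {v | F'.IsLeaf v}.ncard) :
    ∃ f ∈ baseFixing d e w, ∀ a, F.IsLeaf a → ∃ a', F'.IsLeaf a' ∧ Moves f a a' := by
  have hd : 0 < d := i₀.pos
  have hd2 : 2 ≤ d := by
    have h1 := i₀.2
    have h2 := i₁.2
    have h3 : (i₀ : ℕ) ≠ i₁ := fun h => hS.ne (Fin.ext h)
    omega
  have trivial_leaves : ∀ G : FinTree d, ¬ G.IsInner [] → {v | G.IsLeaf v} = {[]} := by
    intro G hG
    have h1 : G.IsLeaf [] := by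
      by_contra h
      exact hG ⟨G.root_mem, h⟩
    ext v
    refine ⟨fun hv => (h1.eq_of_prefix hv List.nil_prefix).symm, ?_⟩
    rintro rfl
    exact h1
  have two_leaves : ∀ G : FinTree d, G.IsInner [] → {v | G.IsLeaf v}.ncard ≠ 1 := by
    intro G hG h
    obtain ⟨p, hp⟩ := FinTree.exists_caret hG
    obtain ⟨v, hv⟩ := Set.ncard_eq_one.1 h
    have h0 : p ++ [i₀] ∈ {v | G.IsLeaf v} := hp i₀
    have h1 : p ++ [i₁] ∈ {v | G.IsLeaf v} := hp i₁
    rw [hv, Set.mem_singleton_iff] at h0 h1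
    exact hS.ne (by simpa using h0.trans h1.symm)
  induction hn : {v | F.IsLeaf v}.ncard using Nat.strong_induction_on generalizing F F' with
  | _ n ih =>
    by_cases hF : F.IsInner []
    · have hF' : F'.IsInner [] := by
        by_contra h
        rw [trivial_leaves F' h, Set.ncard_singleton] at hcard
        exact two_leaves F hF hcard
      obtain ⟨p, hp⟩ := FinTree.exists_caret hF
      obtain ⟨p', hp'⟩ := FinTree.exists_caret hF'
      have h1 := FinTree.ncard_leaves_prune (hp := hp) hd
      have h2 := FinTree.ncard_leaves_prune (hp := hp') hd
      obtain ⟨f, hf, hfa⟩ := ih _ (by omega) (F.prune p hp) (F'.prune p' hp') (by omega) rfl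
      -- after a permutation of the leaves, `f` moves `p` to `p'`
      obtain ⟨a, ha, hpa⟩ := hfa p ((FinTree.prune_isLeaf_iff hd).2 (Or.inl rfl))
      have hp'l : (F'.prune p' hp').IsLeaf p' := (FinTree.prune_isLeaf_iff hd).2 (Or.inl rfl)
      classical
      obtain ⟨g, hg, hgτ⟩ := hS.exists_perm_leaves _
        (Equiv.swap (⟨a, ha⟩ : (F'.prune p' hp').Leaf) ⟨p', hp'l⟩)
      have hgp : Moves (g * f) p p' := by
        refine Moves.mul ?_ hpa
        simpa using hgτ ⟨a, ha⟩
      refine ⟨g * f, (baseFixing d e w).mul_mem hg hf, fun c hc => ?_⟩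
      by_cases hcp : ∃ i, c = p ++ [i]
      · obtain ⟨i, rfl⟩ := hcp
        exact ⟨p' ++ [i], hp' i, hgp.append [i]⟩
      · push Not at hcp
        obtain ⟨c', hc', hcc⟩ := hfa c ((FinTree.prune_isLeaf_iff hd).2 (Or.inr ⟨hc, hcp⟩))
        have h3 := (hgτ ⟨c', hc'⟩).mul hcc
        refine ⟨_, ?_, h3⟩
        rcases (FinTree.prune_isLeaf_iff hd).1
          (Equiv.swap (⟨a, ha⟩ : (F'.prune p' hp').Leaf) ⟨p', hp'l⟩ ⟨c', hc'⟩).2 with h4 | h4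
        · rw [h4] at h3
          rw [ActsOnRegion.eq_of_eq h3 hgp] at hc
          exact absurd (hp i₀).1 (hc.2 i₀)
        · exact h4.1
    · have hF' : ¬ F'.IsInner [] := by
        intro h
        rw [trivial_leaves F hF, Set.ncard_singleton] at hcard
        exact two_leaves F' h hcard.symm
      refine ⟨1, (baseFixing d e w).one_mem, fun a ha => ⟨a, ?_, actsOnRegion_refl a⟩⟩
      have h1 : a ∈ {v | F.IsLeaf v} := ha
      rw [trivial_leaves F hF, ← trivial_leaves F' hF'] at h1
      exact h1

/-- Every bijection between the leaves of two trees, with arbitrary labels, is realized by a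
homeomorphism of the Cantor surface. -/
theorem HasBasicSwaps.exists_matchesLeaves (hS : HasBasicSwaps e w i₀ i₁) (F F' : FinTree d)
    (b : F.Leaf ≃ F'.Leaf) (h : F.Leaf → BlockMCG d w) :
    ∃ f ∈ baseFixing d e w, MatchesLeaves f F F' b h := by
  classical
  have hcard : {v | F.IsLeaf v}.ncard = {v | F'.IsLeaf v}.ncard := Nat.card_congr b
  obtain ⟨f, hf, hfa⟩ := hS.exists_moves_leaves F F' hcard
  choose c hc hfc using hfa
  have hbij : Function.Bijective fun a : F.Leaf => (⟨c a.1 a.2, hc a.1 a.2⟩ : F'.Leaf) := by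
    refine (Nat.bijective_iff_injective_and_card _).2 ⟨fun a a' haa => ?_, Nat.card_congr b⟩
    have h1 := hfc a.1 a.2
    rw [show c a.1 a.2 = c a'.1 a'.2 from congrArg Subtype.val haa] at h1
    exact Subtype.ext (h1.eq_of_eq (hfc a'.1 a'.2))
  obtain ⟨g, hg, hgτ⟩ := hS.exists_perm_leaves F' ((Equiv.ofBijective _ hbij).symm.trans b)
  choose rep hrep using fun a => QuotientGroup.mk_surjective (h a)
  let k : List (Fin d) → blockHomeo d w := fun v =>
    if hv : F.IsInner v then 1 else
      rep ⟨_, (FinTree.exists_leaf_prefix hv).choose_spec.1⟩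
  have hk : ∀ (a : F.Leaf) (u : List (Fin d)), k (a.1 ++ u) = rep a := by
    intro a u
    have hv := a.2.append_not_isInner u
    simp only [k, hv, dif_neg, not_false_eq_true]
    congr 1
    refine Subtype.ext ?_
    have h1 := (FinTree.exists_leaf_prefix hv).choose_spec
    rcases List.prefix_or_prefix_of_prefix h1.2 (List.prefix_append a.1 u) with h2 | h2
    · exact h1.1.eq_of_prefix a.2 h2
    · exact (a.2.eq_of_prefix h1.1 h2).symm
  refine ⟨g * f * portraitHomeo e k, (baseFixing d e w).mul_mem ((baseFixing d e w).mul_mem hg hf)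
    (portraitHomeo_mem k), fun a => ?_⟩
  have h1 := actsOnRegion_portraitHomeo (e := e) (hk a)
  rw [treeMap_eq_self, hrep] at h1
  · have h2 := (hgτ ⟨c a.1 a.2, hc a.1 a.2⟩).mul (hfc a.1 a.2)
    have h3 : (Equiv.ofBijective _ hbij).symm ⟨c a.1 a.2, hc a.1 a.2⟩ = a :=
      (Equiv.symm_apply_eq _).2 rfl
    rw [Equiv.trans_apply, h3] at h2
    simpa using ActsOnRegion.mul h2 h1
  · intro u i hu
    have hin : F.IsInner u := FinTree.isInner_of_prefix_of_ne
      ((List.prefix_append u [i]).trans hu) (by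
        rintro rfl
        simpa using hu.length_le) a.2.1
    simp [k, hin]

end Realization

/-! ### Twists of the plane -/

section Twist

/-- The angle `π` for `t ≤ a`, which decreases to `0` at `t = b`. -/
def twistAngle (a b t : ℝ) : ℝ := Real.pi * max 0 (min 1 ((b - t) / (b - a)))

theorem twistAngle_of_le {a b t : ℝ} (hab : a < b) (h : t ≤ a) : twistAngle a b t = Real.pi := by
  have h1 : 1 ≤ (b - t) / (b - a) := by
    rw [le_div_iff₀ (by linarith)]
    linarith
  rw [twistAngle, min_eq_left h1, max_eq_right zero_le_one, mul_one]

theorem twistAngle_of_ge {a b t : ℝ} (hab : a < b) (h : b ≤ t) : twistAngle a b t = 0 := by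
  have h1 : (b - t) / (b - a) ≤ 0 := div_nonpos_of_nonpos_of_nonneg (by linarith) (by linarith)
  rw [twistAngle, max_eq_left ((min_le_right _ _).trans h1), mul_zero]

theorem continuous_twistAngle (a b : ℝ) : Continuous (twistAngle a b) := by
  unfold twistAngle
  fun_prop

/-- The rotation of the circle of radius `t` by the angle `s * twistAngle a b t`; below, `s` is `1`
or `-1`, which gives a half twist and its inverse. -/
def twist (s a b : ℝ) (z : ℂ) : ℂ := z * Complex.exp ((s * twistAngle a b ‖z‖ : ℝ) * Complex.I)

theorem continuous_twist (s a b : ℝ) : Continuous (twist s a b) := by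
  have := continuous_twistAngle a b
  unfold twist
  fun_prop

theorem norm_twist (s a b : ℝ) (z : ℂ) : ‖twist s a b z‖ = ‖z‖ := by
  rw [twist, norm_mul, Complex.norm_exp_ofReal_mul_I, mul_one]

theorem twist_neg_twist (s a b : ℝ) (z : ℂ) : twist (-s) a b (twist s a b z) = z := by
  conv_lhs => rw [twist, norm_twist, twist, mul_assoc, ← Complex.exp_add]
  rw [← add_mul, ← Complex.ofReal_add]
  simp

theorem twist_of_ge (s : ℝ) {a b : ℝ} (hab : a < b) {z : ℂ} (h : b ≤ ‖z‖) : twist s a b z = z := by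
  rw [twist, twistAngle_of_ge hab h]
  simp

theorem twist_one_of_le {a b : ℝ} (hab : a < b) {z : ℂ} (h : ‖z‖ ≤ a) : twist 1 a b z = -z := by
  rw [twist, twistAngle_of_le hab h, one_mul, Complex.exp_pi_mul_I, mul_neg_one]

theorem twist_neg_one_of_le {a b : ℝ} (hab : a < b) {z : ℂ} (h : ‖z‖ ≤ a) :
    twist (-1) a b z = -z := by
  rw [twist, twistAngle_of_le hab h, neg_one_mul, Complex.ofReal_neg, neg_mul, Complex.exp_neg,
    Complex.exp_pi_mul_I, inv_neg, inv_one, mul_neg_one]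

/-- The half twist around `c`: the rotation by `π` inside the circle of radius `a`, and the identity
outside the circle of radius `b`. -/
def twistAt (c : ℂ) (a b : ℝ) : ℂ ≃ₜ ℂ where
  toFun x := c + twist 1 a b (x - c)
  invFun x := c + twist (-1) a b (x - c)
  left_inv x := by simp [twist_neg_twist]
  right_inv x := by
    have := twist_neg_twist (-1) a b (x - c)
    rw [neg_neg] at this
    simp [this]
  continuous_toFun := continuous_const.add
    ((continuous_twist _ _ _).comp (continuous_id.sub continuous_const))
  continuous_invFun := continuous_const.add
    ((continuous_twist _ _ _).comp (continuous_id.sub continuous_const))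

theorem twistAt_of_le {c x : ℂ} {a b : ℝ} (hab : a < b) (h : ‖x - c‖ ≤ a) :
    twistAt c a b x = 2 * c - x := by
  change c + twist 1 a b (x - c) = _
  rw [twist_one_of_le hab h]
  ring

theorem twistAt_of_ge {c x : ℂ} {a b : ℝ} (hab : a < b) (h : b ≤ ‖x - c‖) :
    twistAt c a b x = x := by
  change c + twist 1 a b (x - c) = _
  rw [twist_of_ge 1 hab h]
  ring

end Twist

/-! ### Every permutation of the lower boundary circles of a block is realized -/

section BlockPermutations

theorem le_norm_of_le_abs_re {z : ℂ} {r : ℝ} (h : r ≤ |z.re|) : r ≤ ‖z‖ :=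
  h.trans (Complex.abs_re_le_norm z)

/-- A homeomorphism of the plane that exchanges the unit discs around `3 n` and `3 (n + 1)` by
translations: a half twist around the midpoint of the centres, followed by half twists around the
centres, which undo the rotation of the discs. The radius `5/2` is that of the smallest disc around
the midpoint that contains both discs, and the radii `17/5 < 7/2` and `7/5 < 2` keep the supports
away from the other discs. -/
def exchangeDiscs (n : ℕ) : ℂ ≃ₜ ℂ :=
  ((twistAt (3 * n + 3 / 2) (5 / 2) (17 / 5)).trans (twistAt (3 * n + 3) 1 (7 / 5))).trans
    (twistAt (3 * n) 1 (7 / 5))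

theorem abs_re_le_one {z : ℂ} (hz : ‖z‖ ≤ 1) : -1 ≤ z.re ∧ z.re ≤ 1 :=
  abs_le.1 ((Complex.abs_re_le_norm z).trans hz)

theorem exchangeDiscs_apply (n : ℕ) (x : ℂ) : exchangeDiscs n x =
    twistAt (3 * n) 1 (7 / 5) (twistAt (3 * n + 3) 1 (7 / 5)
      (twistAt (3 * n + 3 / 2) (5 / 2) (17 / 5) x)) := rfl

theorem exchangeDiscs_left (n : ℕ) {z : ℂ} (hz : ‖z‖ ≤ 1) :
    exchangeDiscs n (3 * n + z) = 3 * (n + 1) + z := by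
  have h1 := abs_re_le_one hz
  have e1 : twistAt (3 * n + 3 / 2) (5 / 2) (17 / 5) (3 * n + z) = 3 * n + 3 - z := by
    rw [twistAt_of_le (by norm_num)]
    · ring
    · have : (3 * (n : ℂ) + z - (3 * n + 3 / 2)) = z - ((3 / 2 : ℝ) : ℂ) := by push_cast; ring
      rw [this]
      refine (norm_sub_le _ _).trans ?_
      rw [Complex.norm_real, Real.norm_of_nonneg (by norm_num)]
      linarith
  have e2 : twistAt (3 * n + 3) 1 (7 / 5) (3 * n + 3 - z) = 3 * (n + 1) + z := by
    rw [twistAt_of_le (by norm_num)]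
    · ring
    · rw [sub_right_comm, sub_self, zero_sub, norm_neg]
      exact hz
  rw [exchangeDiscs_apply, e1, e2, twistAt_of_ge (by norm_num)]
  refine le_norm_of_le_abs_re (le_abs.2 (Or.inl ?_))
  simp
  linarith

theorem exchangeDiscs_right (n : ℕ) {z : ℂ} (hz : ‖z‖ ≤ 1) :
    exchangeDiscs n (3 * (n + 1) + z) = 3 * n + z := by
  have h1 := abs_re_le_one hz
  have e1 : twistAt (3 * n + 3 / 2) (5 / 2) (17 / 5) (3 * (n + 1) + z) = 3 * n - z := by
    rw [twistAt_of_le (by norm_num)]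
    · ring
    · have : (3 * ((n : ℂ) + 1) + z - (3 * n + 3 / 2)) = z + ((3 / 2 : ℝ) : ℂ) := by
        push_cast; ring
      rw [this]
      refine (norm_add_le _ _).trans ?_
      rw [Complex.norm_real, Real.norm_of_nonneg (by norm_num)]
      linarith
  have e2 : twistAt (3 * n + 3) 1 (7 / 5) (3 * n - z) = 3 * n - z := by
    refine twistAt_of_ge (by norm_num) (le_norm_of_le_abs_re (le_abs.2 (Or.inr ?_)))
    simp
    linarith
  rw [exchangeDiscs_apply, e1, e2, twistAt_of_le (by norm_num)]
  · ring
  · rw [sub_right_comm, sub_self, zero_sub, norm_neg]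
    exact hz

theorem exchangeDiscs_of_far (n : ℕ) {x : ℂ} (h : 7 / 2 ≤ |x.re - (3 * n + 3 / 2)|) :
    exchangeDiscs n x = x := by
  have h1 : 17 / 5 ≤ ‖x - (3 * n + 3 / 2)‖ ∧ 7 / 5 ≤ ‖x - (3 * n + 3)‖ ∧
      7 / 5 ≤ ‖x - 3 * n‖ := by
    refine ⟨?_, ?_, ?_⟩
    all_goals
      refine le_norm_of_le_abs_re ?_
      simp
      rcases le_abs.1 h with h | h
      · exact le_abs.2 (Or.inl (by linarith))
      · exact le_abs.2 (Or.inr (by linarith))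
  rw [exchangeDiscs_apply, twistAt_of_ge (by norm_num) h1.1, twistAt_of_ge (by norm_num) h1.2.1,
    twistAt_of_ge (by norm_num) h1.2.2]

theorem exchangeDiscs_other {n m : ℕ} (h1 : m ≠ n) (h2 : m ≠ n + 1) {z : ℂ} (hz : ‖z‖ ≤ 1) :
    exchangeDiscs n (3 * m + z) = 3 * m + z := by
  have h3 := abs_re_le_one hz
  refine exchangeDiscs_of_far n (le_abs.2 ?_)
  rcases lt_or_ge m n with h | h
  · right
    have h4 : (m : ℝ) + 1 ≤ n := by exact_mod_cast h
    simp
    linarith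
  · left
    have h4 : (n : ℝ) + 2 ≤ m := by exact_mod_cast (by omega : n + 2 ≤ m)
    simp
    linarith

theorem exchangeDiscs_of_norm_ge {n : ℕ} {x : ℂ} (h : 3 * (n : ℝ) + 5 ≤ ‖x‖) :
    exchangeDiscs n x = x := by
  have h1 : ‖(3 * (n : ℂ))‖ = 3 * n := by simp
  have h2 : ‖(3 * (n : ℂ) + 3)‖ ≤ 3 * n + 3 := (norm_add_le _ _).trans (by simp)
  have h3 : ‖(3 * (n : ℂ) + 3 / 2)‖ ≤ 3 * n + 3 / 2 := (norm_add_le _ _).trans (by simp)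
  have k1 := norm_sub_norm_le x (3 * (n : ℂ))
  have k2 := norm_sub_norm_le x (3 * (n : ℂ) + 3)
  have k3 := norm_sub_norm_le x (3 * (n : ℂ) + 3 / 2)
  rw [exchangeDiscs_apply, twistAt_of_ge (x := x) (by norm_num) (by linarith),
    twistAt_of_ge (x := x) (by norm_num) (by linarith),
    twistAt_of_ge (x := x) (by norm_num) (by linarith)]

theorem exchangeDiscs_disc (n : ℕ) {m : ℕ} {z : ℂ} (hz : ‖z‖ ≤ 1) :
    exchangeDiscs n (3 * m + z) = 3 * (Equiv.swap n (n + 1) m : ℕ) + z := by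
  by_cases h1 : m = n
  · subst h1
    rw [exchangeDiscs_left m hz, Equiv.swap_apply_left]
    push_cast
    rfl
  by_cases h2 : m = n + 1
  · subst h2
    rw [Equiv.swap_apply_right]
    push_cast
    exact exchangeDiscs_right n hz
  rw [Equiv.swap_apply_of_ne_of_ne h1 h2, exchangeDiscs_other h1 h2 hz]

variable {Y : Type*} [TopologicalSpace Y] (w : CoordPlane Y)

open Classical in
/-- The extension of a map of the coordinate plane by the identity. -/
def planeExtend (T : ℂ → ℂ) (y : Y) : Y :=
  if h : ∃ z, w.toFun z = y then w.toFun (T h.choose) else y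

theorem planeExtend_apply (T : ℂ → ℂ) (z : ℂ) : planeExtend w T (w.toFun z) = w.toFun (T z) := by
  have h : ∃ z', w.toFun z' = w.toFun z := ⟨z, rfl⟩
  rw [planeExtend, dif_pos h, w.isOpenEmbedding.injective h.choose_spec]

theorem planeExtend_of_not_mem {T : ℂ → ℂ} {y : Y} (h : ¬ ∃ z, w.toFun z = y) :
    planeExtend w T y = y := dif_neg h

theorem continuous_planeExtend [T2Space Y] {T : ℂ → ℂ} (hT : Continuous T) {R : ℝ}
    (hR : ∀ z, R ≤ ‖z‖ → T z = z) : Continuous (planeExtend w T) := by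
  refine continuous_iff_continuousAt.2 fun y => ?_
  by_cases h : ∃ z, w.toFun z = y
  · obtain ⟨z, rfl⟩ := h
    rw [← w.isOpenEmbedding.continuousAt_iff]
    have : planeExtend w T ∘ w.toFun = w.toFun ∘ T := funext (planeExtend_apply w T)
    rw [this]
    exact (w.isOpenEmbedding.continuous.comp hT).continuousAt
  · have hK : IsClosed (w.toFun '' Metric.closedBall 0 R) :=
      ((isCompact_closedBall 0 R).image w.isOpenEmbedding.continuous).isClosed
    refine continuousAt_id.congr ?_
    filter_upwards [hK.isOpen_compl.mem_nhds fun ⟨z, _, hz⟩ => h ⟨z, hz⟩] with y' hy'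
    by_cases h' : ∃ z, w.toFun z = y'
    · obtain ⟨z, rfl⟩ := h'
      have hz : R ≤ ‖z‖ := by
        by_contra hz
        exact hy' ⟨z, by simpa using (not_le.1 hz).le, rfl⟩
      rw [planeExtend_apply, hR z hz]
      rfl
    · exact (planeExtend_of_not_mem w h').symm

theorem planeExtend_planeExtend {S T : ℂ → ℂ} (h : ∀ z, S (T z) = z) (y : Y) :
    planeExtend w S (planeExtend w T y) = y := by
  by_cases h' : ∃ z, w.toFun z = y
  · obtain ⟨z, rfl⟩ := h'
    rw [planeExtend_apply, planeExtend_apply, h]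
  · rw [planeExtend_of_not_mem w h', planeExtend_of_not_mem w h']

/-- The extension of a homeomorphism of the coordinate plane with bounded support. -/
def planeExtendHomeo [T2Space Y] (T : ℂ ≃ₜ ℂ) {R : ℝ} (hR : ∀ z, R ≤ ‖z‖ → T z = z) : Y ≃ₜ Y where
  toFun := planeExtend w T
  invFun := planeExtend w T.symm
  left_inv := planeExtend_planeExtend w T.symm_apply_apply
  right_inv := planeExtend_planeExtend w T.apply_symm_apply
  continuous_toFun := continuous_planeExtend w T.continuous hR
  continuous_invFun := continuous_planeExtend w T.symm.continuous
    fun z hz => (T.symm_apply_eq).2 (hR z hz).symm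

variable {w}

/-- A homeomorphism of the coordinate plane that permutes the removed discs by translations
restricts to the block. -/
theorem exists_blockHomeo_of_plane [T2Space Y] {d : ℕ} (T : ℂ ≃ₜ ℂ) {R : ℝ}
    (hR : ∀ z, R ≤ ‖z‖ → T z = z) (σ : Equiv.Perm (Fin (d + 1)))
    (hσ : ∀ (i : Fin (d + 1)) (z : ℂ), ‖z‖ ≤ 1 → T (3 * (i : ℂ) + z) = 3 * ((σ i : Fin _) : ℂ) + z)
    (τ : Equiv.Perm (Fin d)) (h0 : σ 0 = 0) (hτ : ∀ i : Fin d, σ i.succ = (τ i).succ) :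
    ∃ k : blockHomeo d w, homeoPerm d w k = τ := by
  let φ := planeExtendHomeo w T hR
  have hφ : ∀ z, φ (w.toFun z) = w.toFun (T z) := planeExtend_apply w T
  have hball : ∀ (i : Fin (d + 1)) (y : Y), y ∈ w.toFun '' Metric.ball (3 * (i : ℂ)) 1 →
      φ y ∈ w.toFun '' Metric.ball (3 * ((σ i : Fin _) : ℂ)) 1 := by
    rintro i _ ⟨p, hp, rfl⟩
    rw [Metric.mem_ball, dist_eq_norm] at hp
    have h1 := hσ i (p - 3 * (i : ℂ)) hp.le
    rw [add_sub_cancel] at h1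
    refine ⟨T p, ?_, (hφ p).symm⟩
    rw [h1, Metric.mem_ball, dist_eq_norm, add_sub_cancel_left]
    exact hp
  have hball' : ∀ (i : Fin (d + 1)) (y : Y),
      φ y ∈ w.toFun '' Metric.ball (3 * (i : ℂ)) 1 →
      y ∈ w.toFun '' Metric.ball (3 * ((σ.symm i : Fin _) : ℂ)) 1 := by
    rintro i y ⟨p, hp, hpy⟩
    rw [Metric.mem_ball, dist_eq_norm] at hp
    have h1 := hσ (σ.symm i) (p - 3 * (i : ℂ)) hp.le
    rw [Equiv.apply_symm_apply, add_sub_cancel] at h1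
    refine ⟨3 * ((σ.symm i : Fin _) : ℂ) + (p - 3 * (i : ℂ)), ?_, φ.injective ?_⟩
    · rw [Metric.mem_ball, dist_eq_norm, add_sub_cancel_left]
      exact hp
    · rw [hφ, h1, hpy]
  let ψ : Block d w ≃ₜ Block d w := φ.subtype fun y =>
    ⟨fun hy i hi => hy _ (hball' i y hi), fun hy i hi => hy _ (hball i y hi)⟩
  have hψ : ∀ y : Block d w, (ψ y).1 = φ y.1 := fun y => rfl
  have hbdry : ∀ i z, ψ (bdry w i z) = bdry w (τ i) z := by
    intro i z
    apply Subtype.ext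
    rw [hψ]
    change φ (w.toFun _) = w.toFun _
    rw [hφ, hσ _ _ z.norm_coe.le, hτ]
  have htop : ∀ z, ψ (top w z) = top w z := by
    intro z
    apply Subtype.ext
    rw [hψ]
    change φ (w.toFun _) = w.toFun _
    rw [hφ, hσ _ _ (by rw [Complex.norm_conj]; exact z.norm_coe.le), h0]
  refine ⟨⟨ψ, htop, τ, hbdry⟩, ?_⟩
  ext i : 1
  have h1 := q_mk d w ⟨ψ, htop, τ, hbdry⟩ i 1
  exact (bdry_injective w ((hbdry i 1).symm.trans h1)).symm

theorem exists_homeoPerm_eq_swap [T2Space Y] {d : ℕ} {i j : Fin d} (hij : (j : ℕ) = i + 1) :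
    ∃ k : blockHomeo d w, homeoPerm d w k = Equiv.swap i j := by
  refine exists_blockHomeo_of_plane (exchangeDiscs (i + 1)) (fun z => exchangeDiscs_of_norm_ge)
    (Equiv.swap i.succ j.succ) (fun m z hz => ?_) _ ?_ fun m => ?_
  · rw [exchangeDiscs_disc _ hz]
    congr 3
    rcases eq_or_ne m i.succ with rfl | h1
    · simp [hij]
    rcases eq_or_ne m j.succ with rfl | h2
    · simp [hij]
    rw [Equiv.swap_apply_of_ne_of_ne h1 h2, Equiv.swap_apply_of_ne_of_ne]
    · exact fun h => h1 (Fin.ext (by simpa using h))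
    · exact fun h => h2 (Fin.ext (by simpa [hij] using h))
  · exact Equiv.swap_apply_of_ne_of_ne (Fin.succ_ne_zero _).symm (Fin.succ_ne_zero _).symm
  · exact ((Fin.succ_injective d).map_swap i j m).symm

/-- The symmetric group is generated by the exchanges of neighbours. -/
theorem homeoPerm_surjective [T2Space Y] (d : ℕ) : Function.Surjective (homeoPerm d w) := by
  cases d with
  | zero => exact fun σ => ⟨1, Subsingleton.elim _ _⟩
  | succ n =>
    rw [← MonoidHom.range_eq_top, eq_top_iff]
    intro σ _
    have h : σ ∈ Submonoid.closure
        (Set.range fun i : Fin n => Equiv.swap i.castSucc i.succ) := by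
      rw [Equiv.Perm.mclosure_swap_castSucc_succ]
      exact Submonoid.mem_top σ
    refine (Submonoid.closure_le (S := (homeoPerm (n + 1) w).range.toSubmonoid)).2 ?_ h
    rintro _ ⟨i, rfl⟩
    exact exists_homeoPerm_eq_swap (by simp)

end BlockPermutations

/-! ### The Cayley transform -/

section Cayley

/-- The Cayley transform of the unit disc to the right half-plane. It maps `-z` to the inverse of
the image of `z`. -/
def cayley (z : ℂ) : ℂ := (1 + z) / (1 - z)

/-- The inverse of the Cayley transform. -/
def cayleyInv (s : ℂ) : ℂ := (s - 1) / (s + 1)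

theorem one_sub_ne_zero_of_norm {z : ℂ} (h : ‖z‖ < 1) : 1 - z ≠ 0 := by
  intro h1
  rw [← sub_eq_zero.1 h1, norm_one] at h
  exact lt_irrefl _ h

theorem cayleyInv_cayley {z : ℂ} (h : ‖z‖ < 1) : cayleyInv (cayley z) = z := by
  have h1 := one_sub_ne_zero_of_norm h
  have h2 : cayley z + 1 = 2 / (1 - z) := by rw [cayley]; field_simp; ring
  have h3 : cayley z - 1 = 2 * z / (1 - z) := by rw [cayley]; field_simp; ring
  rw [cayleyInv, h2, h3]
  field_simp

theorem cayley_cayleyInv {s : ℂ} (h : s + 1 ≠ 0) : cayley (cayleyInv s) = s := by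
  have h2 : 1 + cayleyInv s = 2 * s / (s + 1) := by rw [cayleyInv]; field_simp; ring
  have h3 : 1 - cayleyInv s = 2 / (s + 1) := by rw [cayleyInv]; field_simp; ring
  rw [cayley, h2, h3]
  field_simp

theorem cayley_neg (z : ℂ) : cayley (-z) = (cayley z)⁻¹ := by
  rw [cayley, cayley, inv_div, sub_neg_eq_add, ← sub_eq_add_neg]

theorem cayley_re_pos {z : ℂ} (h : ‖z‖ < 1) : 0 < (cayley z).re := by
  have h1 := one_sub_ne_zero_of_norm h
  have h2 : (cayley z).re = (1 - ‖z‖ ^ 2) / Complex.normSq (1 - z) := by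
    rw [cayley, Complex.div_re, Complex.sq_norm, Complex.normSq_apply z, ← add_div]
    congr 1
    simp
    ring
  rw [h2]
  refine div_pos ?_ (Complex.normSq_pos.2 h1)
  nlinarith [norm_nonneg z]

/-- The right half-plane is the set of points that are closer to `1` than to `-1`. -/
theorem norm_one_add_sq_sub (z : ℂ) : ‖1 + z‖ ^ 2 - ‖1 - z‖ ^ 2 = 4 * z.re := by
  rw [Complex.sq_norm, Complex.sq_norm, Complex.normSq_apply, Complex.normSq_apply]
  simp
  ring

theorem one_le_norm_cayley {z : ℂ} (h : ‖z‖ < 1) : 1 ≤ ‖cayley z‖ ↔ 0 ≤ z.re := by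
  have h1 := norm_pos_iff.2 (one_sub_ne_zero_of_norm h)
  rw [cayley, norm_div, one_le_div h1, ← sq_le_sq₀ h1.le (norm_nonneg _), ← sub_nonneg,
    norm_one_add_sq_sub]
  constructor <;> intro <;> linarith

theorem norm_cayley_eq_one {z : ℂ} (h : ‖z‖ < 1) : ‖cayley z‖ = 1 ↔ z.re = 0 := by
  have h1 := norm_pos_iff.2 (one_sub_ne_zero_of_norm h)
  rw [cayley, norm_div, div_eq_one_iff_eq h1.ne', ← sq_eq_sq₀ (norm_nonneg _) h1.le, ← sub_eq_zero,
    norm_one_add_sq_sub]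
  constructor <;> intro <;> linarith

/-- The bound `5` is the distance from the origin to the unit disc around `6`. -/
theorem norm_cayley_lt {z : ℂ} (h : ‖z‖ ≤ 13 / 20) : ‖cayley z‖ < 5 := by
  have h1 := norm_pos_iff.2 (one_sub_ne_zero_of_norm (h.trans_lt (by norm_num)))
  rw [cayley, norm_div, div_lt_iff₀ h1]
  have h2 := norm_add_le 1 z
  have h3 := norm_sub_norm_le 1 z
  rw [norm_one] at h2 h3
  linarith

/-- The unit disc around `3` in the half-plane corresponds to a subset of the disc of radius `3/5`;
the bound is sharp because `3/5` is mapped to `4`. -/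
theorem norm_le_of_norm_cayley_sub_le {z : ℂ} (h : ‖z‖ < 1) (h' : ‖cayley z - 3‖ ≤ 1) :
    ‖z‖ ≤ 3 / 5 := by
  have h0 := cayley_re_pos h
  have h1 : ‖cayley z - 3‖ ^ 2 ≤ 1 := by
    have := norm_nonneg (cayley z - 3)
    nlinarith
  have h2 : 0 < ‖cayley z + 1‖ := by
    refine norm_pos_iff.2 fun h2 => ?_
    have := congrArg Complex.re h2
    simp at this
    linarith
  have h3 := (abs_re_le_one h').2
  conv_lhs => rw [← cayleyInv_cayley h]
  rw [cayleyInv, norm_div, div_le_iff₀ h2]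
  refine le_of_sq_le_sq ?_ (by positivity)
  rw [mul_pow]
  rw [Complex.sq_norm, Complex.normSq_apply] at h1 ⊢
  rw [Complex.sq_norm, Complex.normSq_apply]
  simp at h1 h3 ⊢
  nlinarith

theorem continuousOn_cayley : ContinuousOn cayley (Metric.closedBall 0 (13 / 20)) := by
  refine ContinuousOn.div (by fun_prop) (by fun_prop) fun z hz => ?_
  exact one_sub_ne_zero_of_norm (lt_of_le_of_lt (by simpa using hz) (by norm_num))

/-- The right half of a closed disc without the open disc that the Cayley transform maps to the unit
disc around `3`. The radius `13/20` is larger than `3/5`, so that the hole does not reach the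
circular part of the boundary, and small enough for the image not to meet the unit disc around
`6`. -/
def halfDisc : Set ℂ := {z | 0 ≤ z.re ∧ ‖z‖ ≤ 13 / 20 ∧ 1 ≤ ‖cayley z - 3‖}

theorem norm_lt_one_of_mem_halfDisc {z : ℂ} (hz : z ∈ halfDisc) : ‖z‖ < 1 :=
  hz.2.1.trans_lt (by norm_num)

theorem continuousOn_cayley_halfDisc : ContinuousOn cayley halfDisc :=
  continuousOn_cayley.mono fun z hz => by simpa using hz.2.1

theorem isCompact_halfDisc : IsCompact halfDisc := by
  have h1 : IsClosed (Metric.closedBall (0 : ℂ) (13 / 20) ∩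
      (fun z => ‖cayley z - 3‖) ⁻¹' Set.Ici 1) :=
    (continuousOn_cayley.sub continuousOn_const).norm.preimage_isClosed_of_isClosed
      Metric.isClosed_closedBall isClosed_Ici
  refine (isCompact_closedBall (0 : ℂ) (13 / 20)).of_isClosed_subset ?_
    fun z hz => by simpa using hz.2.1
  have h2 : halfDisc = {z | 0 ≤ z.re} ∩ (Metric.closedBall (0 : ℂ) (13 / 20) ∩
      (fun z => ‖cayley z - 3‖) ⁻¹' Set.Ici 1) := by
    ext z
    simp [halfDisc]
  rw [h2]
  exact (isClosed_le continuous_const Complex.continuous_re).inter h1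

/-- The half twist that is used for the exchange of a child and a grandchild. -/
def mixTwist (s : ℝ) : ℂ → ℂ := twist s (3 / 5) (13 / 20)

theorem mixTwist_of_ge (s : ℝ) {z : ℂ} (h : 13 / 20 ≤ ‖z‖) : mixTwist s z = z :=
  twist_of_ge s (by norm_num) h

theorem mixTwist_of_le {s : ℝ} (hs : s = 1 ∨ s = -1) {z : ℂ} (h : ‖z‖ ≤ 3 / 5) :
    mixTwist s z = -z := by
  rcases hs with rfl | rfl
  · exact twist_one_of_le (by norm_num) h
  · exact twist_neg_one_of_le (by norm_num) h

theorem norm_mixTwist (s : ℝ) (z : ℂ) : ‖mixTwist s z‖ = ‖z‖ := norm_twist _ _ _ _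

/-- The closed disc of radius `13/20` without two symmetric open discs. -/
def holedDisc : Set ℂ := {z | z ∈ halfDisc ∨ -z ∈ halfDisc}

theorem norm_le_of_mem_holedDisc {z : ℂ} (hz : z ∈ holedDisc) : ‖z‖ ≤ 13 / 20 := by
  rcases hz with hz | hz
  · exact hz.2.1
  · simpa using hz.2.1

/-- The half twist preserves the disc with two holes: it is a rotation by `π` on the disc of radius
`3/5`, which contains both holes, and it preserves the norm. -/
theorem mixTwist_mem {s : ℝ} (hs : s = 1 ∨ s = -1) {z : ℂ} (hz : z ∈ holedDisc) :
    mixTwist s z ∈ holedDisc := by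
  by_cases h : ‖z‖ ≤ 3 / 5
  · rw [mixTwist_of_le hs h]
    rcases hz with hz | hz
    · exact Or.inr (by simpa using hz)
    · exact Or.inl hz
  · have h1 := norm_le_of_mem_holedDisc hz
    have key : ∀ y : ℂ, ‖y‖ = ‖z‖ → 0 ≤ y.re → y ∈ halfDisc := by
      intro y hy hre
      refine ⟨hre, hy.trans_le h1, ?_⟩
      by_contra h2
      exact h (hy ▸ norm_le_of_norm_cayley_sub_le ((hy.trans_le h1).trans_lt (by norm_num))
        (not_le.1 h2).le)
    rcases le_total 0 (mixTwist s z).re with h2 | h2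
    · exact Or.inl (key _ (norm_mixTwist s z) h2)
    · exact Or.inr (key _ (by rw [norm_neg, norm_mixTwist]) (by simpa using h2))

end Cayley

/-! ### Half discs in a block -/

section HalfDiscCharts

variable {d : ℕ} {Y : Type*} [TopologicalSpace Y] {w : CoordPlane Y}

theorem not_mem_image_ball {p : ℂ} (h : ∀ i : Fin (d + 1), 1 ≤ ‖p - 3 * (i : ℂ)‖)
    (i : Fin (d + 1)) : w.toFun p ∉ w.toFun '' Metric.ball (3 * (i : ℂ)) 1 := by
  rintro ⟨p', hp', hpp⟩
  rw [w.isOpenEmbedding.injective hpp, Metric.mem_ball, dist_eq_norm] at hp'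
  exact absurd (h i) (not_le.2 hp')

theorem one_le_norm_of_block {y : Block d w} {p : ℂ} (h : y.1 = w.toFun p) (i : Fin (d + 1)) :
    1 ≤ ‖p - 3 * (i : ℂ)‖ := by
  by_contra h1
  exact y.2 i ⟨p, by rw [Metric.mem_ball, dist_eq_norm]; exact not_le.1 h1, h.symm⟩

/-- The point of the block with coordinate `p` in the coordinate plane. -/
def ofPlanePoint (p : ℂ) (h : ∀ i : Fin (d + 1), 1 ≤ ‖p - 3 * (i : ℂ)‖) : Block d w :=
  ⟨w.toFun p, not_mem_image_ball h⟩

theorem ofPlanePoint_val {p : ℂ} (h : ∀ i : Fin (d + 1), 1 ≤ ‖p - 3 * (i : ℂ)‖) :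
    (ofPlanePoint (w := w) p h).1 = w.toFun p := rfl

open Classical in
variable (d w) in
/-- The point of the block with coordinate `p` in the coordinate plane; it has no meaning if `p`
lies in one of the removed discs. -/
def blockPoint (p : ℂ) : Block d w :=
  if h : ∀ i : Fin (d + 1), 1 ≤ ‖p - 3 * (i : ℂ)‖ then ofPlanePoint p h
  else interiorPoint d w

theorem blockPoint_val {p : ℂ} (h : ∀ i : Fin (d + 1), 1 ≤ ‖p - 3 * (i : ℂ)‖) :
    (blockPoint d w p).1 = w.toFun p := by
  rw [blockPoint, dif_pos h, ofPlanePoint_val]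

theorem blockPoint_eq_iff {p : ℂ} (h : ∀ i : Fin (d + 1), 1 ≤ ‖p - 3 * (i : ℂ)‖)
    {y : Block d w} : blockPoint d w p = y ↔ y.1 = w.toFun p := by
  rw [← blockPoint_val h]
  exact ⟨fun h => h ▸ rfl, fun h => Subtype.ext h.symm⟩

theorem continuousOn_blockPoint :
    ContinuousOn (blockPoint d w) {p | ∀ i : Fin (d + 1), 1 ≤ ‖p - 3 * (i : ℂ)‖} := by
  rw [continuousOn_iff_continuous_domRestrict]
  refine Topology.IsInducing.subtypeVal.continuous_iff.2 ?_
  exact (w.isOpenEmbedding.continuous.comp continuous_subtype_val).congr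
    fun p => (blockPoint_val p.2).symm

/-- The half disc avoids all removed discs if it is placed between the centres `3 m` and
`3 (m + 1)`, and it touches only the boundaries of these two. -/
theorem halfDisc_avoids (m : ℕ) {z : ℂ} (hz : z ∈ halfDisc) (j : ℕ) :
    1 ≤ ‖3 * (m : ℂ) + cayley z - 3 * (j : ℂ)‖ ∧
      (‖3 * (m : ℂ) + cayley z - 3 * (j : ℂ)‖ = 1 → j = m ∨ j = m + 1) := by
  have h1 := norm_lt_one_of_mem_halfDisc hz
  rcases lt_trichotomy j m with h | rfl | h
  · have h2 : 1 < ‖3 * (m : ℂ) + cayley z - 3 * (j : ℂ)‖ := by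
      refine lt_of_lt_of_le ?_ (Complex.re_le_norm _)
      have h3 : (j : ℝ) + 1 ≤ m := by exact_mod_cast h
      have := cayley_re_pos h1
      simp
      linarith
    exact ⟨h2.le, fun h => absurd h h2.ne'⟩
  · rw [add_sub_cancel_left]
    exact ⟨(one_le_norm_cayley h1).2 hz.1, fun _ => Or.inl rfl⟩
  · rcases eq_or_lt_of_le (Nat.succ_le_of_lt h) with rfl | h
    · have h2 : 3 * (m : ℂ) + cayley z - 3 * ((m.succ : ℕ) : ℂ) = cayley z - 3 := by
        push_cast; ring
      rw [h2]
      exact ⟨hz.2.2, fun _ => Or.inr rfl⟩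
    · have h2 : 1 < ‖3 * (m : ℂ) + cayley z - 3 * (j : ℂ)‖ := by
        have h3 : (m : ℝ) + 2 ≤ j := by exact_mod_cast h
        have h4 : 3 * (m : ℂ) + cayley z - 3 * (j : ℂ) = cayley z - (3 * (j - m) : ℝ) := by
          push_cast; ring
        rw [h4, norm_sub_rev]
        have h5 := norm_sub_norm_le (((3 * (j - m) : ℝ)) : ℂ) (cayley z)
        rw [Complex.norm_real, Real.norm_of_nonneg (by linarith)] at h5
        have := norm_cayley_lt hz.2.1
        linarith
      exact ⟨h2.le, fun h => absurd h h2.ne'⟩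

variable (d w) in
/-- The half disc, placed in the block between the boundary circles with centres `3 m` and
`3 (m + 1)`. -/
def halfDiscMap (m : ℕ) (z : ℂ) : Block d w := blockPoint d w (3 * m + cayley z)

theorem halfDiscMap_val (m : ℕ) {z : ℂ} (hz : z ∈ halfDisc) :
    (halfDiscMap d w m z).1 = w.toFun (3 * m + cayley z) :=
  blockPoint_val fun i => (halfDisc_avoids m hz i).1

theorem halfDiscMap_injOn (m : ℕ) : Set.InjOn (halfDiscMap d w m) halfDisc := by
  intro z hz z' hz' h
  have h1 := congrArg Subtype.val h
  rw [halfDiscMap_val m hz, halfDiscMap_val m hz'] at h1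
  have h2 := add_left_cancel (w.isOpenEmbedding.injective h1)
  rw [← cayleyInv_cayley (norm_lt_one_of_mem_halfDisc hz), h2,
    cayleyInv_cayley (norm_lt_one_of_mem_halfDisc hz')]

theorem continuousOn_halfDiscMap (m : ℕ) : ContinuousOn (halfDiscMap d w m) halfDisc :=
  continuousOn_blockPoint.comp (continuousOn_const.add continuousOn_cayley_halfDisc)
    fun _ hz i => (halfDisc_avoids m hz i).1

theorem halfDiscMap_eq_bdry {m : ℕ} {z : ℂ} (hz : z ∈ halfDisc) {i : Fin d} {x : Circle} :
    halfDiscMap d w m z = bdry w i x ↔ 3 * (m : ℂ) + cayley z = 3 * (i.succ : ℂ) + x := by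
  rw [halfDiscMap, blockPoint_eq_iff fun i => (halfDisc_avoids m hz i).1]
  exact ⟨fun h => (w.isOpenEmbedding.injective h).symm, fun h => congrArg w.toFun h.symm⟩

theorem halfDiscMap_eq_top {m : ℕ} {z : ℂ} (hz : z ∈ halfDisc) {x : Circle} :
    halfDiscMap d w m z = top w x ↔ 3 * (m : ℂ) + cayley z = (starRingEnd ℂ) (x : ℂ) := by
  rw [halfDiscMap, blockPoint_eq_iff fun i => (halfDisc_avoids m hz i).1]
  have h1 : (top w x : Block d w).1 = w.toFun ((starRingEnd ℂ) (x : ℂ)) := by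
    simp [top]
  rw [h1]
  exact ⟨fun h => (w.isOpenEmbedding.injective h).symm, fun h => congrArg w.toFun h.symm⟩

theorem halfDiscMap_eq_bdry_imp {m : ℕ} {z : ℂ} (hz : z ∈ halfDisc) {i : Fin d} {x : Circle}
    (h : halfDiscMap d w m z = bdry w i x) :
    ((i : ℕ) + 1 = m ∧ z.re = 0) ∨ ((i : ℕ) = m ∧ cayley z = 3 + x) := by
  rw [halfDiscMap_eq_bdry hz] at h
  have h1 : ‖3 * (m : ℂ) + cayley z - 3 * ((i.succ : ℕ) : ℂ)‖ = 1 := by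
    rw [h, add_sub_cancel_left]
    exact x.norm_coe
  rcases (halfDisc_avoids m hz i.succ).2 h1 with h2 | h2
  · left
    rw [h2] at h1
    rw [add_sub_cancel_left] at h1
    exact ⟨by simpa using h2, (norm_cayley_eq_one (norm_lt_one_of_mem_halfDisc hz)).1 h1⟩
  · right
    refine ⟨by simpa using h2, ?_⟩
    rw [h2] at h
    push_cast at h
    linear_combination h

theorem halfDiscMap_eq_top_imp {m : ℕ} {z : ℂ} (hz : z ∈ halfDisc) {x : Circle}
    (h : halfDiscMap d w m z = top w x) : m = 0 ∧ z.re = 0 := by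
  rw [halfDiscMap_eq_top hz] at h
  have h1 : ‖3 * (m : ℂ) + cayley z - 3 * ((0 : ℕ) : ℂ)‖ = 1 := by
    rw [h]
    simpa using x.norm_coe
  rcases (halfDisc_avoids m hz 0).2 h1 with h2 | h2
  · subst h2
    simp at h1
    exact ⟨rfl, (norm_cayley_eq_one (norm_lt_one_of_mem_halfDisc hz)).1 h1⟩
  · omega

/-- The points of the block that do not lie in the image of the open disc of radius `13/20` under
the Cayley transform, placed at `3 m`; this image is an Apollonian disc. -/
def halfDiscCompl (m : ℕ) : Set (Block d w) :=
  {y | y.1 ∉ w.toFun '' {p | ‖p - 3 * m - 1‖ < 13 / 20 * ‖p - 3 * m + 1‖}}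

theorem isClosed_halfDiscCompl (m : ℕ) : IsClosed (halfDiscCompl (d := d) (w := w) m) := by
  have h1 : IsOpen {p : ℂ | ‖p - 3 * m - 1‖ < 13 / 20 * ‖p - 3 * m + 1‖} :=
    isOpen_lt (by fun_prop) (by fun_prop)
  have h2 : Continuous (Subtype.val : Block d w → Y) := continuous_subtype_val
  exact ((w.isOpenEmbedding.isOpenMap _ h1).preimage h2).isClosed_compl

theorem mem_halfDiscCompl_or {m : ℕ} (hm : m < d) (y : Block d w) :
    y ∈ halfDiscCompl m ∨ ∃ z ∈ halfDisc, y = halfDiscMap d w m z := by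
  by_cases h : y ∈ halfDiscCompl m
  · exact Or.inl h
  right
  obtain ⟨p, hp, hpy⟩ := not_not.1 h
  rw [Set.mem_ofPred_eq] at hp
  have h1 : p - 3 * m + 1 ≠ 0 := by
    intro h1
    rw [h1, norm_zero, mul_zero] at hp
    exact absurd hp (not_lt.2 (norm_nonneg _))
  let z := cayleyInv (p - 3 * m)
  have hcz : cayley z = p - 3 * m := cayley_cayleyInv h1
  have hz : ‖z‖ < 13 / 20 := by
    simp only [z, cayleyInv]
    rw [norm_div, div_lt_iff₀ (norm_pos_iff.2 h1)]
    exact hp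
  have hz1 : ‖z‖ < 1 := hz.trans (by norm_num)
  have hz' : z ∈ halfDisc := by
    refine ⟨(one_le_norm_cayley hz1).1 ?_, hz.le, ?_⟩
    · rw [hcz]
      simpa using one_le_norm_of_block hpy.symm ⟨m, by omega⟩
    · rw [hcz]
      have := one_le_norm_of_block hpy.symm ⟨m + 1, by omega⟩
      have h2 : p - 3 * ((m + 1 : ℕ) : ℂ) = p - 3 * m - 3 := by push_cast; ring
      rwa [h2] at this
  refine ⟨z, hz', Subtype.ext ?_⟩
  rw [halfDiscMap_val m hz', hcz, ← hpy]
  congr 1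
  ring

theorem norm_of_mem_halfDiscCompl {m : ℕ} {z : ℂ} (hz : z ∈ halfDisc)
    (h : halfDiscMap d w m z ∈ halfDiscCompl m) : 13 / 20 ≤ ‖z‖ := by
  by_contra h1
  refine h ⟨3 * m + cayley z, ?_, (halfDiscMap_val m hz).symm⟩
  have h2 : 0 < ‖cayley z + 1‖ := by
    refine norm_pos_iff.2 fun h2 => ?_
    have := congrArg Complex.re h2
    have := cayley_re_pos (norm_lt_one_of_mem_halfDisc hz)
    simp at *
    linarith
  rw [← cayleyInv_cayley (norm_lt_one_of_mem_halfDisc hz), cayleyInv, norm_div, not_le,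
    div_lt_iff₀ h2] at h1
  rw [Set.mem_ofPred_eq, add_sub_cancel_left]
  exact h1

/-- The boundary circle with centre `3 (m + 1)` bounds the hole of the half disc. -/
theorem exists_halfDisc_eq_bdry {m : ℕ} {i : Fin d} (hi : (i : ℕ) = m) (x : Circle) :
    ∃ z ∈ halfDisc, ‖z‖ ≤ 3 / 5 ∧ cayley z = 3 + x ∧ halfDiscMap d w m z = bdry w i x := by
  have hx := abs_re_le_one x.norm_coe.le
  have h1 : (3 + x + 1 : ℂ) ≠ 0 := by
    intro h1
    have := congrArg Complex.re h1
    simp at this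
    linarith
  have hcz : cayley (cayleyInv (3 + x)) = 3 + x := cayley_cayleyInv h1
  have h2 : ‖cayleyInv (3 + x)‖ < 1 := by
    rw [cayleyInv, norm_div, div_lt_one (norm_pos_iff.2 h1)]
    refine lt_of_pow_lt_pow_left₀ 2 (norm_nonneg _) ?_
    rw [Complex.sq_norm, Complex.sq_norm, Complex.normSq_apply, Complex.normSq_apply]
    simp
    nlinarith
  have h3 : ‖cayleyInv (3 + x)‖ ≤ 3 / 5 := by
    refine norm_le_of_norm_cayley_sub_le h2 ?_
    rw [hcz, add_sub_cancel_left]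
    exact x.norm_coe.le
  have h4 : cayleyInv (3 + x) ∈ halfDisc := by
    refine ⟨(one_le_norm_cayley h2).1 ?_, h3.trans (by norm_num), ?_⟩
    · rw [hcz]
      refine le_trans ?_ (Complex.re_le_norm _)
      simp
      linarith
    · rw [hcz, add_sub_cancel_left]
      exact x.norm_coe.ge
  refine ⟨_, h4, h3, hcz, (halfDiscMap_eq_bdry h4).2 ?_⟩
  rw [hcz, Fin.val_succ, hi]
  push_cast
  ring

theorem bdry_not_mem_halfDiscCompl {m : ℕ} {i : Fin d} (hi : (i : ℕ) = m) (x : Circle) :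
    bdry w i x ∉ halfDiscCompl m := by
  obtain ⟨z, hz, hz1, -, h⟩ := exists_halfDisc_eq_bdry (w := w) hi x
  rw [← h]
  intro h1
  have := norm_of_mem_halfDiscCompl hz h1
  linarith

end HalfDiscCharts

/-! ### Exchanging a child and a grandchild -/

section Mix

variable {d : ℕ} {O Y : Type*} [TopologicalSpace O] [TopologicalSpace Y]
  {e : CoordPlane O} {w : CoordPlane Y} {v : List (Fin d)} {i₀ i₁ : Fin d}

variable (e w v i₀) in
/-- A chart of the union of the block of `v` and of its child `v ++ [i₀]`, for `i₀ = 0` and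
`i₁ = 1`: the right half of the disc is placed in the block of `v`, between the boundary circles of the
children `i₀` and `i₁`, and the left half is placed, after a rotation by `π`, in the block of
`v ++ [i₀]`, between its top boundary and the boundary circle of its child `i₀`. -/
def mixChart (z : ℂ) : CantorSurface d e w :=
  if 0 ≤ z.re then ofBlock e w v (halfDiscMap d w 1 z)
  else ofBlock e w (v ++ [i₀]) (halfDiscMap d w 0 (-z))

theorem mem_halfDisc_of_re_eq_zero {z : ℂ} (h : ‖z‖ ≤ 13 / 20) (hz : z.re = 0) :
    z ∈ halfDisc := by
  have h1 := (norm_cayley_eq_one (h.trans_lt (by norm_num))).2 hz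
  refine ⟨hz.ge, h, ?_⟩
  have h2 := norm_sub_norm_le (3 : ℂ) (cayley z)
  rw [norm_sub_rev, h1] at h2
  norm_num at h2
  linarith

theorem mixChart_of_mem {z : ℂ} (hz : z ∈ halfDisc) :
    mixChart e w v i₀ z = ofBlock e w v (halfDiscMap d w 1 z) := if_pos hz.1

/-- On the imaginary axis, the two parts of the chart agree by the gluing of the blocks. -/
theorem mixChart_of_neg_mem (h0 : (i₀ : ℕ) = 0) {z : ℂ} (hz : -z ∈ halfDisc) :
    mixChart e w v i₀ z = ofBlock e w (v ++ [i₀]) (halfDiscMap d w 0 (-z)) := by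
  by_cases h : 0 ≤ z.re
  · have hre : z.re = 0 := le_antisymm (by simpa using hz.1) h
    have hn : ‖z‖ ≤ 13 / 20 := by simpa using hz.2.1
    have hz' := mem_halfDisc_of_re_eq_zero hn hre
    have h1 := (norm_cayley_eq_one (hn.trans_lt (by norm_num))).2 hre
    let x : Circle := ⟨cayley z, mem_sphere_zero_iff_norm.2 h1⟩
    have hx : (x : ℂ) = cayley z := rfl
    rw [mixChart_of_mem hz', (halfDiscMap_eq_bdry (i := i₀) (x := x) hz').2,
      (halfDiscMap_eq_top (x := x) hz).2, ofBlock_bdry]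
    · rw [cayley_neg, ← hx, ← Circle.coe_inv, Circle.coe_inv_eq_conj]
      simp
    · rw [hx, Fin.val_succ, h0]
  · exact if_neg h

theorem mixChart_eq_upper (h0 : (i₀ : ℕ) = 0) {z : ℂ} (hz : z ∈ holedDisc) {y : Block d w}
    (h : mixChart e w v i₀ z = ofBlock e w v y) : z ∈ halfDisc ∧ y = halfDiscMap d w 1 z := by
  have key : z ∈ halfDisc := by
    rcases hz with hz | hz
    · exact hz
    · rw [mixChart_of_neg_mem h0 hz] at h
      rcases ofBlock_eq_iff.1 h with ⟨h1, -⟩ | ⟨i, x, h1, -⟩ | ⟨i, x, -, -, h1⟩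
      · simp at h1
      · simpa using congrArg List.length h1
      · exact mem_halfDisc_of_re_eq_zero (by simpa using hz.2.1)
          (by simpa using (halfDiscMap_eq_top_imp hz h1).2)
  rw [mixChart_of_mem key] at h
  exact ⟨key, (ofBlock_injective v h).symm⟩

theorem mixChart_eq_lower (h0 : (i₀ : ℕ) = 0) {z : ℂ} (hz : z ∈ holedDisc) {y : Block d w}
    (h : mixChart e w v i₀ z = ofBlock e w (v ++ [i₀]) y) :
    -z ∈ halfDisc ∧ y = halfDiscMap d w 0 (-z) := by
  have key : -z ∈ halfDisc := by
    rcases hz with hz | hz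
    · rw [mixChart_of_mem hz] at h
      rcases ofBlock_eq_iff.1 h with ⟨h1, -⟩ | ⟨i, x, h1, h2, -⟩ | ⟨i, x, h1, -⟩
      · simp at h1
      · obtain rfl : i₀ = i := by simpa using h1
        rcases halfDiscMap_eq_bdry_imp hz h2 with ⟨-, h3⟩ | ⟨h3, -⟩
        · exact mem_halfDisc_of_re_eq_zero (by simpa using hz.2.1) (by simpa using h3)
        · omega
      · simpa using congrArg List.length h1
    · exact hz
  rw [mixChart_of_neg_mem h0 key] at h
  exact ⟨key, (ofBlock_injective _ h).symm⟩

theorem mixChart_injOn (h0 : (i₀ : ℕ) = 0) : Set.InjOn (mixChart e w v i₀) holedDisc := by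
  intro z hz z' hz' h
  rcases hz with hz | hz
  · rw [mixChart_of_mem hz] at h
    obtain ⟨h1, h2⟩ := mixChart_eq_upper h0 hz' h.symm
    exact halfDiscMap_injOn 1 hz h1 h2
  · rw [mixChart_of_neg_mem h0 hz] at h
    obtain ⟨h1, h2⟩ := mixChart_eq_lower h0 hz' h.symm
    exact neg_injective (halfDiscMap_injOn 0 hz h1 h2)

theorem mixChart_ne_ofBase (h0 : (i₀ : ℕ) = 0) {z : ℂ} (hz : z ∈ holedDisc) (b : Base e) :
    mixChart e w v i₀ z ≠ ofBase e w b := by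
  intro h
  rcases hz with hz | hz
  · rw [mixChart_of_mem hz] at h
    obtain ⟨-, x, -, h1⟩ := ofBase_eq_ofBlock_iff.1 h.symm
    exact absurd (halfDiscMap_eq_top_imp hz h1).1 one_ne_zero
  · rw [mixChart_of_neg_mem h0 hz] at h
    simpa using (ofBase_eq_ofBlock_iff.1 h.symm).1

theorem mixChart_mem_region_child (h0 : (i₀ : ℕ) = 0) (h1 : (i₁ : ℕ) = 1) {z : ℂ}
    (hz : z ∈ holedDisc) (h : mixChart e w v i₀ z ∈ region e w (v ++ [i₁])) :
    z ∈ halfDisc ∧ ∃ x : Circle, cayley z = 3 + x := by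
  rcases hz with hz | hz
  · refine ⟨hz, ?_⟩
    rw [mixChart_of_mem hz] at h
    rcases ofBlock_mem_region.1 h with h2 | ⟨i, x, h2, h3⟩
    · simpa using h2.length_le
    · obtain rfl : i₁ = i := by simpa using h2
      rcases halfDiscMap_eq_bdry_imp hz h3 with ⟨h4, -⟩ | ⟨-, h4⟩
      · omega
      · exact ⟨x, h4⟩
  · rw [mixChart_of_neg_mem h0 hz] at h
    rcases ofBlock_mem_region.1 h with h2 | ⟨i, x, h2, -⟩
    · have h3 := h2.eq_of_length (by simp)
      have h4 : i₁ = i₀ := by simpa using h3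
      rw [h4] at h1
      omega
    · simpa using congrArg List.length h2

theorem mixChart_mem_region_grandchild (h0 : (i₀ : ℕ) = 0) {z : ℂ}
    (hz : z ∈ holedDisc) (h : mixChart e w v i₀ z ∈ region e w (v ++ [i₀, i₀])) :
    -z ∈ halfDisc ∧ ∃ x : Circle, cayley (-z) = 3 + x := by
  rcases hz with hz | hz
  · rw [mixChart_of_mem hz] at h
    rcases ofBlock_mem_region.1 h with h2 | ⟨i, x, h2, -⟩
    · simpa using h2.length_le
    · simpa using congrArg List.length h2
  · refine ⟨hz, ?_⟩
    rw [mixChart_of_neg_mem h0 hz] at h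
    rcases ofBlock_mem_region.1 h with h2 | ⟨i, x, h2, h3⟩
    · simpa using h2.length_le
    · obtain rfl : i₀ = i := by simpa using h2
      rcases halfDiscMap_eq_bdry_imp hz h3 with ⟨h4, -⟩ | ⟨-, h4⟩
      · omega
      · exact ⟨x, h4⟩

theorem mixChart_mem_block (h0 : (i₀ : ℕ) = 0) (h1 : (i₁ : ℕ) = 1) {z : ℂ} (hz : z ∈ holedDisc)
    {u : List (Fin d)} {y : Block d w} (h : mixChart e w v i₀ z = ofBlock e w u y) :
    u = v ∨ u = v ++ [i₀] ∨ u = v ++ [i₁] ∨ u = v ++ [i₀, i₀] := by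
  rcases hz with hz | hz
  · rw [mixChart_of_mem hz] at h
    rcases ofBlock_eq_iff.1 h with ⟨h2, -⟩ | ⟨i, x, h2, h3, -⟩ | ⟨i, x, -, -, h3⟩
    · exact Or.inl h2.symm
    · rcases halfDiscMap_eq_bdry_imp hz h3 with ⟨h4, -⟩ | ⟨h4, -⟩
      · have : i = i₀ := Fin.ext (by omega)
        exact Or.inr (Or.inl (this ▸ h2))
      · have : i = i₁ := Fin.ext (by omega)
        exact Or.inr (Or.inr (Or.inl (this ▸ h2)))
    · exact absurd (halfDiscMap_eq_top_imp hz h3).1 one_ne_zero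
  · rw [mixChart_of_neg_mem h0 hz] at h
    rcases ofBlock_eq_iff.1 h with ⟨h2, -⟩ | ⟨i, x, h2, h3, -⟩ | ⟨i, x, h2, -⟩
    · exact Or.inr (Or.inl h2.symm)
    · rcases halfDiscMap_eq_bdry_imp hz h3 with ⟨h4, -⟩ | ⟨h4, -⟩
      · omega
      · have : i = i₀ := Fin.ext (by omega)
        subst this
        exact Or.inr (Or.inr (Or.inr (by simpa using h2)))
    · exact Or.inl (List.append_inj' h2 rfl).1.symm

/-- The chart parametrizes the top curves of `v ++ [i₁]` and of `v ++ [i₀, i₀]` by opposite points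
of the disc. -/
theorem mixChart_hole (h0 : (i₀ : ℕ) = 0) (h1 : (i₁ : ℕ) = 1) {z : ℂ} (hz : z ∈ halfDisc)
    {x : Circle} (hx : cayley z = 3 + x) :
    ‖z‖ ≤ 3 / 5 ∧ mixChart e w v i₀ z = ofBlock e w (v ++ [i₁]) (top w x) ∧
      mixChart e w v i₀ (-z) = ofBlock e w (v ++ [i₀, i₀]) (top w x) := by
  refine ⟨norm_le_of_norm_cayley_sub_le (norm_lt_one_of_mem_halfDisc hz) ?_, ?_, ?_⟩
  · rw [hx, add_sub_cancel_left]
    exact x.norm_coe.le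
  · rw [mixChart_of_mem hz, (halfDiscMap_eq_bdry (i := i₁) (x := x) hz).2, ofBlock_bdry]
    rw [hx, Fin.val_succ, h1]
    push_cast
    ring
  · rw [mixChart_of_neg_mem h0 (by simpa using hz), neg_neg,
      (halfDiscMap_eq_bdry (i := i₀) (x := x) hz).2, ofBlock_bdry]
    · simp
    · rw [hx, Fin.val_succ, h0]
      push_cast
      ring

/-- Moving the words of blocks is compatible with the gluing. -/
theorem ofBlock_append_congr {a a' u u' : List (Fin d)} {y y' : Block d w}
    (h : ofBlock e w (a ++ u) y = ofBlock e w (a ++ u') y') :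
    ofBlock e w (a' ++ u) y = ofBlock e w (a' ++ u') y' := by
  rcases ofBlock_eq_iff.1 h with ⟨h1, h2⟩ | ⟨i, x, h1, h2⟩ | ⟨i, x, h1, h2⟩
  · rw [List.append_cancel_left h1, h2]
  · rw [List.append_assoc] at h1
    rw [List.append_cancel_left h1]
    exact ofBlock_eq_iff.2 (Or.inr (Or.inl ⟨i, x, by simp, h2⟩))
  · rw [List.append_assoc] at h1
    rw [List.append_cancel_left h1]
    exact ofBlock_eq_iff.2 (Or.inr (Or.inr ⟨i, x, by simp, h2⟩))

variable (e w v i₀ i₁) in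
/-- The graph of the half twist that exchanges the regions of `v ++ [i₁]` and of `v ++ [i₀, i₀]`: in
the chart it is `mixTwist s`, it moves the two regions rigidly, and it is the identity elsewhere. -/
inductive MixGraph (s : ℝ) : CantorSurface d e w → CantorSurface d e w → Prop
  | chart (z : ℂ) (hz : z ∈ holedDisc) :
      MixGraph s (mixChart e w v i₀ z) (mixChart e w v i₀ (mixTwist s z))
  | child (u : List (Fin d)) (y : Block d w) :
      MixGraph s (ofBlock e w (v ++ [i₁] ++ u) y) (ofBlock e w (v ++ [i₀, i₀] ++ u) y)
  | grandchild (u : List (Fin d)) (y : Block d w) :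
      MixGraph s (ofBlock e w (v ++ [i₀, i₀] ++ u) y) (ofBlock e w (v ++ [i₁] ++ u) y)
  | rest (x : CantorSurface d e w) (hx : ∀ z ∈ holedDisc, mixChart e w v i₀ z ≠ x)
      (h1 : x ∉ region e w (v ++ [i₁])) (h2 : x ∉ region e w (v ++ [i₀, i₀])) : MixGraph s x x

theorem MixGraph.total (s : ℝ) (x : CantorSurface d e w) : ∃ x', MixGraph e w v i₀ i₁ s x x' := by
  by_cases h : ∃ z ∈ holedDisc, mixChart e w v i₀ z = x
  · obtain ⟨z, hz, rfl⟩ := h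
    exact ⟨_, .chart z hz⟩
  by_cases h1 : x ∈ region e w (v ++ [i₁])
  · obtain ⟨u, y, rfl⟩ := mem_region.1 h1
    exact ⟨_, .child u y⟩
  by_cases h2 : x ∈ region e w (v ++ [i₀, i₀])
  · obtain ⟨u, y, rfl⟩ := mem_region.1 h2
    exact ⟨_, .grandchild u y⟩
  push Not at h
  exact ⟨x, .rest x h h1 h2⟩

theorem mixTwist_neg_mixTwist (s : ℝ) (z : ℂ) : mixTwist (-s) (mixTwist s z) = z :=
  twist_neg_twist _ _ _ _

theorem MixGraph.inverse {s : ℝ} (hs : s = 1 ∨ s = -1) {x x' : CantorSurface d e w}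
    (h : MixGraph e w v i₀ i₁ s x x') : MixGraph e w v i₀ i₁ (-s) x' x := by
  cases h with
  | chart z hz =>
    have := MixGraph.chart (e := e) (w := w) (v := v) (i₀ := i₀) (i₁ := i₁) (s := -s) _
      (mixTwist_mem hs hz)
    rwa [mixTwist_neg_mixTwist] at this
  | child u y => exact .grandchild u y
  | grandchild u y => exact .child u y
  | rest _ hx h1 h2 => exact .rest _ hx h1 h2

theorem ofBlock_append_mem_region (a u : List (Fin d)) (y : Block d w) :
    ofBlock e w (a ++ u) y ∈ region e w a := mem_region.2 ⟨u, y, rfl⟩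

theorem not_mem_region_of_indep {a b : List (Fin d)} (h : Indep a b) {x : CantorSurface d e w}
    (hx : x ∈ region e w a) : x ∉ region e w b := fun h' =>
  (prefix_or_prefix_of_mem_region hx h').elim h.1 h.2

theorem mixTwist_child (h0 : (i₀ : ℕ) = 0) (h1 : (i₁ : ℕ) = 1) {s : ℝ} (hs : s = 1 ∨ s = -1)
    {z : ℂ} (hz : z ∈ holedDisc) {u : List (Fin d)} {y : Block d w}
    (h : mixChart e w v i₀ z = ofBlock e w (v ++ [i₁] ++ u) y) :
    mixChart e w v i₀ (mixTwist s z) = ofBlock e w (v ++ [i₀, i₀] ++ u) y := by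
  obtain ⟨hz', x, hx⟩ := mixChart_mem_region_child h0 h1 hz (h ▸ ofBlock_append_mem_region _ _ _)
  obtain ⟨h2, h3, h4⟩ := mixChart_hole (e := e) (w := w) (v := v) h0 h1 hz' hx
  rw [mixTwist_of_le hs h2, h4]
  rw [h3] at h
  have h5 : ofBlock e w (v ++ [i₁] ++ []) (top w x) = ofBlock e w (v ++ [i₁] ++ u) y := by
    rwa [List.append_nil]
  simpa using ofBlock_append_congr (a' := v ++ [i₀, i₀]) h5

theorem mixTwist_grandchild (h0 : (i₀ : ℕ) = 0) (h1 : (i₁ : ℕ) = 1) {s : ℝ}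
    (hs : s = 1 ∨ s = -1) {z : ℂ} (hz : z ∈ holedDisc) {u : List (Fin d)} {y : Block d w}
    (h : mixChart e w v i₀ z = ofBlock e w (v ++ [i₀, i₀] ++ u) y) :
    mixChart e w v i₀ (mixTwist s z) = ofBlock e w (v ++ [i₁] ++ u) y := by
  obtain ⟨hz', x, hx⟩ := mixChart_mem_region_grandchild h0 hz (h ▸ ofBlock_append_mem_region _ _ _)
  obtain ⟨h2, h3, h4⟩ := mixChart_hole (e := e) (w := w) (v := v) h0 h1 hz' hx
  rw [mixTwist_of_le hs (by simpa using h2), h3]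
  rw [neg_neg] at h4
  rw [h4] at h
  have h5 : ofBlock e w (v ++ [i₀, i₀] ++ []) (top w x) = ofBlock e w (v ++ [i₀, i₀] ++ u) y := by
    rwa [List.append_nil]
  simpa using ofBlock_append_congr (a' := v ++ [i₁]) h5

theorem indep_child_grandchild' (h0 : (i₀ : ℕ) = 0) (h1 : (i₁ : ℕ) = 1) :
    Indep (v ++ [i₁]) (v ++ [i₀, i₀]) :=
  indep_child_grandchild fun h => by rw [h] at h1; omega

theorem MixGraph.unique (h0 : (i₀ : ℕ) = 0) (h1 : (i₁ : ℕ) = 1) {s : ℝ} (hs : s = 1 ∨ s = -1)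
    {x x' x'' : CantorSurface d e w} (h : MixGraph e w v i₀ i₁ s x x')
    (h' : MixGraph e w v i₀ i₁ s x x'') : x' = x'' := by
  have hi := indep_child_grandchild' (v := v) h0 h1
  have hc : ∀ u y, ofBlock e w (v ++ [i₁] ++ u) y ∈ region e w (v ++ [i₁]) :=
    ofBlock_append_mem_region _
  have hg : ∀ u y, ofBlock e w (v ++ [i₀, i₀] ++ u) y ∈ region e w (v ++ [i₀, i₀]) :=
    ofBlock_append_mem_region _
  generalize hy : x = y at h'
  cases h with
  | chart z hz =>
    cases h' with
    | chart z' hz' => rw [mixChart_injOn h0 hz hz' hy]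
    | child u y => exact mixTwist_child h0 h1 hs hz hy
    | grandchild u y => exact mixTwist_grandchild h0 h1 hs hz hy
    | rest _ hx _ _ => exact absurd hy (hx z hz)
  | child u y =>
    cases h' with
    | chart z hz => exact (mixTwist_child h0 h1 hs hz hy.symm).symm
    | child u' y' => exact ofBlock_append_congr hy
    | grandchild u' y' => exact absurd (hy ▸ hg u' y') (not_mem_region_of_indep hi (hc u y))
    | rest _ _ hx _ => exact absurd (hy ▸ hc u y) hx
  | grandchild u y =>
    cases h' with
    | chart z hz => exact (mixTwist_grandchild h0 h1 hs hz hy.symm).symm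
    | child u' y' => exact absurd (hy ▸ hc u' y') (not_mem_region_of_indep hi.symm (hg u y))
    | grandchild u' y' => exact ofBlock_append_congr hy
    | rest _ _ _ hx => exact absurd (hy ▸ hg u y) hx
  | rest _ hx h2 h3 =>
    cases h' with
    | chart z hz => exact absurd hy.symm (hx z hz)
    | child u y => exact absurd (hy ▸ hc u y) h2
    | grandchild u y => exact absurd (hy ▸ hg u y) h3
    | rest _ _ _ _ => exact hy

variable (e w v i₀ i₁) in
/-- The map with graph `MixGraph`. -/
def mixMap (s : ℝ) (x : CantorSurface d e w) : CantorSurface d e w :=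
  (MixGraph.total (v := v) (i₀ := i₀) (i₁ := i₁) s x).choose

theorem mixGraph_mixMap (s : ℝ) (x : CantorSurface d e w) :
    MixGraph e w v i₀ i₁ s x (mixMap e w v i₀ i₁ s x) :=
  (MixGraph.total (v := v) (i₀ := i₀) (i₁ := i₁) s x).choose_spec

theorem mixMap_eq (h0 : (i₀ : ℕ) = 0) (h1 : (i₁ : ℕ) = 1) {s : ℝ} (hs : s = 1 ∨ s = -1)
    {x x' : CantorSurface d e w} (h : MixGraph e w v i₀ i₁ s x x') :
    mixMap e w v i₀ i₁ s x = x' :=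
  (mixGraph_mixMap s x).unique h0 h1 hs h

theorem mixMap_neg_mixMap (h0 : (i₀ : ℕ) = 0) (h1 : (i₁ : ℕ) = 1) {s : ℝ}
    (hs : s = 1 ∨ s = -1) (x : CantorSurface d e w) :
    mixMap e w v i₀ i₁ (-s) (mixMap e w v i₀ i₁ s x) = x := by
  have hs' : -s = 1 ∨ -s = -1 := by
    rcases hs with rfl | rfl
    · exact Or.inr rfl
    · exact Or.inl (neg_neg 1)
  exact mixMap_eq h0 h1 hs' ((mixGraph_mixMap s x).inverse hs)

theorem mixMap_ofBase (h0 : (i₀ : ℕ) = 0) (h1 : (i₁ : ℕ) = 1) {s : ℝ} (hs : s = 1 ∨ s = -1)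
    (b : Base e) : mixMap e w v i₀ i₁ s (ofBase e w b) = ofBase e w b := by
  refine mixMap_eq h0 h1 hs (.rest _ (fun z hz => mixChart_ne_ofBase h0 hz b) ?_ ?_)
  · intro h
    simpa using (ofBase_mem_region.1 h).1
  · intro h
    simpa using (ofBase_mem_region.1 h).1

/-- A block that is neither one of the two blocks of the chart nor in one of the two moved regions
is fixed. -/
theorem mixMap_ofBlock (h0 : (i₀ : ℕ) = 0) (h1 : (i₁ : ℕ) = 1) {s : ℝ} (hs : s = 1 ∨ s = -1)
    {u : List (Fin d)} (hu : u ≠ v) (hu0 : u ≠ v ++ [i₀]) (hu1 : ¬ v ++ [i₁] <+: u)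
    (hu2 : ¬ v ++ [i₀, i₀] <+: u) (y : Block d w) :
    mixMap e w v i₀ i₁ s (ofBlock e w u y) = ofBlock e w u y := by
  refine mixMap_eq h0 h1 hs (.rest _ (fun z hz h => ?_) ?_ ?_)
  · rcases mixChart_mem_block h0 h1 hz h with h | h | h | h
    · exact hu h
    · exact hu0 h
    · exact hu1 (h ▸ List.prefix_rfl)
    · exact hu2 (h ▸ List.prefix_rfl)
  · intro h
    rcases ofBlock_mem_region.1 h with h | ⟨i, x, h, -⟩
    · exact hu1 h
    · exact hu (List.append_inj' h rfl).1.symm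
  · intro h
    rcases ofBlock_mem_region.1 h with h | ⟨i, x, h, -⟩
    · exact hu2 h
    · refine hu0 ?_
      have h2 : v ++ [i₀] ++ [i₀] = u ++ [i] := by simpa using h
      exact (List.append_inj' h2 rfl).1.symm

/-- The half twist is the identity on the part of the block of `v` outside the disc. -/
theorem mixMap_upper_compl (h0 : (i₀ : ℕ) = 0) (h1 : (i₁ : ℕ) = 1) {s : ℝ} (hs : s = 1 ∨ s = -1)
    {y : Block d w} (hy : y ∈ halfDiscCompl 1) :
    mixMap e w v i₀ i₁ s (ofBlock e w v y) = ofBlock e w v y := by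
  by_cases h : ∃ z ∈ holedDisc, mixChart e w v i₀ z = ofBlock e w v y
  · obtain ⟨z, hz, h⟩ := h
    obtain ⟨hz', rfl⟩ := mixChart_eq_upper h0 hz h
    rw [← h, mixMap_eq h0 h1 hs (.chart z hz), mixTwist_of_ge s (norm_of_mem_halfDiscCompl hz' hy)]
  · push Not at h
    refine mixMap_eq h0 h1 hs (.rest _ h (fun h2 => ?_) fun h2 => ?_)
    · rcases ofBlock_mem_region.1 h2 with h3 | ⟨i, x, h3, rfl⟩
      · simpa using h3.length_le
      · obtain rfl : i₁ = i := by simpa using h3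
        exact bdry_not_mem_halfDiscCompl h1 x hy
    · rcases ofBlock_mem_region.1 h2 with h3 | ⟨i, x, h3, -⟩
      · simpa using h3.length_le
      · simpa using congrArg List.length h3

theorem mixMap_lower_compl (h0 : (i₀ : ℕ) = 0) (h1 : (i₁ : ℕ) = 1) {s : ℝ} (hs : s = 1 ∨ s = -1)
    {y : Block d w} (hy : y ∈ halfDiscCompl 0) :
    mixMap e w v i₀ i₁ s (ofBlock e w (v ++ [i₀]) y) = ofBlock e w (v ++ [i₀]) y := by
  by_cases h : ∃ z ∈ holedDisc, mixChart e w v i₀ z = ofBlock e w (v ++ [i₀]) y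
  · obtain ⟨z, hz, h⟩ := h
    obtain ⟨hz', rfl⟩ := mixChart_eq_lower h0 hz h
    have h2 := norm_of_mem_halfDiscCompl hz' hy
    rw [norm_neg] at h2
    rw [← h, mixMap_eq h0 h1 hs (.chart z hz), mixTwist_of_ge s h2]
  · push Not at h
    refine mixMap_eq h0 h1 hs (.rest _ h (fun h2 => ?_) fun h2 => ?_)
    · rcases ofBlock_mem_region.1 h2 with h3 | ⟨i, x, h3, -⟩
      · have h4 : i₁ = i₀ := by simpa using h3.eq_of_length (by simp)
        rw [h4] at h1
        omega
      · simpa using congrArg List.length h3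
    · rcases ofBlock_mem_region.1 h2 with h3 | ⟨i, x, h3, rfl⟩
      · simpa using h3.length_le
      · obtain rfl : i₀ = i := by simpa using h3
        exact bdry_not_mem_halfDiscCompl h0 x hy

/-- Continuity on the image of a compact set can be checked after composition. -/
theorem continuousOn_image_of_isCompact {A B C : Type*} [TopologicalSpace A] [TopologicalSpace B]
    [T2Space B] [TopologicalSpace C] {K : Set A} (hK : IsCompact K) {r : A → B}
    (hr : ContinuousOn r K) {g : B → C} (hg : ContinuousOn (g ∘ r) K) :
    ContinuousOn g (r '' K) := by
  rw [continuousOn_iff_isClosed]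
  intro t ht
  obtain ⟨u, hu, hut⟩ := continuousOn_iff_isClosed.1 hg t ht
  refine ⟨r '' (K ∩ u), ((hK.inter_right hu).image_of_continuousOn
    (hr.mono Set.inter_subset_left)).isClosed, ?_⟩
  rw [Set.inter_comm K u, ← hut]
  ext b
  constructor
  · rintro ⟨h1, a, ha, rfl⟩
    exact ⟨⟨a, ⟨h1, ha⟩, rfl⟩, a, ha, rfl⟩
  · rintro ⟨⟨a, ⟨h1, ha⟩, rfl⟩, h2⟩
    exact ⟨h1, h2⟩

theorem continuousOn_mixChart (h0 : (i₀ : ℕ) = 0) :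
    ContinuousOn (mixChart e w v i₀) holedDisc := by
  have h1 : holedDisc = halfDisc ∪ Neg.neg ⁻¹' halfDisc := rfl
  rw [h1]
  refine ContinuousOn.union_of_isClosed ?_ ?_ isCompact_halfDisc.isClosed
    (isCompact_halfDisc.isClosed.preimage continuous_neg)
  · exact ((continuous_ofBlock v).comp_continuousOn (continuousOn_halfDiscMap 1)).congr
      fun z hz => mixChart_of_mem hz
  · refine ContinuousOn.congr ?_ fun z hz => mixChart_of_neg_mem h0 hz
    exact (continuous_ofBlock _).comp_continuousOn
      ((continuousOn_halfDiscMap 0).comp continuous_neg.continuousOn fun z hz => hz)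

/-- Continuity on a block can be checked on the half disc and on its closed complement. -/
theorem continuous_of_halfDiscMap [T2Space Y] {Z : Type*} [TopologicalSpace Z] {m : ℕ}
    (hm : m < d) {g : Block d w → Z} (h1 : ContinuousOn (g ∘ halfDiscMap d w m) halfDisc)
    (h2 : ContinuousOn g (halfDiscCompl m)) : Continuous g := by
  have h3 := continuousOn_image_of_isCompact isCompact_halfDisc (continuousOn_halfDiscMap m) h1
  have h4 : IsClosed (halfDiscMap d w m '' halfDisc) :=
    (isCompact_halfDisc.image_of_continuousOn (continuousOn_halfDiscMap m)).isClosed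
  have h5 := h2.union_of_isClosed h3 (isClosed_halfDiscCompl m) h4
  rw [← continuousOn_univ]
  refine h5.mono fun y _ => ?_
  rcases mem_halfDiscCompl_or hm y with h | ⟨z, hz, rfl⟩
  · exact Or.inl h
  · exact Or.inr ⟨z, hz, rfl⟩

theorem continuous_mixMap [T2Space Y] (h0 : (i₀ : ℕ) = 0) (h1 : (i₁ : ℕ) = 1) {s : ℝ}
    (hs : s = 1 ∨ s = -1) : Continuous (mixMap e w v i₀ i₁ s) := by
  have hchart : ContinuousOn (fun z => mixChart e w v i₀ (mixTwist s z)) holedDisc :=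
    (continuousOn_mixChart h0).comp (continuous_twist _ _ _).continuousOn
      fun z hz => mixTwist_mem hs hz
  refine continuous_iff_comp.2 ⟨?_, fun u => ?_⟩
  · exact continuous_ofBase.congr fun b => (mixMap_ofBase h0 h1 hs b).symm
  by_cases hu : u = v
  · subst hu
    refine continuous_of_halfDiscMap (m := 1) (by omega) ?_ ?_
    · refine (hchart.mono fun z hz => Or.inl hz).congr fun z hz => ?_
      rw [Function.comp_apply, Function.comp_apply, ← mixChart_of_mem (i₀ := i₀) hz,
        mixMap_eq h0 h1 hs (.chart z (Or.inl hz))]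
    · exact (continuous_ofBlock u).continuousOn.congr fun y hy => mixMap_upper_compl h0 h1 hs hy
  by_cases hu0 : u = v ++ [i₀]
  · subst hu0
    refine continuous_of_halfDiscMap (m := 0) (by omega) ?_ ?_
    · have h2 : ContinuousOn (fun z => mixChart e w v i₀ (mixTwist s (-z))) halfDisc :=
        hchart.comp continuous_neg.continuousOn fun z hz => Or.inr (by simpa using hz)
      refine h2.congr fun z hz => ?_
      have h3 := mixChart_of_neg_mem (e := e) (w := w) (v := v) h0 (z := -z) (by simpa using hz)
      rw [neg_neg] at h3
      rw [Function.comp_apply, Function.comp_apply, ← h3,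
        mixMap_eq h0 h1 hs (.chart (-z) (Or.inr (by simpa using hz)))]
    · exact (continuous_ofBlock _).continuousOn.congr fun y hy => mixMap_lower_compl h0 h1 hs hy
  by_cases hu1 : v ++ [i₁] <+: u
  · obtain ⟨t, rfl⟩ := hu1
    exact (continuous_ofBlock (v ++ [i₀, i₀] ++ t)).congr fun y =>
      (mixMap_eq h0 h1 hs (.child t y)).symm
  by_cases hu2 : v ++ [i₀, i₀] <+: u
  · obtain ⟨t, rfl⟩ := hu2
    exact (continuous_ofBlock (v ++ [i₁] ++ t)).congr fun y =>
      (mixMap_eq h0 h1 hs (.grandchild t y)).symm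
  exact (continuous_ofBlock u).congr fun y => (mixMap_ofBlock h0 h1 hs hu hu0 hu1 hu2 y).symm

theorem swappable_child_grandchild [T2Space Y] (h0 : (i₀ : ℕ) = 0) (h1 : (i₁ : ℕ) = 1) :
    Swappable e w (v ++ [i₁]) (v ++ [i₀, i₀]) := by
  have hs : (1 : ℝ) = 1 ∨ (1 : ℝ) = -1 := Or.inl rfl
  have hs' : (-1 : ℝ) = 1 ∨ (-1 : ℝ) = -1 := Or.inr rfl
  let f : CantorSurface d e w ≃ₜ CantorSurface d e w :=
    { toFun := mixMap e w v i₀ i₁ 1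
      invFun := mixMap e w v i₀ i₁ (-1)
      left_inv := mixMap_neg_mixMap h0 h1 hs
      right_inv := fun x => by
        have := mixMap_neg_mixMap (v := v) h0 h1 hs' x
        rwa [neg_neg] at this
      continuous_toFun := continuous_mixMap h0 h1 hs
      continuous_invFun := continuous_mixMap h0 h1 hs' }
  have hf : ∀ x, f x = mixMap e w v i₀ i₁ 1 x := fun x => rfl
  refine ⟨f, ?_, fun u => ⟨1, rfl, fun y => ?_⟩, fun u => ⟨1, rfl, fun y => ?_⟩,
    fun c hc1 hc2 u => ⟨1, rfl, fun y => ?_⟩⟩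
  · rintro _ ⟨b, rfl⟩
    exact mixMap_ofBase h0 h1 hs b
  · rw [hf, mixMap_eq h0 h1 hs (.child u y)]
    simp
  · rw [hf, mixMap_eq h0 h1 hs (.grandchild u y)]
    simp
  · rw [hf, mixMap_ofBlock h0 h1 hs]
    · simp
    · intro h
      refine hc1.1 ((List.prefix_append c u).trans ?_)
      rw [h]
      exact List.prefix_append _ _
    · intro h
      refine hc2.1 ((List.prefix_append c u).trans ?_)
      rw [h]
      exact ⟨[i₀], by simp⟩
    · exact fun h => (hc1.append_left u).2 h
    · exact fun h => (hc2.append_left u).2 h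

/-- Blocks of the Cantor surface admit the basic swaps. -/
theorem hasBasicSwaps [T2Space Y] (h0 : (i₀ : ℕ) = 0) (h1 : (i₁ : ℕ) = 1) :
    HasBasicSwaps e w i₀ i₁ where
  ne h := by rw [h] at h0; omega
  mix v := swappable_child_grandchild h0 h1
  perm v σ := by
    classical
    obtain ⟨s, rfl⟩ := homeoPerm_surjective (w := w) d σ
    let k : List (Fin d) → blockHomeo d w := fun u => if u = v then s else 1
    have hk : ∀ u, u ≠ v → k u = 1 := fun u hu => if_neg hu
    have hkv : k v = s := if_pos rfl
    have hmove : ∀ c, (∀ u, c ++ u ≠ v) → ActsOnRegion (portraitHomeo e k) c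
        (treeMap (fun v => q d w (QuotientGroup.mk (k v))) c) 1 := fun c hc =>
      actsOnRegion_portraitHomeo fun u => hk _ (hc u)
    have hq : ∀ u, u ≠ v → q d w (QuotientGroup.mk (k u)) = 1 := by
      intro u hu
      rw [hk u hu, QuotientGroup.mk_one, map_one]
    refine ⟨portraitHomeo e k, portraitHomeo_mem k, fun i => ?_, fun c hc => ?_⟩
    · have h2 := hmove (v ++ [i]) fun u hu => by simpa using congrArg List.length hu
      rw [treeMap_append_singleton, treeMap_eq_self, hkv] at h2
      · exact h2
      · intro u j hu
        refine hq u ?_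
        rintro rfl
        simpa using hu.length_le
    · have h2 := hmove c fun u hu => hc.1 ⟨u, hu⟩
      rw [treeMap_eq_self] at h2
      · exact h2
      · intro u j hu
        refine hq u ?_
        rintro rfl
        exact hc.2 ((List.prefix_append _ _).trans hu)

end Mix

/-! ### The block mapping class group and its action on the ends -/

section Groups

variable {d : ℕ} {O Y : Type*} [TopologicalSpace O] [TopologicalSpace Y]
  {w : CoordPlane Y}

variable (e : CoordPlane O) in
/-- The block mapping class group `𝔅_d(H)`. -/
def blockMCG [CompactSpace O] [T2Space O] [CompactSpace Y] [T2Space Y] (hd : 0 < d)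
    (H : Subgroup (BlockMCG d w)) : Subgroup (CantorMCG d e w) where
  carrier := blockClasses e H
  one_mem' := ⟨1, isHBlock_one H, rfl⟩
  mul_mem' := by
    rintro _ _ ⟨f, hf, rfl⟩ ⟨g, hg, rfl⟩
    exact ⟨f * g, hf.mul hd hg, rfl⟩
  inv_mem' := by
    rintro _ ⟨f, hf, rfl⟩
    exact ⟨f⁻¹, hf.inv, rfl⟩

variable {e : CoordPlane O}

theorem IsHBlock.exists_endAction {H : Subgroup (BlockMCG d w)}
    {f : CantorSurface d e w ≃ₜ CantorSurface d e w} (hf : IsHBlock H f) :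
    ∃ ψ ∈ symHigmanThompson (H.map (q d w)), EndAction f ψ := by
  obtain ⟨F, F', b, h, hH, hb⟩ := isHBlock_iff_matchesLeaves.1 hf
  exact ⟨_, ⟨F, F', b, fun a => q d w (h a), fun a => ⟨h a, hH a, rfl⟩,
    isSymTreePair_treePairHomeo _ _ _ _⟩, hb.endAction⟩

theorem EndAction.unique_homeo {f : CantorSurface d e w ≃ₜ CantorSurface d e w}
    {ψ χ : InfWord d ≃ₜ InfWord d} (h : EndAction f ψ) (h' : EndAction f χ) : ψ = χ :=
  DFunLike.coe_injective (h.unique h')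

theorem endAction_one : EndAction (1 : CantorSurface d e w ≃ₜ CantorSurface d e w) id :=
  fun c n => ⟨n, by rintro _ ⟨x, hx, rfl⟩; exact hx⟩

/-- Isotopic homeomorphisms act in the same way on the ends. -/
theorem EndAction.of_mk_eq [T2Space O] [T2Space Y] {f g : cantorHomeo d e w}
    {ψ : InfWord d → InfWord d} (h : EndAction f.1 ψ)
    (hfg : (QuotientGroup.mk f : CantorMCG d e w) = QuotientGroup.mk g) : EndAction g.1 ψ := by
  have h1 := endAction_id_of_isotopic (Subgroup.mem_subgroupOf.1 (QuotientGroup.eq.1 hfg))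
  have h2 := h.mul h1
  have h3 : f.1 * (f⁻¹ * g : cantorHomeo d e w).1 = g.1 := by simp
  rw [h3] at h2
  exact h2

/-- Every element of the symmetric Higman-Thompson group is the action on the ends of an `H`-block
homeomorphism. -/
theorem exists_isHBlock_endAction [T2Space Y] (hd : 2 ≤ d) {H : Subgroup (BlockMCG d w)}
    {ψ : InfWord d ≃ₜ InfWord d} (hψ : ψ ∈ symHigmanThompson (H.map (q d w))) :
    ∃ f : cantorHomeo d e w, IsHBlock H f.1 ∧ EndAction f.1 ψ := by
  obtain ⟨F, F', b, g, hg, hψ⟩ := hψ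
  choose h hH hq using hg
  have hS : HasBasicSwaps e w (⟨0, by omega⟩ : Fin d) ⟨1, by omega⟩ := hasBasicSwaps rfl rfl
  obtain ⟨f, hf, hfb⟩ := hS.exists_matchesLeaves F F' b h
  refine ⟨⟨f, baseFixing_le_cantorHomeo hf⟩,
    isHBlock_iff_matchesLeaves.2 ⟨F, F', b, h, hH, hfb⟩, ?_⟩
  have h1 := hfb.endAction
  have h2 : (fun a => q d w (h a)) = g := funext hq
  rwa [h2, ← hψ.eq_treePairHomeo] at h1

variable (e) in
/-- The symmetric Higman-Thompson group `V_d(H̄)`. That it is closed under multiplication and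
inverses follows from the same fact for `H`-block homeomorphisms, since its elements are the
actions of these on the ends. -/
def symHigmanThompsonGroup [CompactSpace O] [T2Space O] [CompactSpace Y] [T2Space Y] (hd : 2 ≤ d)
    (H : Subgroup (BlockMCG d w)) : Subgroup (InfWord d ≃ₜ InfWord d) where
  carrier := symHigmanThompson (H.map (q d w))
  one_mem' := by
    obtain ⟨ψ, hψ, h⟩ := (isHBlock_one (e := e) H).exists_endAction
    have h1 : (1 : InfWord d ≃ₜ InfWord d) = ψ := EndAction.unique_homeo endAction_one h
    rwa [h1]
  mul_mem' := by
    intro ψ χ hψ hχ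
    obtain ⟨f, hf, hfψ⟩ := exists_isHBlock_endAction (e := e) hd hψ
    obtain ⟨g, hg, hgχ⟩ := exists_isHBlock_endAction (e := e) hd hχ
    obtain ⟨ω, hω, h⟩ := (hf.mul (by omega) hg).exists_endAction
    have h1 : ψ * χ = ω := EndAction.unique_homeo (hfψ.mul hgχ) h
    rwa [h1]
  inv_mem' := by
    intro ψ hψ
    obtain ⟨f, hf, hfψ⟩ := exists_isHBlock_endAction (e := e) hd hψ
    obtain ⟨ω, hω, h⟩ := hf.inv.exists_endAction
    have h1 := hfψ.mul h
    rw [mul_inv_cancel] at h1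
    have h2 : 1 = ψ * ω := EndAction.unique_homeo endAction_one h1
    rwa [inv_eq_of_mul_eq_one_right h2.symm]

theorem exists_class_endAction [T2Space O] [T2Space Y] {H : Subgroup (BlockMCG d w)}
    {x : CantorMCG d e w} (hx : x ∈ blockClasses e H) :
    ∃ ψ ∈ symHigmanThompson (H.map (q d w)),
      ∀ f : cantorHomeo d e w, QuotientGroup.mk f = x → EndAction f.1 ψ := by
  obtain ⟨f, hf, rfl⟩ := hx
  obtain ⟨ψ, hψ, h⟩ := hf.exists_endAction
  exact ⟨ψ, hψ, fun g hg => h.of_mk_eq hg.symm⟩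

variable (e) in
/-- The homomorphism `𝔅_d(H) → V_d(H̄)` that records the action on the ends. -/
def endHom [CompactSpace O] [T2Space O] [CompactSpace Y] [T2Space Y] (hd : 2 ≤ d)
    (H : Subgroup (BlockMCG d w)) :
    blockMCG e (by omega) H →* symHigmanThompsonGroup e hd H :=
  MonoidHom.mk' (fun x => ⟨(exists_class_endAction x.2).choose,
    (exists_class_endAction x.2).choose_spec.1⟩) (by
      rintro ⟨x, hx⟩ ⟨y, hy⟩
      obtain ⟨f, rfl⟩ := QuotientGroup.mk_surjective x
      obtain ⟨g, rfl⟩ := QuotientGroup.mk_surjective y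
      apply Subtype.ext
      refine EndAction.unique_homeo
        ((exists_class_endAction (mul_mem hx hy)).choose_spec.2 (f * g) rfl) ?_
      exact ((exists_class_endAction hx).choose_spec.2 f rfl).mul
        ((exists_class_endAction hy).choose_spec.2 g rfl))

theorem endAction_endHom [CompactSpace O] [T2Space O] [CompactSpace Y] [T2Space Y] (hd : 2 ≤ d)
    (H : Subgroup (BlockMCG d w)) (f : cantorHomeo d e w)
    (hf : QuotientGroup.mk f ∈ blockMCG e (by omega) H) :
    EndAction f.1 (endHom e hd H ⟨QuotientGroup.mk f, hf⟩ : InfWord d ≃ₜ InfWord d) :=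
  (exists_class_endAction hf).choose_spec.2 f rfl

end Groups

end CantorSurf

end

theorem proposition4p1 {d : ℕ} (hd : 2 ≤ d)
    {O : Type*} [TopologicalSpace O] [T2Space O] [SecondCountableTopology O] [CompactSpace O]
    [ConnectedSpace O] (hO : CantorSurf.IsOrientableSurface O)
    {Y : Type*} [TopologicalSpace Y] (hY : CantorSurf.IsSphereOrTorus Y)
    (e : CantorSurf.CoordPlane O) (w : CantorSurf.CoordPlane Y)
    (H : Subgroup (CantorSurf.BlockMCG d w)) :
    -- `𝔅_d(H)` and `V_d(H̄)` are groups, and there is a homomorphism `π` between them such that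
    ∃ (B : Subgroup (CantorSurf.CantorMCG d e w))
      (V : Subgroup (CantorSurf.InfWord d ≃ₜ CantorSurf.InfWord d)) (π : B →* V),
      (B : Set (CantorSurf.CantorMCG d e w)) = CantorSurf.blockClasses e H ∧
      (V : Set (CantorSurf.InfWord d ≃ₜ CantorSurf.InfWord d)) =
        CantorSurf.symHigmanThompson (H.map (CantorSurf.q d w)) ∧
      -- `π` sends the class of `(Z, (f_Z, h), f(Z))` to `(τ(Z), (b_f, q(h)), τ(f(Z)))`,
      (∀ (f : CantorSurf.cantorHomeo d e w) (hf : QuotientGroup.mk f ∈ B)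
        (F F' : CantorSurf.FinTree d) (h : F.Leaf → CantorSurf.BlockMCG d w),
        CantorSurf.IsDefining f.1 F F' → (∀ a, h a ∈ H) →
        CantorSurf.EventuallyActsLike f.1 F h →
        ∃ b : F.Leaf ≃ F'.Leaf,
          (∀ a, f.1 '' CantorSurf.curve e w a.1 = CantorSurf.curve e w (b a).1) ∧
          CantorSurf.IsSymTreePair F F' b (fun a => CantorSurf.q d w (h a))
            (π ⟨QuotientGroup.mk f, hf⟩ : CantorSurf.InfWord d ≃ₜ CantorSurf.InfWord d)) ∧
      -- `π` records the action on the ends,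
      (∀ (f : CantorSurf.cantorHomeo d e w) (hf : QuotientGroup.mk f ∈ B)
        (c : CantorSurf.InfWord d) (n : ℕ), ∃ m : ℕ,
        f.1 '' CantorSurf.region e w (CantorSurf.initSeg c m) ⊆
          CantorSurf.region e w (CantorSurf.initSeg
            ((π ⟨QuotientGroup.mk f, hf⟩ : CantorSurf.InfWord d ≃ₜ CantorSurf.InfWord d) c) n)) ∧
      -- and `π` is surjective.
      Function.Surjective π := by
  have := hY.t2Space
  have := hY.compactSpace
  refine ⟨CantorSurf.blockMCG e (by omega) H, CantorSurf.symHigmanThompsonGroup e hd H,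
    CantorSurf.endHom e hd H, rfl, rfl, fun f hf F F' h hF _ hh => ?_, fun f hf c n => ?_,
    fun ⟨ψ, hψ⟩ => ?_⟩
  · obtain ⟨b, hb⟩ := CantorSurf.exists_matchesLeaves hF hh
    refine ⟨b, fun a => (hb a).image_curve, ?_⟩
    rw [CantorSurf.EndAction.unique_homeo (CantorSurf.endAction_endHom hd H f hf) hb.endAction]
    exact CantorSurf.isSymTreePair_treePairHomeo _ _ _ _
  · exact CantorSurf.endAction_endHom hd H f hf c n
  · obtain ⟨f, hf, hfψ⟩ := CantorSurf.exists_isHBlock_endAction (e := e) hd hψ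
    refine ⟨⟨QuotientGroup.mk f, f, hf, rfl⟩, Subtype.ext ?_⟩
    exact CantorSurf.EndAction.unique_homeo (CantorSurf.endAction_endHom hd H f _) hfψ
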